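/- Let $N\ge 1$, let $\Omega\subseteq\mathbb R^N$ be a bounded domain with $C^2$-boundary, and let $1<p<\infty$. Put $p^*=\frac{Np}{N-p}$ if $p<N$ and $p^*=+\infty$ if $p\ge N$. Let $\hat\lambda_1(p)$ be the smallest eigenvalue of $-\Delta_p$ on $W^{1,p}_0(\Omega)$, and write $L^\infty(\Omega)_+$ for the nonnegative functions in $L^\infty(\Omega)$. Let $\vartheta\in C^1(0,\infty)$ and constants $\hat c,c_0,c_1,c_2>0$ satisfy $$\hat c\le \frac{t\vartheta'(t)}{\vartheta(t)}\le c_0,\qquad c_1t^{p-1}\le\vartheta(t)\le c_2(1+t^{p-1})\qquad\text{for all }t>0 .$$ **Hypotheses H(a)$_1$.** $a(\xi)=a_0(\|\xi\|)\xi$ for $\xi\in\mathbb R^N$, where $a_0(t)>0$ for $t>0$, and with $G_0(t)=\int_0^t s\,a_0(s)\,ds$: (i) $a_0\in C^1(0,\infty)$, $t\mapsto t a_0(t)$ is strictly increasing on $(0,\infty)$, $\lim_{t\to0^+}ta_0(t)=0$, and $\lim_{t\to0^+}\frac{ta_0'(t)}{a_0(t)}$ exists and is $>-1$; (ii) $\|\nabla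 a(\xi)\|\le c_3\frac{\vartheta(\|\xi\|)}{\|\xi\|}$ for all $\xi\ne0$ and some $c_3>0$; (iii) $(\nabla a(\xi)y,y)\ge\frac{\vartheta(\|\xi\|)}{\|\xi\|}\|y\|^2$ for all $\xi\neq0$, $y\in\mathbb R^N$; (iv) $pG_0(t)-t^2a_0(t)\ge-c_6$ and $t^2a_0(t)-G_0(t)\ge\hat\eta t^p$ for all $t>0$ and some $c_6,\hat\eta>0$. **Hypotheses H(f)$_1$.** $f:\Omega\times\mathbb R\to\mathbb R$ is a Carathéodory function with $f(x,0)=0$ for a.a. $x\in\Omega$ and, with $F(x,s)=\int_0^sf(x,t)\,dt$: (i) $|f(x,s)|\le \alpha(x)(1+|s|^{r-1})$ for a.a. $x\in\Omega$ and all $s\in\mathbb R$, with $\alpha\in L^\infty(\Omega)_+$ and $p<r<p^*$; (ii) $\lim_{s\to\pm\infty}F(x,s)/|s|^p=+\infty$ uniformly for a.a. $x\in\Omega$; (iii) there are $\tau\in\big((r-p)\max\{N/p,1\},p^*\big)$ and $\beta_0>0$ with $\liminf_{s\to\pm\infty}\frac{f(x,s)s-pF(x,s)}{|s|^\tau}\ge\beta_0$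 uniformly for a.a. $x\in\Omega$; (iv) there is $\eta\in L^\infty(\Omega)_+$ with $\eta\le\frac{c_1}{p-1}\hat\lambda_1(p)$ a.e. in $\Omega$, $\eta\not\equiv\frac{c_1}{p-1}\hat\lambda_1(p)$, and $\limsup_{s\to0}\frac{pF(x,s)}{|s|^p}\le\eta(x)$ uniformly for a.a. $x\in\Omega$; (v) for every $\varrho>0$ there is $\kappa_\varrho>0$ with $f(x,s)s+\kappa_\varrho|s|^p\ge0$ for a.a. $x\in\Omega$ and all $|s|\le\varrho$. Define functionals on $X=W^{1,p}_0(\Omega)$ by $$\varphi(u)=\int_\Omega G_0(\|\nabla u\|)\,dx-\int_\Omega F(x,u)\,dx,\qquad \varphi_\pm(u)=\int_\Omega G_0(\|\nabla u\|)\,dx-\int_\Omega F_\pm(x,u)\,dx,$$ where $F_\pm(x,s)=\int_0^sf(x,\pm t^\pm)\,dt$ and $t^\pm=\max\{\pm t,0\}$. For $\psi\in C^1(X)$ let $K_\psi=\{u:\psi'(u)=0\}$. The function $\psi$ satisfies the C-condition if every sequence $(u_n)$ in $X$ with $(\psi(u_n))$ bounded and $(1+\|u_n\|)\psi'(u_n)\to0$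 in $X^*$ has a strongly convergent subsequence. If $\psi$ satisfies the C-condition and $\inf\psi(K_\psi)>-\infty$, the critical groups of $\psi$ at infinity are the relative singular homology groups with integer coefficients $$C_k(\psi,\infty)=H_k\big(X,\{u\in X:\psi(u)\le c\}\big),\qquad k\ge0,$$ where $c<\inf\psi(K_\psi)$ is any such level. **Proposition.** Assume H(a)$_1$ and H(f)$_1$. Then the critical groups at infinity of $\varphi$, $\varphi_+$ and $\varphi_-$ are defined (each of these functionals is of class $C^1$, satisfies the C-condition and has its critical values bounded below), and $$C_k(\varphi,\infty)=0,\qquad C_k(\varphi_+,\infty)=0,\qquad C_k(\varphi_-,\infty)=0\qquad\text{for all }k\ge0,$$ that is, the homology groups above vanish for every level $c$ strictly below the infimum of the functional over its critical set. -/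

import Mathlib

noncomputable section

open MeasureTheory Filter Topology CategoryTheory
open scoped ENNReal ContDiff

namespace EllipticDirichlet

/-! ### Relative singular homology -/

/-- The singular chain complex of a topological space, with integer coefficients. -/
abbrev singularChains : TopCat.{0} ⥤ ChainComplex (ModuleCat.{0} ℤ) ℕ :=
  (AlgebraicTopology.singularChainComplexFunctor (ModuleCat.{0} ℤ)).obj (ModuleCat.of ℤ ℤ)

/-- The inclusion of a subset, as a morphism of topological spaces. -/
abbrev subsetInclusion (X : Type) [TopologicalSpace X] (A : Set X) :
    TopCat.of A ⟶ TopCat.of X :=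
  TopCat.ofHom ⟨Subtype.val, continuous_subtype_val⟩

/-- The relative singular homology group `H_k(X, A)` with integer coefficients: the homology of
the quotient complex `C_*(X) / C_*(A)`. -/
def relativeHomology (X : Type) [TopologicalSpace X] (A : Set X) (k : ℕ) : ModuleCat.{0} ℤ :=
  (Limits.cokernel (singularChains.map (subsetInclusion X A))).homology k

/-! ### Critical point theory -/

section CriticalPoints

variable {X : Type} [NormedAddCommGroup X] [NormedSpace ℝ X]

/-- The critical set `K_φ`. -/
def criticalSet (φ : X → ℝ) : Set X := {u | fderiv ℝ φ u = 0}

/-- The sublevel set `φ^c`. -/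
def sublevel (φ : X → ℝ) (c : ℝ) : Set X := {u | φ u ≤ c}

/-- The infimum of `φ` over its critical set, in the extended reals. -/
def criticalInf (φ : X → ℝ) : EReal := ⨅ u ∈ criticalSet φ, (φ u : EReal)

/-- The Cerami condition (C-condition). -/
def CeramiCondition (φ : X → ℝ) : Prop :=
  ∀ u : ℕ → X, (∃ M : ℝ, ∀ n, |φ (u n)| ≤ M) →
    Tendsto (fun n => (1 + ‖u n‖) • fderiv ℝ φ (u n)) atTop (𝓝 0) →
    ∃ (x : X) (σ : ℕ → ℕ), StrictMono σ ∧ Tendsto (u ∘ σ) atTop (𝓝 x)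

/-- The conditions under which the critical groups of `φ` at infinity are defined: `φ` is of
class `C¹`, satisfies the C-condition, and `inf φ(K_φ) > -∞`. -/
structure AdmitsCriticalGroupsAtInfinity (φ : X → ℝ) : Prop where
  contDiff : ContDiff ℝ 1 φ
  cerami : CeramiCondition φ
  bddBelow : ⊥ < criticalInf φ

/-- `C_k(φ, ∞) = H_k(X, φ^c)`, computed at the level `c`; the admissible levels are those with
`c < inf φ(K_φ)`. -/
def criticalGroupAtInfinity (φ : X → ℝ) (c : ℝ) (k : ℕ) : ModuleCat.{0} ℤ :=
  relativeHomology X (sublevel φ c) k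

/-- The critical groups of `φ` at infinity are defined and they all vanish: `H_k(X, φ^c) = 0` for
all `k ≥ 0`, whichever admissible level `c < inf φ(K_φ)` is used. -/
def CriticalGroupsAtInfinityVanish (φ : X → ℝ) : Prop :=
  AdmitsCriticalGroupsAtInfinity φ ∧
    ∀ c : ℝ, (c : EReal) < criticalInf φ →
      ∀ k : ℕ, Limits.IsZero (criticalGroupAtInfinity φ c k)

end CriticalPoints

/-! ### The domain and the Sobolev space -/

/-- Euclidean space `ℝᴺ`. -/
abbrev E (N : ℕ) : Type := EuclideanSpace ℝ (Fin N)

/-- `Ω` has a boundary of class `C²`: near each boundary point, `Ω` is the set where a `C²`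
function with non-vanishing derivative is negative. -/
def HasC2Boundary {N : ℕ} (Ω : Set (E N)) : Prop :=
  ∀ x ∈ frontier Ω, ∃ ρ : E N → ℝ,
    ContDiffAt ℝ 2 ρ x ∧ fderiv ℝ ρ x ≠ 0 ∧ ∀ᶠ y in 𝓝 x, (y ∈ Ω ↔ ρ y < 0)

instance factOneLeOfReal {p : ℝ} [hp : Fact (1 < p)] : Fact (1 ≤ ENNReal.ofReal p) :=
  ⟨by simpa using ENNReal.ofReal_le_ofReal hp.out.le⟩

section Sobolev

variable {N : ℕ} (Ω : Set (E N)) (p : ℝ)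

/-- The pairs `(ψ, ∇ψ)` with `ψ` a smooth function with compact support in `Ω`, as elements of
`L^p(Ω) × L^p(Ω; ℝᴺ)`. -/
def testPairs : Submodule ℝ
    (Lp ℝ (ENNReal.ofReal p) (volume.restrict Ω) ×
      Lp (E N) (ENNReal.ofReal p) (volume.restrict Ω)) where
  carrier := {w | ∃ ψ : E N → ℝ, ContDiff ℝ ∞ ψ ∧ HasCompactSupport ψ ∧ tsupport ψ ⊆ Ω ∧
    w.1 =ᵐ[volume.restrict Ω] ψ ∧ w.2 =ᵐ[volume.restrict Ω] gradient ψ}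
  zero_mem' := by
    refine ⟨0, contDiff_const, HasCompactSupport.zero, by simp [tsupport], ?_, ?_⟩
    · exact Lp.coeFn_zero _ _ _
    · filter_upwards [Lp.coeFn_zero (E N) (ENNReal.ofReal p) (volume.restrict Ω)] with x hx
      refine hx.trans ?_
      have : fderiv ℝ (0 : E N → ℝ) x = 0 := by simp
      simp [gradient, this]
  add_mem' := by
    rintro a b ⟨ψ, h1, h2, h3, h4, h5⟩ ⟨χ, g1, g2, g3, g4, g5⟩
    refine ⟨ψ + χ, h1.add g1, h2.add g2,
      (tsupport_add ψ χ).trans (Set.union_subset h3 g3), ?_, ?_⟩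
    · exact (Lp.coeFn_add a.1 b.1).trans (h4.add g4)
    · refine (Lp.coeFn_add a.2 b.2).trans ?_
      filter_upwards [h5, g5] with x hx hx'
      have : fderiv ℝ (ψ + χ) x = fderiv ℝ ψ x + fderiv ℝ χ x :=
        fderiv_add (h1.differentiable (by simp) x) (g1.differentiable (by simp) x)
      simp [gradient, this, hx, hx']
  smul_mem' := by
    rintro c a ⟨ψ, h1, h2, h3, h4, h5⟩
    refine ⟨c • ψ, h1.const_smul c, h2.smul_left (f := fun _ => c),
      (closure_mono (Function.support_const_smul_subset c ψ)).trans h3, ?_, ?_⟩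
    · exact (Lp.coeFn_smul c a.1).trans (h4.const_smul c)
    · refine (Lp.coeFn_smul c a.2).trans ?_
      filter_upwards [h5] with x hx
      have : fderiv ℝ (c • ψ) x = c • fderiv ℝ ψ x :=
        fderiv_const_smul (h1.differentiable (by simp) x) c
      simp [gradient, this, hx]

/-- The Sobolev space `W₀^{1,p}(Ω)`: the closure of the smooth compactly supported functions in
the norm of `W^{1,p}(Ω)`, an element being recorded as the pair of the function and its weak
gradient. The norm is `max (‖u‖_p) (‖∇u‖_p)`, which is equivalent to the other usual norms. -/
def W0 [Fact (1 < p)] : Submodule ℝ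
    (Lp ℝ (ENNReal.ofReal p) (volume.restrict Ω) ×
      Lp (E N) (ENNReal.ofReal p) (volume.restrict Ω)) :=
  (testPairs Ω p).topologicalClosure

variable {Ω p}

/-- The function underlying an element of `W₀^{1,p}(Ω)`. -/
def valOf [Fact (1 < p)] (u : W0 Ω p) : E N → ℝ := u.1.1

/-- The weak gradient of an element of `W₀^{1,p}(Ω)`. -/
def gradOf [Fact (1 < p)] (u : W0 Ω p) : E N → E N := u.1.2

variable (Ω p)

/-- `lam` is an eigenvalue of the negative `p`-Laplacian on `W₀^{1,p}(Ω)`: there is a nontrivial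
weak solution `u` of `-Δ_p u = lam |u|^{p-2} u`. -/
def IsPLaplaceEigenvalue [Fact (1 < p)] (lam : ℝ) : Prop :=
  ∃ u : W0 Ω p, u ≠ 0 ∧ ∀ v : W0 Ω p,
    ∫ x in Ω, ‖gradOf u x‖ ^ (p - 2) * inner ℝ (gradOf u x) (gradOf v x) =
      lam * ∫ x in Ω, |valOf u x| ^ (p - 2) * valOf u x * valOf v x

/-- The first (smallest) eigenvalue of the negative `p`-Laplacian on `W₀^{1,p}(Ω)`. -/
def firstEigenvalue [Fact (1 < p)] : ℝ := sInf {lam | IsPLaplaceEigenvalue Ω p lam}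

end Sobolev

/-! ### The differential operator -/

/-- The map `a(ξ) = a₀(‖ξ‖) ξ`. -/
def fieldA {N : ℕ} (a₀ : ℝ → ℝ) (ξ : E N) : E N := a₀ ‖ξ‖ • ξ

/-- `G₀(t) = ∫₀ᵗ s a₀(s) ds`. -/
def G₀ (a₀ : ℝ → ℝ) (t : ℝ) : ℝ := ∫ s in (0 : ℝ)..t, s * a₀ s

/-- The conditions on the comparison function `ϑ`, with the constant `c₁` of its lower bound. -/
structure HypTheta (p : ℝ) (ϑ : ℝ → ℝ) (c₁ : ℝ) : Prop where
  contDiffOn : ContDiffOn ℝ 1 ϑ (Set.Ioi 0)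
  c₁_pos : 0 < c₁
  logDeriv : ∃ c c₀ : ℝ, 0 < c ∧ 0 < c₀ ∧
    ∀ t : ℝ, 0 < t → c ≤ t * deriv ϑ t / ϑ t ∧ t * deriv ϑ t / ϑ t ≤ c₀
  lower : ∀ t : ℝ, 0 < t → c₁ * t ^ (p - 1) ≤ ϑ t
  upper : ∃ c₂ : ℝ, 0 < c₂ ∧ ∀ t : ℝ, 0 < t → ϑ t ≤ c₂ * (1 + t ^ (p - 1))

/-- The hypotheses on the map `a(ξ) = a₀(‖ξ‖) ξ` of `ℝᴺ`. -/
structure HypA (N : ℕ) (p : ℝ) (a₀ ϑ : ℝ → ℝ) : Prop where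
  pos : ∀ t : ℝ, 0 < t → 0 < a₀ t
  contDiffOn : ContDiffOn ℝ 1 a₀ (Set.Ioi 0)
  strictMono : StrictMonoOn (fun t => t * a₀ t) (Set.Ioi 0)
  tendsto_zero : Tendsto (fun t => t * a₀ t) (𝓝[>] 0) (𝓝 0)
  limit : ∃ l : ℝ, -1 < l ∧ Tendsto (fun t => t * deriv a₀ t / a₀ t) (𝓝[>] 0) (𝓝 l)
  upper : ∃ c₃ : ℝ, 0 < c₃ ∧ ∀ ξ : E N, ξ ≠ 0 →
    ‖fderiv ℝ (fieldA a₀) ξ‖ ≤ c₃ * (ϑ ‖ξ‖ / ‖ξ‖)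
  lower : ∀ ξ : E N, ξ ≠ 0 → ∀ y : E N,
    ϑ ‖ξ‖ / ‖ξ‖ * ‖y‖ ^ 2 ≤ inner ℝ (fderiv ℝ (fieldA a₀) ξ y) y
  primitive_upper : ∃ c₆ : ℝ, 0 < c₆ ∧ ∀ t : ℝ, 0 < t → -c₆ ≤ p * G₀ a₀ t - t ^ 2 * a₀ t
  primitive_lower : ∃ η : ℝ, 0 < η ∧ ∀ t : ℝ, 0 < t → η * t ^ p ≤ t ^ 2 * a₀ t - G₀ a₀ t

/-! ### The reaction term -/

/-- The critical Sobolev exponent `p^*`. -/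
def criticalExponent (N : ℕ) (p : ℝ) : EReal :=
  if p < N then ((N * p / (N - p) : ℝ) : EReal) else ⊤

/-- `F(x, s) = ∫₀ˢ f(x, t) dt`. -/
def primitive {N : ℕ} (f : E N → ℝ → ℝ) (x : E N) (s : ℝ) : ℝ := ∫ t in (0 : ℝ)..s, f x t

/-- `f` is a Carathéodory function on `Ω × ℝ`. -/
structure Caratheodory {N : ℕ} (Ω : Set (E N)) (f : E N → ℝ → ℝ) : Prop where
  measurable : ∀ s : ℝ, AEMeasurable (fun x => f x s) (volume.restrict Ω)
  continuous : ∀ᵐ x ∂volume.restrict Ω, Continuous (f x)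

/-- The nonnegative elements of `L^∞(Ω)`. -/
def IsLinftyNonneg {N : ℕ} (Ω : Set (E N)) (g : E N → ℝ) : Prop :=
  MemLp g ⊤ (volume.restrict Ω) ∧ ∀ᵐ x ∂volume.restrict Ω, 0 ≤ g x

/-- The hypotheses on the reaction `f`, where `r` is the growth exponent and `c₁` the constant
of the lower bound of `ϑ`. -/
structure HypF {N : ℕ} (Ω : Set (E N)) (p : ℝ) [Fact (1 < p)] (c₁ r : ℝ) (f : E N → ℝ → ℝ) :
    Prop where
  caratheodory : Caratheodory Ω f
  zero : ∀ᵐ x ∂volume.restrict Ω, f x 0 = 0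
  p_lt_r : p < r
  r_lt : (r : EReal) < criticalExponent N p
  growth : ∃ α : E N → ℝ, IsLinftyNonneg Ω α ∧
    ∀ᵐ x ∂volume.restrict Ω, ∀ s : ℝ, |f x s| ≤ α x * (1 + |s| ^ (r - 1))
  superlinear : ∀ M : ℝ, ∃ R : ℝ, 0 < R ∧
    ∀ᵐ x ∂volume.restrict Ω, ∀ s : ℝ, R ≤ |s| → M ≤ primitive f x s / |s| ^ p
  liminf_infinity : ∃ τ β₀ : ℝ, (r - p) * max (N / p) 1 < τ ∧ (τ : EReal) < criticalExponent N p ∧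
    0 < β₀ ∧ ∀ ε : ℝ, 0 < ε → ∃ R : ℝ, 0 < R ∧
      ∀ᵐ x ∂volume.restrict Ω, ∀ s : ℝ, R ≤ |s| →
        β₀ - ε ≤ (f x s * s - p * primitive f x s) / |s| ^ τ
  limsup_zero : ∃ η : E N → ℝ, IsLinftyNonneg Ω η ∧
    (∀ᵐ x ∂volume.restrict Ω, η x ≤ c₁ / (p - 1) * firstEigenvalue Ω p) ∧
    (¬ ∀ᵐ x ∂volume.restrict Ω, η x = c₁ / (p - 1) * firstEigenvalue Ω p) ∧
    ∀ ε : ℝ, 0 < ε → ∃ δ : ℝ, 0 < δ ∧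
      ∀ᵐ x ∂volume.restrict Ω, ∀ s : ℝ, 0 < |s| → |s| ≤ δ →
        p * primitive f x s / |s| ^ p ≤ η x + ε
  lower_local : ∀ ρ : ℝ, 0 < ρ → ∃ κ : ℝ, 0 < κ ∧
    ∀ᵐ x ∂volume.restrict Ω, ∀ s : ℝ, |s| ≤ ρ → 0 ≤ f x s * s + κ * |s| ^ p

/-- The positive truncation `f₊(x, s) = f(x, s⁺)`. -/
def truncPos {N : ℕ} (f : E N → ℝ → ℝ) (x : E N) (s : ℝ) : ℝ := f x (max s 0)

/-- The negative truncation `f₋(x, s) = f(x, -s⁻)`. -/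
def truncNeg {N : ℕ} (f : E N → ℝ → ℝ) (x : E N) (s : ℝ) : ℝ := f x (-max (-s) 0)

/-- The energy functional `φ(u) = ∫_Ω G(∇u) dx - ∫_Ω F(x, u) dx` on `W₀^{1,p}(Ω)`, where
`G(ξ) = G₀(‖ξ‖)` and `F` is the primitive of `f`. -/
def energy {N : ℕ} (Ω : Set (E N)) (p : ℝ) [Fact (1 < p)] (a₀ : ℝ → ℝ) (f : E N → ℝ → ℝ)
    (u : W0 Ω p) : ℝ :=
  (∫ x in Ω, G₀ a₀ ‖gradOf u x‖) - ∫ x in Ω, primitive f x (valOf u x)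

end EllipticDirichlet

end

noncomputable section

open MeasureTheory Filter Topology CategoryTheory
open scoped ENNReal ContDiff

namespace EllipticDirichlet

/-! ### Homology of pairs of contractible spaces -/

/-! A normed space is contractible, so all groups H_k(X, φ^c) vanish once the sublevel φ^c is itself
contractible. This is shown first at one very low level and then carried up to every level below the
critical values.

Low levels. The bound on t²a₀ − pG₀ and the lower bound on f(x,s)s − pF(x,s) give φ'(u)u ≤ pφ(u) + C
(`exists_radial_estimate`). Critical values are therefore at least −C/p, and at low levels φ
strictly decreases outward along rays, so a ray that has entered the sublevel stays in it. Let D be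
the set of active functions: u ≠ 0 for φ, and u^± ≠ 0 for φ_±. Superlinearity of F drives φ(tu) to
−∞ for u in D, while φ is bounded below off D. The low sublevel thus lies in D, and D is pushed into
it along rays, so contractibility passes from D to the sublevel (`contractible_sublevel_of_rays`).
For φ_± the set D is star-shaped about a bump function. For φ it is the space without its origin,
contractible because the dimension is infinite; here an explicit contraction goes through
multiplication by |x − x₀|^{2N}, since no nonzero multiple of a bump equal to 1 near x₀ is such a
product with an L^p function.

Higher levels. Below all critical values the Cerami condition bounds (1 + ‖u‖)‖φ'(u)‖ from below on
each strip of levels. A descent by discrete pseudo-gradient steps reaches the low level after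
finitely many steps from every point, which transfers contractibility upward
(`contractible_sublevel_of_cerami`).

Cerami condition. On a Cerami sequence the radial estimate bounds the integral of |u|^τ (of |u^±|^τ
after truncation). Interpolation with a subcritical exponent, where the lower bound on τ enters,
bounds the reaction by a power of ‖u‖ below p, and coercivity bounds the sequence
(`exists_norm_bound`). Compactness of the embedding into L^r and the monotonicity estimate
`HypA.norm_sub_rpow_le` then give strong convergence (`ceramiCondition_of_monotone`).

The three functionals are one case: f is composed with a truncation π, and |π| measures activity.
The Sobolev facts are proved for test functions and extended by density, and the C¹ property follows
from continuity of superposition operators between dual Lebesgue spaces. -/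

theorem isZero_relativeHomology_of_contractible (X : Type) [TopologicalSpace X] (A : Set X)
    [ContractibleSpace X] [ContractibleSpace A] (k : ℕ) :
    Limits.IsZero (relativeHomology X A k) := by
  obtain ⟨x₀, ⟨HX⟩⟩ := id_nullhomotopic X
  obtain ⟨a₀, ⟨HA⟩⟩ := id_nullhomotopic A
  -- The contraction of X is redirected to end at the centre of contraction of A, so that one
  -- constant map serves as homotopy inverse of the inclusion on both sides.
  obtain ⟨HX'⟩ : (ContinuousMap.id X).Homotopic (ContinuousMap.const X a₀.1) := by
    have h : (ContinuousMap.const X a₀.1).Homotopic (ContinuousMap.const X x₀) :=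
      ContinuousMap.Homotopic.comp ⟨HX⟩ (ContinuousMap.Homotopic.refl (ContinuousMap.const X a₀.1))
    exact ContinuousMap.Homotopic.trans ⟨HX⟩ h.symm
  let i := subsetInclusion X A
  let j : TopCat.of X ⟶ TopCat.of A := TopCat.ofHom (ContinuousMap.const X a₀)
  have h1 : TopCat.Homotopy (𝟙 (TopCat.of A)) (i ≫ j) := HA
  have h2 : TopCat.Homotopy (𝟙 (TopCat.of X)) (j ≫ i) := HX'
  have hmono : Mono i := (TopCat.mono_iff_injective _).2 Subtype.val_injective
  have hmono' : Mono (singularChains.map i) := by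
    have : Functor.PreservesMonomorphisms singularChains := inferInstance
    infer_instance
  have hq : QuasiIso (singularChains.map i) := by
    refine ⟨fun n => ?_⟩
    rw [quasiIsoAt_iff_isIso_homologyMap]
    refine ⟨HomologicalComplex.homologyMap (singularChains.map j) n, ?_, ?_⟩
    · rw [← HomologicalComplex.homologyMap_comp, ← Functor.map_comp,
        ← h1.congr_homologyMap_singularChainComplexFunctor]
      simp
    · rw [← HomologicalComplex.homologyMap_comp, ← Functor.map_comp,
        ← h2.congr_homologyMap_singularChainComplexFunctor]
      simp
  -- The inclusion is injective on chains, so the relative complex is the third term of a short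
  -- exact sequence whose first map is a quasi-isomorphism; it is acyclic.
  let S : ShortComplex (ChainComplex (ModuleCat.{0} ℤ) ℕ) :=
    ShortComplex.mk (singularChains.map i) (Limits.cokernel.π (singularChains.map i)) (by simp)
  have hS : S.ShortExact :=
    { exact := ShortComplex.exact_of_g_is_cokernel _ (Limits.cokernelIsCokernel _)
      mono_f := hmono'
      epi_g := inferInstanceAs (Epi (Limits.cokernel.π _)) }
  exact ((hS.acyclic_X₃ hq) k).isZero_homology

/-! ### Sublevel sets along rays -/

section Rays

variable {X : Type} [NormedAddCommGroup X] [NormedSpace ℝ X]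

/-- A sublevel set is contractible if every ray in a contractible set `D` containing it eventually
enters it, and no ray leaves it. -/
theorem contractible_sublevel_of_rays {φ : X → ℝ} (hφ : Continuous φ) {b : ℝ} {D : Set X}
    (hD : ContractibleSpace D) (hbD : sublevel φ b ⊆ D)
    (hneg : ∀ u ∈ D, ∃ t : ℝ, 1 ≤ t ∧ φ (t • u) < b)
    (hray : ∀ u, φ u ≤ b → ∀ t : ℝ, 1 ≤ t → φ (t • u) ≤ b) :
    ContractibleSpace (sublevel φ b) := by
  have hray' : ∀ (u : X) (s t : ℝ), 1 ≤ s → s ≤ t → φ (s • u) ≤ b → φ (t • u) ≤ b := by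
    intro u s t hs hst h
    have h2 := hray _ h (t / s) ((one_le_div (by linarith)).2 hst)
    rwa [smul_smul, div_mul_cancel₀ _ (by linarith)] at h2
  -- A continuous entrance time. At each point the admissible times form an interval because rays do
  -- not leave, and the strict inequality makes one time work nearby; a partition of unity glues
  -- these choices.
  obtain ⟨T, hT⟩ := exists_continuous_forall_mem_convex_of_local_const (X := D) (E := ℝ)
    (t := fun u => {t : ℝ | 1 ≤ t ∧ φ (t • u.1) ≤ b}) (by
      intro u
      refine Set.OrdConnected.convex ⟨?_⟩
      intro s hs t ht z hz
      exact ⟨hs.1.trans hz.1, hray' _ _ _ hs.1 hz.1 hs.2⟩) (by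
      intro u
      obtain ⟨t, ht1, ht⟩ := hneg u.1 u.2
      refine ⟨t, ?_⟩
      have hc : Continuous fun y : D => φ (t • y.1) := by fun_prop
      filter_upwards [hc.continuousAt.eventually_lt continuousAt_const ht] with y hy
      exact ⟨ht1, hy.le⟩)
  let R : C(D, sublevel φ b) := ⟨fun u => ⟨T u • u.1, (hT u).2⟩, by fun_prop⟩
  let j : C(sublevel φ b, D) := ⟨fun u => ⟨u.1, hbD u.2⟩, by fun_prop⟩
  -- Moving outward along a ray keeps a point of the sublevel inside it, so its identity factors up
  -- to homotopy through the contractible set D.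
  have hRj : (ContinuousMap.id (sublevel φ b)).Homotopic (R.comp j) := by
    have hc : Continuous fun q : unitInterval × sublevel φ b => T (j q.2) :=
      T.continuous.comp (j.continuous.comp continuous_snd)
    have hmem : ∀ q : unitInterval × sublevel φ b,
        φ ((1 + (q.1 : ℝ) * (T (j q.2) - 1)) • q.2.1) ≤ b := by
      intro q
      refine hray _ q.2.2 _ ?_
      nlinarith [q.1.2.1, (hT (j q.2)).1]
    refine ⟨⟨⟨fun q => ⟨(1 + (q.1 : ℝ) * (T (j q.2) - 1)) • q.2.1, hmem q⟩,
      Continuous.subtype_mk (by fun_prop) _⟩, ?_, ?_⟩⟩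
    · intro u; simp
    · intro u; simp [R, j]
  rw [contractible_iff_id_nullhomotopic]
  have h := ((id_nullhomotopic D).comp_right R).comp_left j
  obtain ⟨y, hy⟩ := h
  exact ⟨y, hRj.trans hy⟩

/-- If the radial derivative is negative on a sublevel set, rays do not leave it. -/
theorem sublevel_ray_of_radial_deriv_neg {φ : X → ℝ} (hφ : Differentiable ℝ φ) {b : ℝ}
    (h : ∀ u, φ u ≤ b → fderiv ℝ φ u u < 0) (u : X) (hu : φ u ≤ b) (t : ℝ) (ht : 1 ≤ t) :
    φ (t • u) ≤ b := by
  have hd : ∀ s : ℝ, HasDerivAt (fun s : ℝ => φ (s • u)) (fderiv ℝ φ (s • u) u) s := by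
    intro s
    have h1 : HasDerivAt (fun s : ℝ => s • u) u s := by
      simpa using (hasDerivAt_id s).smul_const u
    exact (hφ (s • u)).hasFDerivAt.comp_hasDerivAt s h1
  refine image_le_of_deriv_right_lt_deriv_boundary (a := 1) (b := t)
    (f := fun s : ℝ => φ (s • u)) (f' := fun s => fderiv ℝ φ (s • u) u) (B := fun _ => b)
    (B' := fun _ => 0) (fun s _ => (hd s).continuousAt.continuousWithinAt)
    (fun s _ => (hd s).hasDerivWithinAt) (by simpa using hu) (fun s => hasDerivAt_const s b)
    ?_ ⟨ht, le_rfl⟩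
  intro s hs hsb
  have h2 := h _ hsb.le
  rw [map_smul, smul_eq_mul] at h2
  have h3 : 0 < s := by linarith [hs.1]
  exact neg_of_mul_neg_right h2 h3.le

end Rays

/-! ### Deformation of sublevel sets below the critical values -/

section Deformation

variable {X : Type} [NormedAddCommGroup X] [NormedSpace ℝ X]

theorem not_mem_criticalSet_of_lt {φ : X → ℝ} {c : ℝ} (hc : (c : EReal) < criticalInf φ) {u : X}
    (hu : φ u ≤ c) : fderiv ℝ φ u ≠ 0 := by
  intro h
  have h1 : criticalInf φ ≤ φ u := iInf₂_le u h
  exact absurd (hc.trans_le h1) (not_lt.2 (EReal.coe_le_coe_iff.2 hu))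

/-- Under the Cerami condition the weighted slope is bounded away from zero between two levels
that lie below all critical values. -/
theorem exists_slope_lower_bound {φ : X → ℝ} (hφ : ContDiff ℝ 1 φ) (hC : CeramiCondition φ)
    {c : ℝ} (hc : (c : EReal) < criticalInf φ) (b : ℝ) :
    ∃ σ : ℝ, 0 < σ ∧ ∀ u, b ≤ φ u → φ u ≤ c → σ ≤ (1 + ‖u‖) * ‖fderiv ℝ φ u‖ := by
  by_contra! hcon
  choose u hu1 hu2 hu3 using fun n : ℕ => hcon (1 / ((n : ℝ) + 1)) (by positivity)
  have hcont : Continuous (fderiv ℝ φ) := hφ.continuous_fderiv (by simp)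
  have hnorm : ∀ n, ‖(1 + ‖u n‖) • fderiv ℝ φ (u n)‖ = (1 + ‖u n‖) * ‖fderiv ℝ φ (u n)‖ := by
    intro n
    rw [norm_smul, Real.norm_of_nonneg (by positivity)]
  have hlim : Tendsto (fun n => (1 + ‖u n‖) • fderiv ℝ φ (u n)) atTop (𝓝 0) := by
    rw [tendsto_zero_iff_norm_tendsto_zero]
    refine squeeze_zero (fun _ => norm_nonneg _) (fun n => ?_)
      tendsto_one_div_add_atTop_nhds_zero_nat
    rw [hnorm]
    exact (hu3 n).le
  obtain ⟨x, σ, hσ, hx⟩ := hC u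
    ⟨max |b| |c|, fun n => abs_le_max_abs_abs (hu1 n) (hu2 n)⟩ hlim
  have hxc : φ x ≤ c := le_of_tendsto ((hφ.continuous.tendsto x).comp hx)
    (Eventually.of_forall fun n => hu2 _)
  have h0 : fderiv ℝ φ x = 0 := by
    have h1 : Tendsto (fun n => (1 + ‖(u ∘ σ) n‖) • fderiv ℝ φ ((u ∘ σ) n)) atTop
        (𝓝 ((1 + ‖x‖) • fderiv ℝ φ x)) :=
      (tendsto_const_nhds.add hx.norm).smul ((hcont.tendsto x).comp hx)
    have h2 := tendsto_nhds_unique h1 (hlim.comp hσ.tendsto_atTop)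
    exact (smul_eq_zero.1 h2).resolve_left (by positivity)
  exact not_mem_criticalSet_of_lt hc hxc h0

/-- A continuous pseudo-gradient direction together with a continuous admissible step length. -/
theorem exists_descent_step {φ : X → ℝ} (hφ : ContDiff ℝ 1 φ) {c : ℝ}
    (hc : (c : EReal) < criticalInf φ) :
    ∃ (V : C(sublevel φ c, X)) (τ : C(sublevel φ c, ℝ)), ∀ u : sublevel φ c,
      ‖V u‖ ≤ 1 + ‖u.1‖ ∧ 0 < τ u ∧ ∀ s ∈ Set.Icc (0 : ℝ) (τ u),
        φ (u.1 + s • V u) ≤ φ u.1 - s * ((1 + ‖u.1‖) * ‖fderiv ℝ φ u.1‖ / 4) := by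
  have hcont : Continuous (fderiv ℝ φ) := hφ.continuous_fderiv (by simp)
  have hdiff : Differentiable ℝ φ := hφ.differentiable (by simp)
  set m : X → ℝ := fun u => (1 + ‖u‖) * ‖fderiv ℝ φ u‖ with hm
  have hmc : Continuous m := by fun_prop
  have hmpos : ∀ u : sublevel φ c, 0 < m u.1 := fun u => by
    have := norm_pos_iff.2 (not_mem_criticalSet_of_lt hc u.2)
    positivity
  -- The pseudo-gradient has length up to 1 + ‖u‖, which matches the Cerami weight. Its defining
  -- conditions are convex in v and open in u, so local constant choices can be averaged.
  obtain ⟨V, hV⟩ := exists_continuous_forall_mem_convex_of_local_const (X := sublevel φ c)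
    (t := fun u => {v : X | ‖v‖ < 1 + ‖u.1‖ ∧ fderiv ℝ φ u.1 v < -(m u.1 / 2)}) (by
      intro u
      refine Convex.inter ?_ ?_
      · have hb : Convex ℝ {v : X | ‖v‖ < 1 + ‖u.1‖} := by
          simpa [Metric.ball, dist_zero_right] using convex_ball (0 : X) (1 + ‖u.1‖)
        exact hb
      · exact convex_halfSpace_lt (fderiv ℝ φ u.1).isLinear _) (by
      intro u
      have hpos : 0 < ‖fderiv ℝ φ u.1‖ := norm_pos_iff.2 (not_mem_criticalSet_of_lt hc u.2)
      obtain ⟨x, hx1, hx2⟩ := (fderiv ℝ φ u.1).exists_lt_apply_of_lt_opNorm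
        (show ‖fderiv ℝ φ u.1‖ / 2 < ‖fderiv ℝ φ u.1‖ by linarith)
      obtain ⟨y, hy1, hy2⟩ : ∃ y : X, ‖y‖ < 1 ∧ fderiv ℝ φ u.1 y < -(‖fderiv ℝ φ u.1‖ / 2) := by
        rcases le_total 0 (fderiv ℝ φ u.1 x) with h | h
        · refine ⟨-x, by simpa using hx1, ?_⟩
          rw [Real.norm_of_nonneg h] at hx2
          rw [map_neg]; linarith
        · refine ⟨x, hx1, ?_⟩
          rw [Real.norm_of_nonpos h] at hx2
          linarith
      have h1u : 0 < 1 + ‖u.1‖ := by positivity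
      refine ⟨(1 + ‖u.1‖) • y, ?_⟩
      have e1 : ‖(1 + ‖u.1‖) • y‖ < 1 + ‖u.1‖ := by
        rw [norm_smul, Real.norm_of_nonneg h1u.le]
        nlinarith
      have e2 : fderiv ℝ φ u.1 ((1 + ‖u.1‖) • y) < -(m u.1 / 2) := by
        rw [map_smul, smul_eq_mul, hm]
        nlinarith
      have c1 : Continuous fun z : sublevel φ c => 1 + ‖z.1‖ := by fun_prop
      have c2 : Continuous fun z : sublevel φ c => fderiv ℝ φ z.1 ((1 + ‖u.1‖) • y) := by fun_prop
      have c3 : Continuous fun z : sublevel φ c => -(m z.1 / 2) := by fun_prop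
      filter_upwards [continuousAt_const.eventually_lt c1.continuousAt e1,
        c2.continuousAt.eventually_lt c3.continuousAt e2] with z hz1 hz2
      exact ⟨hz1, hz2⟩)
  -- Admissible step lengths also form an interval. The descent rate is relaxed from m/2 to m/4 so
  -- that one length stays admissible on a neighbourhood.
  obtain ⟨τ, hτ⟩ := exists_continuous_forall_mem_convex_of_local_const (X := sublevel φ c) (E := ℝ)
    (t := fun u => {τ : ℝ | 0 < τ ∧ ∀ s ∈ Set.Icc (0 : ℝ) τ,
        φ (u.1 + s • V u) ≤ φ u.1 - s * (m u.1 / 4)}) (by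
      intro u
      refine Set.OrdConnected.convex ⟨?_⟩
      intro x hx y hy z hz
      exact ⟨hx.1.trans_le hz.1, fun s hs => hy.2 s ⟨hs.1, hs.2.trans hz.2⟩⟩) (by
      intro u
      let g : ℝ × sublevel φ c → ℝ := fun q => fderiv ℝ φ (q.2.1 + q.1 • V q.2) (V q.2) + m q.2.1 / 4
      have hg : Continuous g := by fun_prop
      have hg0 : g (0, u) < 0 := by
        have := (hV u).2
        simp only [g, zero_smul, add_zero]
        linarith [hmpos u]
      have hev : ∀ᶠ q in 𝓝 ((0 : ℝ), u), g q < 0 :=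
        hg.continuousAt.eventually_lt continuousAt_const hg0
      rw [nhds_prod_eq, Filter.eventually_prod_iff] at hev
      obtain ⟨pa, hpa, pb, hpb, hab⟩ := hev
      obtain ⟨ε, hε, hball⟩ := Metric.eventually_nhds_iff.1 hpa
      refine ⟨ε / 2, ?_⟩
      filter_upwards [hpb] with z hz
      refine ⟨by positivity, fun s hs => ?_⟩
      have hd : ∀ x : ℝ, HasDerivAt (fun x : ℝ => φ (z.1 + x • V z) + x * (m z.1 / 4))
          (g (x, z)) x := by
        intro x
        have h1 : HasDerivAt (fun s : ℝ => z.1 + s • V z) (V z) x := by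
          simpa using ((hasDerivAt_id x).smul_const (V z)).const_add z.1
        have h2 := (hdiff (z.1 + x • V z)).hasFDerivAt.comp_hasDerivAt x h1
        have h3 := (hasDerivAt_id x).mul_const (m z.1 / 4)
        exact (h2.add h3).congr_deriv (by simp [g])
      have hanti : AntitoneOn (fun x : ℝ => φ (z.1 + x • V z) + x * (m z.1 / 4))
          (Set.Icc 0 (ε / 2)) := by
        refine antitoneOn_of_deriv_nonpos (convex_Icc _ _)
          (fun x _ => (hd x).continuousAt.continuousWithinAt)
          (fun x _ => (hd x).differentiableAt.differentiableWithinAt) ?_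
        intro x hx
        rw [interior_Icc] at hx
        rw [(hd x).deriv]
        refine (hab (hball ?_) hz).le
        rw [Real.dist_eq, sub_zero, abs_of_pos hx.1]
        linarith [hx.2]
      have := hanti (Set.left_mem_Icc.2 (by positivity)) hs hs.1
      simp only [zero_smul, add_zero, zero_mul] at this
      linarith)
  exact ⟨V, τ, fun u => ⟨(hV u).1.le, (hτ u).1, (hτ u).2⟩⟩

/-- If the sublevel set of a low level is contractible, so is that of every level below the
critical values. -/
theorem contractible_sublevel_of_cerami [CompleteSpace X] {φ : X → ℝ} (hφ : ContDiff ℝ 1 φ)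
    (hC : CeramiCondition φ) {b c : ℝ} (hbc : b ≤ c) (hc : (c : EReal) < criticalInf φ)
    (hb : ContractibleSpace (sublevel φ b)) : ContractibleSpace (sublevel φ c) := by
  obtain ⟨σ, hσ, hslope⟩ := exists_slope_lower_bound hφ hC hc b
  obtain ⟨V, τ, hVτ⟩ := exists_descent_step hφ hc
  have hclosed : IsClosed (sublevel φ c) := isClosed_le hφ.continuous continuous_const
  -- one step of the descent, at the fraction `s` of the step length
  have hstep : ∀ (s : Set.Icc (0 : ℝ) 1) (u : sublevel φ c),
      φ (u.1 + ((s : ℝ) * τ u) • V u) ≤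
        φ u.1 - (s * τ u) * ((1 + ‖u.1‖) * ‖fderiv ℝ φ u.1‖ / 4) := by
    intro s u
    refine (hVτ u).2.2 _ ⟨mul_nonneg s.2.1 (hVτ u).2.1.le, ?_⟩
    nlinarith [s.2.2, (hVτ u).2.1]
  have hstep' : ∀ (s : Set.Icc (0 : ℝ) 1) (u : sublevel φ c),
      φ (u.1 + ((s : ℝ) * τ u) • V u) ≤ φ u.1 := by
    intro s u
    refine (hstep s u).trans (sub_le_self _ ?_)
    have := (hVτ u).2.1
    have := s.2.1
    positivity
  let S : C(Set.Icc (0 : ℝ) 1 × sublevel φ c, sublevel φ c) :=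
    ⟨fun q => ⟨q.2.1 + ((q.1 : ℝ) * τ q.2) • V q.2, (hstep' q.1 q.2).trans q.2.2⟩,
      Continuous.subtype_mk (by fun_prop) _⟩
  have hS : ∀ q, φ (S q).1 ≤ φ q.2.1 := fun q => hstep' q.1 q.2
  have hS0 : ∀ u, S (⟨0, by simp⟩, u) = u := fun u => Subtype.ext (by simp [S])
  let S₁ : sublevel φ c → sublevel φ c := fun u => S (⟨1, by simp⟩, u)
  have hS₁ : Continuous S₁ := S.continuous.comp (by fun_prop)
  -- every point reaches the lower level after finitely many full steps
  have hreach : ∀ u, ∃ n : ℕ, φ (S₁^[n] u).1 < b := by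
    intro u
    by_contra! hcon
    set η : ℕ → sublevel φ c := fun n => S₁^[n] u with hη
    have hη1 : ∀ n, (η (n + 1)).1 = (η n).1 + τ (η n) • V (η n) := by
      intro n
      simp only [hη, Function.iterate_succ_apply']
      simp [S₁, S]
    have hdec : ∀ n, φ (η (n + 1)).1 ≤ φ (η n).1 - τ (η n) * (σ / 4) := by
      intro n
      have h1 := hstep ⟨1, by simp⟩ (η n)
      simp only [one_mul] at h1
      rw [hη1]
      refine h1.trans (sub_le_sub_left ?_ _)
      have := hslope _ (hcon n) (η n).2
      exact mul_le_mul_of_nonneg_left (by linarith) (hVτ _).2.1.le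
    -- If the low level were never reached, the energy would fall by at least τσ/4 at each step
    -- while staying above b, so the step lengths would be summable.
    have hsum : ∀ n, ∑ i ∈ Finset.range n, τ (η i) * (σ / 4) ≤ φ u.1 - φ (η n).1 := by
      intro n
      induction n with
      | zero => simp [hη]
      | succ n ih => rw [Finset.sum_range_succ]; linarith [hdec n]
    have hsum' : ∀ n, ∑ i ∈ Finset.range n, τ (η i) ≤ (φ u.1 - b) / (σ / 4) := by
      intro n
      rw [le_div_iff₀ (by positivity), Finset.sum_mul]
      linarith [hsum n, hcon n]
    have hsummable : Summable fun n => τ (η n) :=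
      summable_of_sum_range_le (fun n => (hVτ _).2.1.le) hsum'
    -- Discrete Grönwall inequality: steps of length at most τ(1 + ‖u‖) with summable τ keep the
    -- orbit bounded, hence Cauchy.
    have hbound : ∀ n, 1 + ‖(η n).1‖ ≤
        (1 + ‖u.1‖) * Real.exp (∑ i ∈ Finset.range n, τ (η i)) := by
      intro n
      induction n with
      | zero => simp [hη]
      | succ n ih =>
        rw [Finset.sum_range_succ, Real.exp_add, ← mul_assoc]
        have h1 : ‖(η (n + 1)).1‖ ≤ ‖(η n).1‖ + τ (η n) * (1 + ‖(η n).1‖) := by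
          rw [hη1]
          refine (norm_add_le _ _).trans ?_
          rw [norm_smul, Real.norm_of_nonneg (hVτ _).2.1.le]
          gcongr
          · exact (hVτ _).2.1.le
          · exact (hVτ _).1
        have h2 := Real.add_one_le_exp (τ (η n))
        calc 1 + ‖(η (n + 1)).1‖ ≤ (1 + ‖(η n).1‖) * (τ (η n) + 1) := by linarith
          _ ≤ _ := mul_le_mul ih h2 (by linarith [(hVτ (η n)).2.1]) (by positivity)
    set M := (1 + ‖u.1‖) * Real.exp ((φ u.1 - b) / (σ / 4)) with hM
    have hdist : ∀ n, dist (η n).1 (η (n + 1)).1 ≤ τ (η n) * M := by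
      intro n
      rw [hη1, dist_self_add_right, norm_smul, Real.norm_of_nonneg (hVτ _).2.1.le]
      refine mul_le_mul_of_nonneg_left ?_ (hVτ _).2.1.le
      refine ((hVτ _).1.trans (hbound n)).trans ?_
      rw [hM]
      gcongr
      exact hsum' n
    have hcauchy : CauchySeq fun n => (η n).1 :=
      cauchySeq_of_dist_le_of_summable _ hdist (hsummable.mul_right M)
    obtain ⟨x, hx⟩ := cauchySeq_tendsto_of_complete hcauchy
    have hxc : x ∈ sublevel φ c := hclosed.mem_of_tendsto hx (Eventually.of_forall fun n => (η n).2)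
    have hx' : Tendsto η atTop (𝓝 ⟨x, hxc⟩) := tendsto_subtype_rng.2 hx
    -- The orbit converges inside the closed sublevel, where τ is continuous and positive, although
    -- the step lengths tend to zero.
    have h0 := tendsto_nhds_unique ((τ.continuous.tendsto _).comp hx')
      hsummable.tendsto_atTop_zero
    exact (hVτ ⟨x, hxc⟩).2.1.ne' h0
  let clamp : ℝ → Set.Icc (0 : ℝ) 1 := Set.projIcc 0 1 zero_le_one
  have hclamp : Continuous clamp := continuous_projIcc
  -- The descent in real time: step k is carried out to the fraction of [k, k+1] already elapsed, so
  -- at an integer time n exactly n full steps have been made.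
  let h : ℕ → ℝ × sublevel φ c → sublevel φ c := fun n =>
    Nat.rec (fun q => q.2) (fun k hk q => S (clamp (q.1 - k), hk q)) n
  have hsucc : ∀ n q, h (n + 1) q = S (clamp (q.1 - n), h n q) := fun n q => rfl
  have hcont : ∀ n, Continuous (h n) := by
    intro n
    induction n with
    | zero => exact continuous_snd
    | succ n ih =>
      exact S.continuous.comp ((hclamp.comp (by fun_prop)).prodMk ih)
  have hstat : ∀ (q : ℝ × sublevel φ c) (m n : ℕ), q.1 ≤ m → m ≤ n → h n q = h m q := by
    intro q m n hqm hmn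
    induction n, hmn using Nat.le_induction with
    | base => rfl
    | succ n hmn ih =>
      have h1 : clamp (q.1 - n) = ⟨0, by simp⟩ := by
        refine Set.projIcc_of_le_left _ ?_
        have : (m : ℝ) ≤ n := by exact_mod_cast hmn
        linarith
      rw [hsucc, h1, hS0, ih]
  have hfull : ∀ (q : ℝ × sublevel φ c) (n : ℕ), (n : ℝ) ≤ q.1 → h n q = S₁^[n] q.2 := by
    intro q n hn
    induction n with
    | zero => rfl
    | succ n ih =>
      push_cast at hn
      have h1 : clamp (q.1 - n) = ⟨1, by simp⟩ := Set.projIcc_of_right_le _ (by linarith)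
      rw [hsucc, h1, ih (by linarith), Function.iterate_succ_apply']
  have hmono : ∀ (q : ℝ × sublevel φ c) (m n : ℕ), m ≤ n → φ (h n q).1 ≤ φ (h m q).1 := by
    intro q m n hmn
    induction n, hmn using Nat.le_induction with
    | base => rfl
    | succ n hmn ih => rw [hsucc]; exact (hS _).trans ih
  -- Steps beyond the ceiling of the time are trivial, so near any time H agrees with a fixed finite
  -- composition; this gives continuity.
  let H : ℝ × sublevel φ c → sublevel φ c := fun q => h ⌈q.1⌉₊ q
  have hH : Continuous H := by
    rw [continuous_iff_continuousAt]
    intro q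
    have hev : ∀ᶠ z in 𝓝 q, z.1 < q.1 + 1 :=
      continuous_fst.continuousAt.eventually_lt continuousAt_const (by simp)
    refine ((hcont ⌈q.1 + 1⌉₊).continuousAt (x := q)).congr ?_
    filter_upwards [hev] with z hz
    exact hstat z _ _ (Nat.le_ceil _) (Nat.ceil_mono hz.le)
  obtain ⟨T, hT⟩ := exists_continuous_forall_mem_convex_of_local_const (X := sublevel φ c) (E := ℝ)
    (t := fun u => {t : ℝ | ∃ n : ℕ, (n : ℝ) ≤ t ∧ φ (S₁^[n] u).1 ≤ b}) (by
      intro u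
      refine Set.OrdConnected.convex ⟨?_⟩
      rintro s ⟨n, hn1, hn2⟩ t - z hz
      exact ⟨n, hn1.trans hz.1, hn2⟩) (by
      intro u
      obtain ⟨n, hn⟩ := hreach u
      refine ⟨n, ?_⟩
      have hc : Continuous fun y => φ (S₁^[n] y).1 :=
        hφ.continuous.comp (continuous_subtype_val.comp (hS₁.iterate n))
      filter_upwards [hc.continuousAt.eventually_lt continuousAt_const hn] with y hy
      exact ⟨n, le_rfl, hy.le⟩)
  have hHT : ∀ u, φ (H (T u, u)).1 ≤ b := by
    intro u
    obtain ⟨n, hn1, hn2⟩ := hT u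
    have h1 : n ≤ ⌈T u⌉₊ := by exact_mod_cast hn1.trans (Nat.le_ceil _)
    refine (hmono (T u, u) n _ h1).trans ?_
    rw [hfull (T u, u) n hn1]
    exact hn2
  let r : C(sublevel φ c, sublevel φ b) :=
    ⟨fun u => ⟨(H (T u, u)).1, hHT u⟩, Continuous.subtype_mk (by fun_prop) _⟩
  let ι : C(sublevel φ b, sublevel φ c) :=
    ⟨fun u => ⟨u.1, le_trans u.2 hbc⟩, Continuous.subtype_mk (by fun_prop) _⟩
  have hr : (ContinuousMap.id (sublevel φ c)).Homotopic (ι.comp r) := by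
    refine ⟨⟨⟨fun q => H ((q.1 : ℝ) * T q.2, q.2), by fun_prop⟩, ?_, ?_⟩⟩
    · intro u; simp [H, h]
    · intro u; simp [ι, r]
  rw [contractible_iff_id_nullhomotopic]
  obtain ⟨y, hy⟩ := ((id_nullhomotopic (sublevel φ b)).comp_right ι).comp_left r
  exact ⟨y, hr.trans hy⟩

end Deformation

/-! ### Integral functionals on Lebesgue spaces -/

section Nemytskii

variable {α : Type*} [MeasurableSpace α] {μ : Measure α}
variable {F : Type*} [NormedAddCommGroup F]

theorem tendsto_eLpNorm_zero_of_dominated {f : ℕ → α → ℝ} {K : α → ℝ} {s : ℝ≥0∞} (hs : s ≠ 0)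
    (hs' : s ≠ ⊤) (hK : MemLp K s μ) (hf : ∀ n, AEStronglyMeasurable (f n) μ)
    (hbd : ∀ n, ∀ᵐ x ∂μ, ‖f n x‖ ≤ ‖K x‖)
    (hlim : ∀ᵐ x ∂μ, Tendsto (fun n => f n x) atTop (𝓝 0)) :
    Tendsto (fun n => eLpNorm (f n) s μ) atTop (𝓝 0) := by
  have hpos : 0 < s.toReal := ENNReal.toReal_pos hs hs'
  simp only [eLpNorm_eq_lintegral_rpow_enorm_toReal hs hs']
  have h1 : Tendsto (fun n => ∫⁻ x, ‖f n x‖ₑ ^ s.toReal ∂μ) atTop (𝓝 (∫⁻ _, 0 ∂μ)) := by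
    refine tendsto_lintegral_of_dominated_convergence' (fun x => ‖K x‖ₑ ^ s.toReal)
      (fun n => (hf n).enorm.pow_const _) ?_ ?_ ?_
    · intro n
      filter_upwards [hbd n] with x hx
      gcongr
      exact enorm_le_iff_norm_le.2 hx
    · exact (lintegral_rpow_enorm_lt_top_of_eLpNorm_lt_top hs hs' hK.2).ne
    · filter_upwards [hlim] with x hx
      have h2 : Tendsto (fun n => ‖f n x‖ₑ) atTop (𝓝 0) := by simpa using hx.enorm
      have h3 := (ENNReal.continuous_rpow_const (y := s.toReal)).tendsto 0
      rw [ENNReal.zero_rpow_of_pos hpos] at h3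
      exact h3.comp h2
  rw [lintegral_zero] at h1
  have h3 := (ENNReal.continuous_rpow_const (y := 1 / s.toReal)).tendsto 0
  rw [ENNReal.zero_rpow_of_pos (by positivity)] at h3
  exact h3.comp h1

variable {q : ℝ} [hq : Fact (1 < q)]
variable {q' : ℝ} [hq' : Fact (1 < q')] (hqq : q'.HolderConjugate q)

include hqq in
-- Conjugacy gives q'(q − 1) = q.
theorem memLp_rpow_norm {h : α → F} (hh : MemLp h (ENNReal.ofReal q) μ) :
    MemLp (fun x => ‖h x‖ ^ (q - 1)) (ENNReal.ofReal q') μ ∧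
      eLpNorm (fun x => ‖h x‖ ^ (q - 1)) (ENNReal.ofReal q') μ =
        eLpNorm h (ENNReal.ofReal q) μ ^ (q - 1) := by
  have h1 : 0 < q - 1 := sub_pos.2 hq.out
  have hc : ENNReal.ofReal q' * ENNReal.ofReal (q - 1) = ENNReal.ofReal q := by
    rw [← ENNReal.ofReal_mul (by linarith [hq'.out])]
    congr 1
    linarith [hqq.mul_eq_add]
  have h2 := eLpNorm_norm_rpow (μ := μ) (p := ENNReal.ofReal q') h h1
  rw [hc] at h2
  refine ⟨⟨(hh.1.norm.aemeasurable.pow_const _).aestronglyMeasurable, ?_⟩, h2⟩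
  rw [h2]
  exact ENNReal.rpow_lt_top_of_nonneg h1.le hh.2.ne

include hqq in
-- The superposition is dominated by min(R, K) + C‖h‖^(q−1). The first term tends to zero by
-- dominated convergence with the fixed majorant K; the second by the convergence of h in norm. No
-- majorant for the sequence h itself is needed.
theorem tendsto_eLpNorm_superposition_of_ae {R : α → F → ℝ} {K : α → ℝ} {C : ℝ} (hC : 0 ≤ C)
    (hK : MemLp K (ENNReal.ofReal q') μ) (hK0 : ∀ᵐ x ∂μ, 0 ≤ K x)
    (hR0 : ∀ x η, 0 ≤ R x η) (hbd : ∀ᵐ x ∂μ, ∀ η, R x η ≤ K x + C * ‖η‖ ^ (q - 1))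
    (hlim : ∀ x, Tendsto (R x) (𝓝 0) (𝓝 0))
    (hmeas : ∀ h : α → F, AEStronglyMeasurable h μ → AEStronglyMeasurable (fun x => R x (h x)) μ)
    {h : ℕ → α → F} (hh : ∀ n, MemLp (h n) (ENNReal.ofReal q) μ)
    (hh0 : Tendsto (fun n => eLpNorm (h n) (ENNReal.ofReal q) μ) atTop (𝓝 0))
    (hae : ∀ᵐ x ∂μ, Tendsto (fun n => h n x) atTop (𝓝 0)) :
    Tendsto (fun n => eLpNorm (fun x => R x (h n x)) (ENNReal.ofReal q') μ)
      atTop (𝓝 0) := by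
  have h1 : 0 < q - 1 := sub_pos.2 hq.out
  have hone : 1 ≤ ENNReal.ofReal q' := Fact.out
  have hm1 : ∀ n, AEStronglyMeasurable (fun x => min (R x (h n x)) (K x)) μ := fun n =>
    (hmeas _ (hh n).1).inf hK.1
  have hm2 : ∀ n, AEStronglyMeasurable (fun x => C * ‖h n x‖ ^ (q - 1)) μ := fun n =>
    ((memLp_rpow_norm hqq (hh n)).1.const_mul C).1
  have hA : Tendsto (fun n => eLpNorm (fun x => min (R x (h n x)) (K x))
      (ENNReal.ofReal q') μ) atTop (𝓝 0) := by
    refine tendsto_eLpNorm_zero_of_dominated (zero_lt_one.trans_le hone).ne' ENNReal.ofReal_ne_top hK hm1 ?_ ?_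
    · intro n
      filter_upwards [hK0] with x hx
      rw [Real.norm_of_nonneg (le_min (hR0 _ _) hx), Real.norm_of_nonneg hx]
      exact min_le_right _ _
    · filter_upwards [hae, hK0] with x hx hx0
      have h2 := ((hlim x).comp hx).min (tendsto_const_nhds (x := K x))
      rw [min_eq_left hx0] at h2
      exact h2
  have hB : Tendsto (fun n => eLpNorm (fun x => C * ‖h n x‖ ^ (q - 1))
      (ENNReal.ofReal q') μ) atTop (𝓝 0) := by
    have h2 : ∀ n, eLpNorm (fun x => C * ‖h n x‖ ^ (q - 1)) (ENNReal.ofReal q') μ =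
        ‖C‖ₑ * (eLpNorm (h n) (ENNReal.ofReal q) μ ^ (q - 1)) := by
      intro n
      rw [← (memLp_rpow_norm hqq (hh n)).2]
      have h3 := eLpNorm_const_smul (μ := μ) (p := ENNReal.ofReal q') C
        (fun x => ‖h n x‖ ^ (q - 1))
      simp only [Pi.smul_def, smul_eq_mul] at h3
      exact h3
    simp only [h2]
    have h5 := ((ENNReal.continuous_rpow_const (y := q - 1)).tendsto 0).comp hh0
    rw [ENNReal.zero_rpow_of_pos h1] at h5
    have h6 := ENNReal.Tendsto.const_mul (a := ‖C‖ₑ) h5 (Or.inr (by simp))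
    simp only [mul_zero, Function.comp_def] at h6
    exact h6
  have hAB := hA.add hB
  rw [add_zero] at hAB
  refine tendsto_of_tendsto_of_tendsto_of_le_of_le tendsto_const_nhds hAB
    (fun _ => zero_le) (fun n => ?_)
  have h8 := eLpNorm_add_le (hm1 n) (hm2 n) hone
  refine le_trans ?_ h8
  refine eLpNorm_mono_ae ?_
  filter_upwards [hbd, hK0] with x hx hx0
  have h6 := hx (h n x)
  have h7 : R x (h n x) ≤ min (R x (h n x)) (K x) + C * ‖h n x‖ ^ (q - 1) := by
    rcases le_total (R x (h n x)) (K x) with h' | h'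
    · rw [min_eq_left h']
      have : 0 ≤ C * ‖h n x‖ ^ (q - 1) := by positivity
      linarith
    · rw [min_eq_right h']; exact h6
  rw [Real.norm_of_nonneg (hR0 _ _), Pi.add_apply, Real.norm_eq_abs]
  exact h7.trans (le_abs_self _)

include hqq in
/-- A superposition that vanishes at zero and has growth `q - 1` is continuous at zero as a map
from `L^q` to the dual Lebesgue space. -/
theorem tendsto_eLpNorm_superposition {R : α → F → ℝ} {K : α → ℝ} {C : ℝ} (hC : 0 ≤ C)
    (hK : MemLp K (ENNReal.ofReal q') μ) (hK0 : ∀ᵐ x ∂μ, 0 ≤ K x)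
    (hR0 : ∀ x η, 0 ≤ R x η) (hbd : ∀ᵐ x ∂μ, ∀ η, R x η ≤ K x + C * ‖η‖ ^ (q - 1))
    (hlim : ∀ x, Tendsto (R x) (𝓝 0) (𝓝 0))
    (hmeas : ∀ h : α → F, AEStronglyMeasurable h μ → AEStronglyMeasurable (fun x => R x (h x)) μ) :
    Tendsto (fun h : Lp F (ENNReal.ofReal q) μ =>
      eLpNorm (fun x => R x (h x)) (ENNReal.ofReal q') μ) (𝓝 0) (𝓝 0) := by
  -- Convergence in L^q yields pointwise convergence only along a subsequence, which suffices when
  -- every subsequence is tested.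
  refine tendsto_of_subseq_tendsto fun ns hns => ?_
  obtain ⟨ms, hms, hae⟩ := (tendstoInMeasure_of_tendsto_Lp hns).exists_seq_tendsto_ae
  refine ⟨ms, tendsto_eLpNorm_superposition_of_ae hqq hC hK hK0 hR0 hbd hlim hmeas
    (h := fun n => ns (ms n)) (fun n => Lp.memLp _) ?_ ?_⟩
  · have h4 := (hns.comp hms.tendsto_atTop).enorm
    simpa [Lp.enorm_def] using h4
  · filter_upwards [hae, Lp.coeFn_zero F (ENNReal.ofReal q) μ] with x hx hx0
    rw [hx0] at hx
    exact hx

section Functional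

variable [NormedSpace ℝ F] [IsFiniteMeasure μ]

/-- The data of an integrand `g(x, ξ)` with derivative `dg(x, ξ)` of growth `q - 1`. -/
structure IsSmoothIntegrand (μ : Measure α) (q : ℝ) (g : α → F → ℝ) (dg : α → F → F →L[ℝ] ℝ) :
    Prop where
  hasFDerivAt : ∀ x ξ, HasFDerivAt (g x) (dg x ξ) ξ
  continuous : ∀ x, Continuous (dg x)
  zero : ∀ x, g x 0 = 0
  aesm : ∀ h : α → F, AEStronglyMeasurable h μ → AEStronglyMeasurable (fun x => g x (h x)) μ
  aesm_deriv : ∀ h : α → F, AEStronglyMeasurable h μ →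
    AEStronglyMeasurable (fun x => dg x (h x)) μ
  growth : ∃ C : ℝ, 0 ≤ C ∧ ∀ᵐ x ∂μ, ∀ ξ, ‖dg x ξ‖ ≤ C * (1 + ‖ξ‖ ^ (q - 1))

variable {g : α → F → ℝ} {dg : α → F → F →L[ℝ] ℝ}

omit [NormedSpace ℝ F] in
theorem rpow_norm_add_le (ξ η : F) :
    ‖ξ + η‖ ^ (q - 1) ≤ 2 ^ (q - 1) * (‖ξ‖ ^ (q - 1) + ‖η‖ ^ (q - 1)) := by
  have h1 : 0 < q - 1 := sub_pos.2 hq.out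
  have h2 : ‖ξ + η‖ ≤ 2 * max ‖ξ‖ ‖η‖ := by
    linarith [norm_add_le ξ η, le_max_left ‖ξ‖ ‖η‖, le_max_right ‖ξ‖ ‖η‖]
  calc ‖ξ + η‖ ^ (q - 1) ≤ (2 * max ‖ξ‖ ‖η‖) ^ (q - 1) := by gcongr
    _ = 2 ^ (q - 1) * (max ‖ξ‖ ‖η‖) ^ (q - 1) := Real.mul_rpow (by norm_num) (by positivity)
    _ ≤ _ := by
      gcongr
      rcases le_total ‖ξ‖ ‖η‖ with h | h
      · rw [max_eq_right h]; exact le_add_of_nonneg_left (by positivity)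
      · rw [max_eq_left h]; exact le_add_of_nonneg_right (by positivity)

namespace IsSmoothIntegrand

variable (H : IsSmoothIntegrand μ q g dg)
include H

include hqq in
theorem memLp_deriv {h : α → F} (hh : MemLp h (ENNReal.ofReal q) μ) :
    MemLp (fun x => dg x (h x)) (ENNReal.ofReal q') μ := by
  obtain ⟨C, hC, hgr⟩ := H.growth
  have h1 : MemLp (fun x => C * (1 + ‖h x‖ ^ (q - 1))) (ENNReal.ofReal q') μ := by
    have h2 := (MemLp.add (memLp_const (1 : ℝ)) (memLp_rpow_norm hqq hh).1).const_mul C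
    simp only [Pi.add_apply] at h2
    exact h2
  refine h1.mono (H.aesm_deriv h hh.1) ?_
  filter_upwards [hgr] with x hx
  exact (hx _).trans (le_abs_self _)

omit [IsFiniteMeasure μ] in
-- Mean value inequality on the segment from ξ to ξ + η. The bound has the form K(x) + C‖η‖^(q−1),
-- times ‖η‖, as needed to treat the difference quotient as a superposition in η.
theorem remainder_le : ∃ C : ℝ, 0 ≤ C ∧ ∀ᵐ x ∂μ, ∀ ξ η,
    ‖g x (ξ + η) - g x ξ - dg x ξ η‖ ≤
      (C * (1 + ‖ξ‖ ^ (q - 1)) + C * ‖η‖ ^ (q - 1)) * ‖η‖ := by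
  have h1 : 0 < q - 1 := sub_pos.2 hq.out
  obtain ⟨C, hC, hgr⟩ := H.growth
  refine ⟨C * (2 + 2 ^ (q - 1)), by positivity, ?_⟩
  filter_upwards [hgr] with x hx ξ η
  have h2 := (convex_segment ξ (ξ + η)).norm_image_sub_le_of_norm_hasFDerivWithin_le'
    (f := g x) (f' := dg x) (φ := dg x ξ)
    (C := C * (2 + 2 ^ (q - 1)) * (1 + ‖ξ‖ ^ (q - 1)) + C * (2 + 2 ^ (q - 1)) * ‖η‖ ^ (q - 1))
    (fun y _ => (H.hasFDerivAt x y).hasFDerivWithinAt) (fun y hy => ?_)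
    (left_mem_segment ℝ _ _) (right_mem_segment ℝ _ _)
  · simpa using h2
  · set c := (2 : ℝ) ^ (q - 1) with hc
    obtain ⟨s, ⟨hs0, hs1⟩, rfl⟩ : ∃ s ∈ Set.Icc (0 : ℝ) 1, ξ + s • η = y := by
      rw [segment_eq_image'] at hy
      simpa using hy
    have h3 : ‖ξ + s • η‖ ^ (q - 1) ≤ c * (‖ξ‖ ^ (q - 1) + ‖η‖ ^ (q - 1)) := by
      refine (rpow_norm_add_le ξ (s • η)).trans ?_
      gcongr
      rw [norm_smul, Real.norm_of_nonneg hs0]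
      exact mul_le_of_le_one_left (norm_nonneg _) hs1
    have h4 : 0 ≤ C * ‖η‖ ^ (q - 1) := by positivity
    have h5 : 0 ≤ C * c := by positivity
    have h6 : 0 ≤ C * ‖ξ‖ ^ (q - 1) := by positivity
    calc ‖dg x (ξ + s • η) - dg x ξ‖
        ≤ C * (1 + ‖ξ + s • η‖ ^ (q - 1)) + C * (1 + ‖ξ‖ ^ (q - 1)) :=
          (norm_sub_le _ _).trans (add_le_add (hx _) (hx _))
      _ ≤ C * (1 + c * (‖ξ‖ ^ (q - 1) + ‖η‖ ^ (q - 1))) + C * (1 + ‖ξ‖ ^ (q - 1)) := by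
          gcongr
      _ ≤ _ := by nlinarith [h4, h5, h6]

theorem integrable_deriv {u h : α → F} (hu : MemLp u (ENNReal.ofReal q) μ)
    (hh : MemLp h (ENNReal.ofReal q) μ) : Integrable (fun x => dg x (u x) (h x)) μ := by
  have hqq := (Real.HolderConjugate.conjExponent hq.out).symm
  have : Fact (1 < q.conjExponent) := ⟨hqq.lt⟩
  have := hqq.ennrealOfReal
  exact memLp_one_iff_integrable.1
    ((ContinuousLinearMap.id ℝ (F →L[ℝ] ℝ)).memLp_of_bilin (r := 1) (H.memLp_deriv hqq hu) hh)

theorem integrable {u : α → F} (hu : MemLp u (ENNReal.ofReal q) μ) :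
    Integrable (fun x => g x (u x)) μ := by
  obtain ⟨C, hC, hrem⟩ := H.remainder_le
  have hqq := (Real.HolderConjugate.conjExponent hq.out).symm
  have : Fact (1 < q.conjExponent) := ⟨hqq.lt⟩
  have := hqq.ennrealOfReal
  have h0 : MemLp (fun _ : α => (0 : F)) (ENNReal.ofReal q) μ := MemLp.zero
  have h1 := H.integrable_deriv h0 hu
  have h2 : MemLp (fun x => C * (1 + ‖(0 : F)‖ ^ (q - 1)) + C * ‖u x‖ ^ (q - 1))
      (ENNReal.ofReal q.conjExponent) μ := by
    have h3 := MemLp.add (memLp_const (C * (1 + ‖(0 : F)‖ ^ (q - 1))))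
      ((memLp_rpow_norm hqq hu).1.const_mul C)
    simp only [Pi.add_def] at h3
    exact h3
  have h3 := memLp_one_iff_integrable.1 (MemLp.mul (r := 1) h2 hu.norm)
  have h4 : Integrable (fun x => g x (u x) - dg x 0 (u x)) μ := by
    refine h3.mono ((H.aesm u hu.1).sub h1.1) ?_
    filter_upwards [hrem] with x hx
    have := hx 0 (u x)
    simp only [zero_add, H.zero, sub_zero] at this
    refine this.trans (le_of_eq_of_le ?_ (le_abs_self _))
    simp only [Pi.mul_apply]
    ring
  have h5 := h4.add h1
  simp only [Pi.add_def, sub_add_cancel] at h5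
  exact h5

/-- The derivative of the integral functional, as an element of the dual Lebesgue space. -/
theorem contDiff_and_fderiv :
    ContDiff ℝ 1 (fun u : Lp F (ENNReal.ofReal q) μ => ∫ x, g x (u x) ∂μ) ∧
      ∀ u h : Lp F (ENNReal.ofReal q) μ,
        fderiv ℝ (fun u : Lp F (ENNReal.ofReal q) μ => ∫ x, g x (u x) ∂μ) u h =
          ∫ x, dg x (u x) (h x) ∂μ := by
  obtain ⟨q', hqq⟩ : ∃ q' : ℝ, q'.HolderConjugate q :=
    ⟨_, (Real.HolderConjugate.conjExponent hq.out).symm⟩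
  have : Fact (1 < q') := ⟨hqq.lt⟩
  have := hqq.ennrealOfReal
  -- The derivative factors as the superposition operator u ↦ dg(x, u) into the dual Lebesgue space
  -- followed by the bounded Hölder pairing, so the C¹ property reduces to continuity of the former.
  let D : Lp F (ENNReal.ofReal q) μ → Lp (F →L[ℝ] ℝ) (ENNReal.ofReal q') μ := fun u =>
    (H.memLp_deriv hqq (Lp.memLp u)).toLp
  have hDc : ∀ u, D u =ᵐ[μ] fun x => dg x (u x) := fun u => MemLp.coeFn_toLp _
  let B := (ContinuousLinearMap.id ℝ (F →L[ℝ] ℝ)).lpPairing μ (ENNReal.ofReal q')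
    (ENNReal.ofReal q)
  have hB : ∀ u h, B (D u) h = ∫ x, dg x (u x) (h x) ∂μ := by
    intro u h
    rw [ContinuousLinearMap.lpPairing_eq_integral]
    refine integral_congr_ae ?_
    filter_upwards [hDc u] with x hx
    simp [hx]
  have hone : 1 ≤ ENNReal.ofReal q' := Fact.out
  obtain ⟨C, hC, hgr⟩ := H.growth
  obtain ⟨C', hC', hrem⟩ := H.remainder_le
  set c : ℝ := 2 ^ (q - 1) with hc
  have hK : ∀ (C : ℝ) (u : Lp F (ENNReal.ofReal q) μ),
      MemLp (fun x => C * (1 + ‖u x‖ ^ (q - 1))) (ENNReal.ofReal q') μ := by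
    intro C u
    have h2 := (MemLp.add (memLp_const (1 : ℝ)) (memLp_rpow_norm hqq (Lp.memLp u)).1).const_mul C
    simp only [Pi.add_apply] at h2
    exact h2
  have hK0 : ∀ (C : ℝ) (_ : 0 ≤ C) (u : Lp F (ENNReal.ofReal q) μ), ∀ᵐ x ∂μ,
      0 ≤ C * (1 + ‖u x‖ ^ (q - 1)) := fun C hC u =>
    Eventually.of_forall fun x => by positivity
  have hDcont : Continuous D := by
    rw [continuous_iff_continuousAt]
    intro u
    have h1 := tendsto_eLpNorm_superposition (μ := μ) hqq
      (R := fun x η => ‖dg x (u x + η) - dg x (u x)‖)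
      (K := fun x => C * (2 + c) * (1 + ‖u x‖ ^ (q - 1)))
      (C := C * c) (by positivity) (hK _ u) (hK0 _ (by positivity) u) (fun _ _ => norm_nonneg _)
      (by
        filter_upwards [hgr] with x hx η
        have h2 := rpow_norm_add_le (q := q) (u x) η
        have h3 : 0 ≤ C * ‖u x‖ ^ (q - 1) := by positivity
        have h4 : 0 ≤ C * c := by positivity
        calc ‖dg x (u x + η) - dg x (u x)‖
          ≤ C * (1 + ‖u x + η‖ ^ (q - 1)) + C * (1 + ‖u x‖ ^ (q - 1)) :=
            (norm_sub_le _ _).trans (add_le_add (hx _) (hx _))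
          _ ≤ C * (1 + c * (‖u x‖ ^ (q - 1) + ‖η‖ ^ (q - 1))) + C * (1 + ‖u x‖ ^ (q - 1)) := by
            gcongr
          _ ≤ _ := by nlinarith [h3, h4])
      (by
        intro x
        have h2 : Continuous fun η : F => ‖dg x (u x + η) - dg x (u x)‖ := by
          have := H.continuous x
          fun_prop
        simpa using h2.tendsto 0)
      (by
        intro h hh
        exact ((H.aesm_deriv _ ((Lp.aestronglyMeasurable u).add hh)).sub
          (H.aesm_deriv _ (Lp.aestronglyMeasurable u))).norm)
    rw [ContinuousAt, tendsto_iff_edist_tendsto_0]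
    have h2 : Tendsto (fun v => v - u) (𝓝 u) (𝓝 0) := by
      have : Continuous fun v => v - u := by fun_prop
      simpa using this.tendsto u
    refine (h1.comp h2).congr fun v => ?_
    rw [Lp.edist_def, Function.comp_apply, eLpNorm_norm]
    refine eLpNorm_congr_ae ?_
    filter_upwards [hDc v, hDc u, Lp.coeFn_sub v u] with x a b c
    rw [c, Pi.sub_apply, Pi.sub_apply, a, b, add_sub_cancel]
  have hderiv : ∀ u, HasFDerivAt (fun u : Lp F (ENNReal.ofReal q) μ => ∫ x, g x (u x) ∂μ)
      (B (D u)) u := by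
    intro u
    -- The remainder divided by ‖η‖ has growth q − 1 and vanishes as η → 0 by differentiability,
    -- with the value 0 at η = 0 supplied by the convention for the inverse. Its norm in the dual
    -- space is small, and Hölder against h gives o(‖h‖).
    have h1 := tendsto_eLpNorm_superposition (μ := μ) hqq
      (R := fun x η => ‖η‖⁻¹ * ‖g x (u x + η) - g x (u x) - dg x (u x) η‖)
      (K := fun x => C' * (1 + ‖u x‖ ^ (q - 1)))
      (C := C') (by positivity) (hK _ u) (hK0 _ (by positivity) u) (fun _ _ => by positivity)
      (by
        filter_upwards [hrem] with x hx η
        rcases eq_or_ne η 0 with rfl | hη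
        · simp only [norm_zero, inv_zero, zero_mul]
          positivity
        · rw [inv_mul_le_iff₀ (norm_pos_iff.2 hη), mul_comm]
          exact hx _ _)
      (by
        intro x
        have h2 := hasFDerivAt_iff_tendsto.1 (H.hasFDerivAt x (u x))
        have h3 : Tendsto (fun η : F => u x + η) (𝓝 0) (𝓝 (u x)) := by
          have : Continuous fun η : F => u x + η := by fun_prop
          simpa using this.tendsto 0
        simpa [Function.comp_def] using h2.comp h3)
      (by
        intro h hh
        have h2 : AEStronglyMeasurable (fun x => dg x (u x) (h x)) μ :=
          (ContinuousLinearMap.id ℝ (F →L[ℝ] ℝ)).aestronglyMeasurable_comp₂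
            (H.aesm_deriv _ (Lp.aestronglyMeasurable u)) hh
        exact hh.norm.aemeasurable.inv.aestronglyMeasurable.mul
          ((((H.aesm _ ((Lp.aestronglyMeasurable u).add hh))).sub
          (H.aesm _ (Lp.aestronglyMeasurable u))).sub h2).norm)
    rw [hasFDerivAt_iff_isLittleO_nhds_zero, Asymptotics.isLittleO_iff]
    intro ε hε
    filter_upwards [h1.eventually_lt_const (ENNReal.ofReal_pos.2 hε)] with h hh
    set R : α → ℝ := fun x => ‖h x‖⁻¹ * ‖g x (u x + h x) - g x (u x) - dg x (u x) (h x)‖ with hR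
    have hsum : MemLp (fun x => u x + h x) (ENNReal.ofReal q) μ := (Lp.memLp u).add (Lp.memLp h)
    have i1 := H.integrable (Lp.memLp u)
    have i2 := H.integrable_deriv (Lp.memLp u) (Lp.memLp h)
    have i3 : ∫ x, g x ((u + h : Lp F (ENNReal.ofReal q) μ) x) ∂μ = ∫ x, g x (u x + h x) ∂μ := by
      refine integral_congr_ae ?_
      filter_upwards [Lp.coeFn_add u h] with x hx
      rw [hx, Pi.add_apply]
    have i4 := H.integrable hsum
    have i5 : Integrable (fun x => g x (u x + h x) - g x (u x)) μ := i4.sub i1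
    rw [hB, i3, ← integral_sub i4 i1, ← integral_sub i5 i2]
    have hRm : AEStronglyMeasurable R μ :=
      (Lp.aestronglyMeasurable h).norm.aemeasurable.inv.aestronglyMeasurable.mul
        (i5.sub i2).1.norm
    have key : ‖∫ x, g x (u x + h x) - g x (u x) - dg x (u x) (h x) ∂μ‖ₑ ≤
        ENNReal.ofReal ε * ‖h‖ₑ := by
      refine (enorm_integral_le_lintegral_enorm _).trans ?_
      have h3 : ∀ x, ‖g x (u x + h x) - g x (u x) - dg x (u x) (h x)‖ₑ = ‖R x‖ₑ * ‖h x‖ₑ := by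
        intro x
        rw [← enorm_norm (h x), ← enorm_mul, hR, ← enorm_norm]
        congr 1
        rcases eq_or_ne (h x) 0 with h0 | h0
        · simp [h0]
        · have := norm_ne_zero_iff.2 h0
          field_simp
      simp only [h3]
      have h4 := eLpNorm_smul_le_mul_eLpNorm (p := ENNReal.ofReal q') (q := ENNReal.ofReal q)
        (r := 1) (Lp.aestronglyMeasurable h) hRm
      rw [eLpNorm_one_eq_lintegral_enorm] at h4
      simp only [Pi.smul_apply', enorm_smul] at h4
      refine h4.trans ?_
      rw [Lp.enorm_def]
      gcongr
    rw [← ENNReal.ofReal_le_ofReal_iff (by positivity), ENNReal.ofReal_mul hε.le,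
      ofReal_norm, ofReal_norm]
    exact key
  refine ⟨?_, fun u h => by rw [(hderiv u).fderiv, hB]⟩
  rw [contDiff_one_iff_fderiv]
  refine ⟨fun u => (hderiv u).differentiableAt, ?_⟩
  have h1 : fderiv ℝ (fun u : Lp F (ENNReal.ofReal q) μ => ∫ x, g x (u x) ∂μ) =
      fun u => B (D u) := funext fun u => (hderiv u).fderiv
  rw [h1]
  exact B.continuous.comp hDcont

end IsSmoothIntegrand

end Functional

end Nemytskii

/-! ### The vector field `a` -/

section Field

variable {N : ℕ} {p : ℝ} {a₀ ϑ : ℝ → ℝ} {c₁ : ℝ}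

theorem HypTheta.pos (h : HypTheta p ϑ c₁) {t : ℝ} (ht : 0 < t) : 0 < ϑ t := by
  have := h.lower t ht
  have := h.c₁_pos
  have : 0 < c₁ * t ^ (p - 1) := by positivity
  linarith [h.lower t ht]

namespace HypA

variable (ha : HypA N p a₀ ϑ)
include ha

theorem differentiableAt {t : ℝ} (ht : 0 < t) : DifferentiableAt ℝ a₀ t :=
  (ha.contDiffOn.differentiableOn (by simp)).differentiableAt (Ioi_mem_nhds ht)

theorem differentiableAt_fieldA {ξ : E N} (hξ : ξ ≠ 0) : DifferentiableAt ℝ (fieldA a₀) ξ := by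
  have h1 : DifferentiableAt ℝ (fun ξ : E N => ‖ξ‖) ξ := differentiableAt_id.norm ℝ hξ
  have h2 : DifferentiableAt ℝ (fun ξ : E N => a₀ ‖ξ‖) ξ :=
    DifferentiableAt.comp ξ (ha.differentiableAt (norm_pos_iff.2 hξ)) h1
  exact h2.smul differentiableAt_id

omit ha in
/-- The profile `t a₀(t)`, extended by zero to the nonpositive reals. -/
def profile (a₀ : ℝ → ℝ) (t : ℝ) : ℝ := if 0 < t then t * a₀ t else 0

omit ha in
theorem profile_of_pos {t : ℝ} (ht : 0 < t) : profile a₀ t = t * a₀ t := if_pos ht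

omit ha in
theorem profile_of_nonpos {t : ℝ} (ht : t ≤ 0) : profile a₀ t = 0 := if_neg (not_lt.2 ht)

theorem profile_nonneg (t : ℝ) : 0 ≤ profile a₀ t := by
  rcases lt_or_ge 0 t with h | h
  · rw [profile_of_pos h]; exact mul_nonneg h.le (ha.pos t h).le
  · rw [profile_of_nonpos h]

theorem profile_monotone : Monotone (profile a₀) := by
  intro s t hst
  rcases lt_or_ge 0 s with h | h
  · rw [profile_of_pos h, profile_of_pos (h.trans_le hst)]
    exact ha.strictMono.monotoneOn h (h.trans_le hst) hst
  · rw [profile_of_nonpos h]; exact ha.profile_nonneg t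

theorem continuous_profile : Continuous (profile a₀) := by
  rw [continuous_iff_continuousAt]
  intro t
  rcases lt_trichotomy t 0 with h | rfl | h
  · have h0 : ContinuousAt (fun _ : ℝ => (0 : ℝ)) t := continuousAt_const
    refine h0.congr ?_
    filter_upwards [Iio_mem_nhds h] with s hs
    rw [profile_of_nonpos (le_of_lt hs)]
  · rw [continuousAt_iff_continuous_left'_right']
    constructor
    · have h0 : ContinuousWithinAt (fun _ : ℝ => (0 : ℝ)) (Set.Iio 0) 0 :=
        continuousWithinAt_const
      exact h0.congr (fun s hs => profile_of_nonpos (le_of_lt hs)) (profile_of_nonpos le_rfl)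
    · rw [ContinuousWithinAt, profile_of_nonpos le_rfl]
      refine ha.tendsto_zero.congr' ?_
      filter_upwards [self_mem_nhdsWithin] with s hs
      rw [profile_of_pos hs]
  · refine (continuousAt_id.mul (ha.differentiableAt h).continuousAt).congr ?_
    filter_upwards [Ioi_mem_nhds h] with s hs
    rw [profile_of_pos hs]; rfl

theorem norm_fieldA (ξ : E N) : ‖fieldA a₀ ξ‖ = profile a₀ ‖ξ‖ := by
  rcases eq_or_ne ξ 0 with rfl | hξ
  · simp [fieldA, profile]
  · have h := norm_pos_iff.2 hξ
    rw [fieldA, norm_smul, Real.norm_of_nonneg (ha.pos _ h).le, profile_of_pos h, mul_comm]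

omit ha in
theorem inner_fieldA_self (ξ : E N) : inner ℝ (fieldA a₀ ξ) ξ = profile a₀ ‖ξ‖ * ‖ξ‖ := by
  rcases eq_or_ne ξ 0 with rfl | hξ
  · simp [fieldA]
  · have h := norm_pos_iff.2 hξ
    rw [fieldA, inner_smul_left, real_inner_self_eq_norm_sq, profile_of_pos h]
    simp
    ring

theorem continuous_fieldA : Continuous (fieldA a₀ : E N → E N) := by
  rw [continuous_iff_continuousAt]
  intro ξ
  rcases eq_or_ne ξ 0 with rfl | hξ
  · have h0 : fieldA a₀ (0 : E N) = 0 := by simp [fieldA]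
    rw [ContinuousAt, h0, tendsto_zero_iff_norm_tendsto_zero]
    simp only [ha.norm_fieldA]
    have := (ha.continuous_profile.comp (continuous_norm (E := E N))).tendsto 0
    simpa [Function.comp_def, profile_of_nonpos le_rfl] using this
  · exact (ha.differentiableAt_fieldA hξ).continuousAt

/-- By Cauchy–Schwarz the product dominates (A(‖ξ‖) − A(‖ζ‖))(‖ξ‖ − ‖ζ‖) with A the profile, and A
is increasing. -/
theorem inner_fieldA_sub_nonneg (ξ ζ : E N) :
    0 ≤ inner ℝ (fieldA a₀ ξ - fieldA a₀ ζ) (ξ - ζ) := by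
  have h1 := real_inner_le_norm (fieldA a₀ ξ) ζ
  have h2 := real_inner_le_norm (fieldA a₀ ζ) ξ
  rw [ha.norm_fieldA] at h1 h2
  rw [inner_sub_left, inner_sub_right, inner_sub_right, inner_fieldA_self, inner_fieldA_self]
  have h3 : 0 ≤ (profile a₀ ‖ξ‖ - profile a₀ ‖ζ‖) * (‖ξ‖ - ‖ζ‖) := by
    rcases le_total ‖ξ‖ ‖ζ‖ with h | h
    · exact mul_nonneg_of_nonpos_of_nonpos (sub_nonpos.2 (ha.profile_monotone h))
        (sub_nonpos.2 h)
    · exact mul_nonneg (sub_nonneg.2 (ha.profile_monotone h)) (sub_nonneg.2 h)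
  nlinarith

/-- The derivative of t a₀(t) is at most c₃ϑ(t)/t, and the logarithmic bound turns this into
(c₃/c)ϑ'(t). Integrating from 0, where t a₀(t) vanishes, gives t a₀(t) ≤ (c₃/c)ϑ(t). -/
theorem profile_le (hN : 1 ≤ N) (hϑ : HypTheta p ϑ c₁) :
    ∃ C : ℝ, 0 ≤ C ∧ ∀ t : ℝ, 0 < t → profile a₀ t ≤ C * (1 + t ^ (p - 1)) := by
  obtain ⟨c₃, hc₃, hup⟩ := ha.upper
  obtain ⟨c, c₀, hc, -, hlog⟩ := hϑ.logDeriv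
  obtain ⟨c₂, hc₂, hϑup⟩ := hϑ.upper
  have hϑd : ∀ t : ℝ, 0 < t → DifferentiableAt ℝ ϑ t := fun t ht =>
    (hϑ.contDiffOn.differentiableOn (by simp)).differentiableAt (Ioi_mem_nhds ht)
  have hAd : ∀ t : ℝ, 0 < t → HasDerivAt (fun t => t * a₀ t) (a₀ t + t * deriv a₀ t) t := by
    intro t ht
    exact ((hasDerivAt_id t).mul (ha.differentiableAt ht).hasDerivAt).congr_deriv (by simp)
  let e : E N := EuclideanSpace.single ⟨0, hN⟩ 1
  have he : ‖e‖ = 1 := by simp [e]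
  -- The derivative of t a₀(t) is the component of ∇a(te)e along a unit vector e, and so is bounded
  -- by ‖∇a(te)‖.
  have hder : ∀ t : ℝ, 0 < t → a₀ t + t * deriv a₀ t ≤ c₃ * (ϑ t / t) := by
    intro t ht
    have hne : t • e ≠ 0 := smul_ne_zero ht.ne' (norm_ne_zero_iff.1 (by rw [he]; norm_num))
    have hnorm : ∀ s : ℝ, 0 < s → ‖s • e‖ = s := fun s hs => by
      rw [norm_smul, he, mul_one, Real.norm_of_nonneg hs.le]
    have h1 : HasDerivAt (fun s : ℝ => s • e) e t := by
      simpa using (hasDerivAt_id t).smul_const e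
    have h2 := (ha.differentiableAt_fieldA hne).hasFDerivAt.comp_hasDerivAt t h1
    have h3 := (innerSL ℝ e).hasFDerivAt.comp_hasDerivAt t h2
    have h4 : (⇑(innerSL ℝ e) ∘ (fieldA a₀ ∘ fun s : ℝ => s • e)) =ᶠ[𝓝 t]
        fun t => t * a₀ t := by
      filter_upwards [Ioi_mem_nhds ht] with s hs
      simp only [Function.comp_apply, fieldA, innerSL_apply_apply, hnorm s hs, inner_smul_right,
        real_inner_self_eq_norm_sq, he]
      ring
    have h5 := (h3.congr_of_eventuallyEq h4.symm).unique (hAd t ht)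
    rw [← h5]
    have h6 := hup _ hne
    rw [hnorm t ht] at h6
    calc innerSL ℝ e (fderiv ℝ (fieldA a₀) (t • e) e)
        ≤ ‖e‖ * ‖fderiv ℝ (fieldA a₀) (t • e) e‖ := by
          rw [innerSL_apply_apply]; exact real_inner_le_norm _ _
      _ ≤ ‖e‖ * (‖fderiv ℝ (fieldA a₀) (t • e)‖ * ‖e‖) := by
        gcongr; exact ContinuousLinearMap.le_opNorm _ _
      _ ≤ c₃ * (ϑ t / t) := by rw [he]; simpa using h6
  have hmono : MonotoneOn (fun t => c₃ / c * ϑ t - t * a₀ t) (Set.Ioi 0) := by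
    have hd : ∀ t : ℝ, 0 < t → HasDerivAt (fun t => c₃ / c * ϑ t - t * a₀ t)
        (c₃ / c * deriv ϑ t - (a₀ t + t * deriv a₀ t)) t := fun t ht =>
      ((hϑd t ht).hasDerivAt.const_mul _).sub (hAd t ht)
    refine monotoneOn_of_deriv_nonneg (convex_Ioi 0)
      (fun t ht => (hd t ht).continuousAt.continuousWithinAt)
      (fun t ht => (hd t (by simpa using ht)).differentiableAt.differentiableWithinAt) ?_
    intro t ht
    rw [interior_Ioi, Set.mem_Ioi] at ht
    rw [(hd t ht).deriv]
    have h1 := (hlog t ht).1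
    rw [le_div_iff₀ (hϑ.pos ht)] at h1
    have h2 : c₃ * (ϑ t / t) ≤ c₃ / c * deriv ϑ t := by
      rw [mul_div_assoc', div_mul_eq_mul_div, div_le_div_iff₀ ht hc]
      nlinarith
    linarith [hder t ht]
  refine ⟨c₃ / c * c₂, by positivity, fun t ht => ?_⟩
  rw [profile_of_pos ht]
  have h1 : Tendsto (fun s => t * a₀ t - s * a₀ s) (𝓝[>] 0) (𝓝 (t * a₀ t - 0)) :=
    tendsto_const_nhds.sub ha.tendsto_zero
  rw [sub_zero] at h1
  have h2 : t * a₀ t ≤ c₃ / c * ϑ t := by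
    refine le_of_tendsto h1 ?_
    filter_upwards [Ioo_mem_nhdsGT ht] with s hs
    have h3 := hmono hs.1 ht hs.2.le
    have h4 : 0 < c₃ / c * ϑ s := mul_pos (by positivity) (hϑ.pos hs.1)
    simp only at h3
    linarith
  refine h2.trans ?_
  rw [mul_assoc]
  gcongr
  exact hϑup t ht

theorem norm_fieldA_le (hN : 1 ≤ N) (hϑ : HypTheta p ϑ c₁) :
    ∃ C : ℝ, 0 ≤ C ∧ ∀ ξ : E N, ‖fieldA a₀ ξ‖ ≤ C * (1 + ‖ξ‖ ^ (p - 1)) := by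
  obtain ⟨C, hC, h⟩ := ha.profile_le hN hϑ
  refine ⟨C, hC, fun ξ => ?_⟩
  rw [ha.norm_fieldA]
  rcases eq_or_ne ξ 0 with rfl | hξ
  · rw [norm_zero, profile_of_nonpos le_rfl]
    positivity
  · exact h _ (norm_pos_iff.2 hξ)

omit ha in
theorem G₀_eq {t : ℝ} (ht : 0 ≤ t) : G₀ a₀ t = ∫ s in (0 : ℝ)..t, profile a₀ s := by
  refine intervalIntegral.integral_congr_ae (Eventually.of_forall fun s hs => ?_)
  rw [Set.uIoc_of_le ht] at hs
  rw [profile_of_pos hs.1]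

/-- Away from the origin this is the chain rule. At the origin the norm is not differentiable, but
the radial primitive is o(t) there because the profile vanishes at 0. -/
theorem hasFDerivAt_G (ξ : E N) :
    HasFDerivAt (fun ξ : E N => G₀ a₀ ‖ξ‖) (innerSL ℝ (fieldA a₀ ξ)) ξ := by
  let P : ℝ → ℝ := fun t => ∫ s in (0 : ℝ)..t, profile a₀ s
  have hP : ∀ t, HasDerivAt P (profile a₀ t) t := fun t =>
    intervalIntegral.integral_hasDerivAt_right (ha.continuous_profile.intervalIntegrable _ _)
      (ha.continuous_profile.stronglyMeasurableAtFilter _ _) ha.continuous_profile.continuousAt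
  have hG : (fun ξ : E N => G₀ a₀ ‖ξ‖) = fun ξ => P ‖ξ‖ :=
    funext fun ξ => G₀_eq (norm_nonneg ξ)
  rw [hG]
  rcases eq_or_ne ξ 0 with rfl | hξ
  · have h0 : fieldA a₀ (0 : E N) = 0 := by simp [fieldA]
    have h1 := hP 0
    rw [profile_of_nonpos le_rfl, hasDerivAt_iff_isLittleO_nhds_zero] at h1
    rw [h0, map_zero, hasFDerivAt_iff_isLittleO_nhds_zero]
    have h2 : Tendsto (fun ξ : E N => ‖ξ‖) (𝓝 0) (𝓝 0) := by
      simpa using (continuous_norm (E := E N)).tendsto 0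
    have h3 := (h1.comp_tendsto h2)
    refine Asymptotics.IsLittleO.of_norm_right ?_
    simpa [Function.comp_def] using h3
  · have hpos := norm_pos_iff.2 hξ
    have h1 : HasFDerivAt (fun ξ : E N => ‖ξ‖ ^ 2) (2 • (innerSL ℝ ξ)) ξ :=
      (hasStrictFDerivAt_norm_sq ξ).hasFDerivAt
    have h2 := h1.sqrt (by positivity)
    simp only [Real.sqrt_sq (norm_nonneg _)] at h2
    have h3 := (hP ‖ξ‖).comp_hasFDerivAt ξ h2
    refine h3.congr_fderiv ?_
    ext y
    simp only [profile_of_pos hpos, fieldA, smul_apply, innerSL_apply_apply,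
      inner_smul_left]
    simp
    field_simp

theorem G₀_nonneg {t : ℝ} (ht : 0 ≤ t) : 0 ≤ G₀ a₀ t := by
  rw [G₀_eq ht]
  exact intervalIntegral.integral_nonneg ht fun s _ => ha.profile_nonneg s

theorem inner_fieldA_ge (hp : 1 < p) :
    ∃ η : ℝ, 0 < η ∧ ∀ ξ : E N, η * ‖ξ‖ ^ p ≤ inner ℝ (fieldA a₀ ξ) ξ := by
  obtain ⟨η, hη, h⟩ := ha.primitive_lower
  refine ⟨η, hη, fun ξ => ?_⟩
  rw [inner_fieldA_self]
  rcases eq_or_ne ξ 0 with rfl | hξ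
  · simp [Real.zero_rpow (show p ≠ 0 by linarith)]
  · have hpos := norm_pos_iff.2 hξ
    rw [profile_of_pos hpos]
    have := h _ hpos
    nlinarith [ha.G₀_nonneg hpos.le]

theorem inner_fieldA_sub_le :
    ∃ c : ℝ, 0 < c ∧ ∀ ξ : E N, inner ℝ (fieldA a₀ ξ) ξ - p * G₀ a₀ ‖ξ‖ ≤ c := by
  obtain ⟨c, hc, h⟩ := ha.primitive_upper
  refine ⟨c, hc, fun ξ => ?_⟩
  rw [inner_fieldA_self]
  rcases eq_or_ne ξ 0 with rfl | hξ
  · simp [G₀, hc.le]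
  · have hpos := norm_pos_iff.2 hξ
    rw [profile_of_pos hpos]
    have := h _ hpos
    nlinarith

theorem G₀_le (hN : 1 ≤ N) (hp : 1 < p) (hϑ : HypTheta p ϑ c₁) :
    ∃ C : ℝ, 0 ≤ C ∧ ∀ ξ : E N, G₀ a₀ ‖ξ‖ ≤ C * (1 + ‖ξ‖ ^ p) := by
  obtain ⟨C, hC, h⟩ := ha.profile_le hN hϑ
  obtain ⟨η, hη, hlow⟩ := ha.primitive_lower
  refine ⟨2 * C, by positivity, fun ξ => ?_⟩
  rcases eq_or_ne ξ 0 with rfl | hξ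
  · simp only [norm_zero, G₀, intervalIntegral.integral_same]
    positivity
  · have hpos := norm_pos_iff.2 hξ
    have h1 := hlow _ hpos
    have h2 := h _ hpos
    rw [profile_of_pos hpos] at h2
    have h3 : ‖ξ‖ * ‖ξ‖ ^ (p - 1) = ‖ξ‖ ^ p := by
      rw [← Real.rpow_one_add' hpos.le (by linarith)]; congr 1; ring
    have h4 : ‖ξ‖ ≤ 1 + ‖ξ‖ ^ p := by
      rcases le_total ‖ξ‖ 1 with h | h
      · have : 0 ≤ ‖ξ‖ ^ p := by positivity
        linarith
      · have := Real.rpow_le_rpow_of_exponent_le h hp.le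
        rw [Real.rpow_one] at this
        linarith
    have h5 : 0 ≤ η * ‖ξ‖ ^ p := by positivity
    have h6 : ‖ξ‖ * (‖ξ‖ * a₀ ‖ξ‖) ≤ ‖ξ‖ * (C * (1 + ‖ξ‖ ^ (p - 1))) := by gcongr
    have h7 : ‖ξ‖ * (C * (1 + ‖ξ‖ ^ (p - 1))) = C * (‖ξ‖ + ‖ξ‖ ^ p) := by rw [← h3]; ring
    have h8 : C * (‖ξ‖ + ‖ξ‖ ^ p) ≤ C * (2 * (1 + ‖ξ‖ ^ p)) := by gcongr; linarith
    nlinarith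

/-- Uniform monotonicity with an arbitrarily small loss, which treats p ≥ 2 and p < 2 alike. If ξ −
ζ is small relative to ‖ξ‖ + ‖ζ‖, the loss term absorbs it. Otherwise a definite part of the segment
from ζ to ξ stays away from the origin, and the ellipticity bound integrated over that part already
controls (‖ξ‖ + ‖ζ‖)^p. -/
theorem norm_sub_rpow_le (hp : 1 < p) (hϑ : HypTheta p ϑ c₁) {ε : ℝ} (hε : 0 < ε) :
    ∃ C : ℝ, 0 ≤ C ∧ ∀ ξ ζ : E N, ‖ξ - ζ‖ ^ p ≤
      ε * (‖ξ‖ ^ p + ‖ζ‖ ^ p) + C * inner ℝ (fieldA a₀ ξ - fieldA a₀ ζ) (ξ - ζ) := by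
  have hc₁ := hϑ.c₁_pos
  have hp0 : 0 < p := by linarith
  -- Chosen so that (2δ)^p = ε, which is exactly what the first case needs.
  set δ : ℝ := ε ^ (1 / p) / 2 with hδ
  have hδ0 : 0 < δ := by positivity
  set L : ℝ := c₁ * (δ / 4) ^ (p - 1) * δ ^ 2 / 4 with hL
  have hL0 : 0 < L := by positivity
  refine ⟨1 / L, by positivity, fun ξ ζ => ?_⟩
  have hnonneg := ha.inner_fieldA_sub_nonneg ξ ζ
  set η := ξ - ζ with hη
  set S := ‖ξ‖ + ‖ζ‖ with hS
  have hηS : ‖η‖ ≤ S := norm_sub_le _ _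
  have hS0 : 0 ≤ S := by positivity
  rcases le_or_gt ‖η‖ (δ * S) with hcase | hcase
  · have h1 : S ^ p ≤ 2 ^ p * (‖ξ‖ ^ p + ‖ζ‖ ^ p) := by
      have h2 : S ≤ 2 * max ‖ξ‖ ‖ζ‖ := by
        linarith [le_max_left ‖ξ‖ ‖ζ‖, le_max_right ‖ξ‖ ‖ζ‖]
      calc S ^ p ≤ (2 * max ‖ξ‖ ‖ζ‖) ^ p := by gcongr
        _ = 2 ^ p * (max ‖ξ‖ ‖ζ‖) ^ p := Real.mul_rpow (by norm_num) (by positivity)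
        _ ≤ _ := by
          gcongr
          rcases le_total ‖ξ‖ ‖ζ‖ with h | h
          · rw [max_eq_right h]; exact le_add_of_nonneg_left (by positivity)
          · rw [max_eq_left h]; exact le_add_of_nonneg_right (by positivity)
    have h3 : δ ^ p * 2 ^ p = ε := by
      rw [← Real.mul_rpow hδ0.le (by norm_num), hδ, div_mul_cancel₀ _ (by norm_num),
        ← Real.rpow_mul hε.le, one_div_mul_cancel hp0.ne', Real.rpow_one]
    have h4 : ‖η‖ ^ p ≤ ε * (‖ξ‖ ^ p + ‖ζ‖ ^ p) := by
      calc ‖η‖ ^ p ≤ (δ * S) ^ p := by gcongr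
        _ = δ ^ p * S ^ p := Real.mul_rpow hδ0.le hS0
        _ ≤ δ ^ p * (2 ^ p * (‖ξ‖ ^ p + ‖ζ‖ ^ p)) := by gcongr
        _ = _ := by rw [← mul_assoc, h3]
    have : 0 ≤ 1 / L * inner ℝ (fieldA a₀ ξ - fieldA a₀ ζ) η := by positivity
    linarith
  · have hη0 : 0 < ‖η‖ := lt_of_le_of_lt (by positivity) hcase
    have hSpos : 0 < S := hη0.trans_le hηS
    let ψ : ℝ → ℝ := fun s => inner ℝ (fieldA a₀ (ζ + s • η)) η
    have hψmono : Monotone ψ := by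
      intro s t hst
      rcases hst.eq_or_lt with rfl | hst
      · rfl
      have h1 := ha.inner_fieldA_sub_nonneg (ζ + t • η) (ζ + s • η)
      rw [add_sub_add_left_eq_sub, ← sub_smul, inner_smul_right, inner_sub_left] at h1
      have h2 := nonneg_of_mul_nonneg_right h1 (sub_pos.2 hst)
      simp only [ψ]
      linarith
    -- The parameter of the point nearest the origin on the line through ζ and ξ.
    set s₀ : ℝ := -(inner ℝ ζ η) / ‖η‖ ^ 2 with hs₀
    have hdist : ∀ s : ℝ, |s - s₀| * ‖η‖ ≤ ‖ζ + s • η‖ := by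
      intro s
      have h1 : s₀ * ‖η‖ ^ 2 = -(inner ℝ ζ η) := by
        rw [hs₀, div_mul_cancel₀ _ (by positivity)]
      have h2 := abs_real_inner_le_norm (ζ + s • η) η
      rw [inner_add_left, inner_smul_left, real_inner_self_eq_norm_sq] at h2
      have h3 : inner ℝ ζ η + (starRingEnd ℝ) s * ‖η‖ ^ 2 = (s - s₀) * ‖η‖ ^ 2 := by
        simp only [conj_trivial]; linarith
      rw [h3, abs_mul, abs_of_nonneg (by positivity : 0 ≤ ‖η‖ ^ 2), pow_two, ← mul_assoc] at h2
      exact le_of_mul_le_mul_right h2 hη0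
    have hupper : ∀ s ∈ Set.Icc (0 : ℝ) 1, ‖ζ + s • η‖ ≤ S := by
      intro s hs
      have h1 : ζ + s • η = (1 - s) • ζ + s • ξ := by rw [hη, smul_sub, sub_smul, one_smul]; abel
      rw [h1]
      refine (norm_add_le _ _).trans ?_
      rw [norm_smul, norm_smul, Real.norm_of_nonneg hs.1, Real.norm_of_nonneg (by linarith [hs.2])]
      nlinarith [norm_nonneg ξ, norm_nonneg ζ, hs.1, hs.2]
    -- Whatever s₀ is, the first or the last quarter of [0, 1] keeps distance at least 1/4 from it.
    -- The other parts of the segment contribute nonnegatively by monotonicity of ψ.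
    obtain ⟨l, hl0, hl1, hl⟩ : ∃ l : ℝ, 0 ≤ l ∧ l + 1 / 4 ≤ 1 ∧
        ∀ s ∈ Set.Icc l (l + 1 / 4), 1 / 4 ≤ |s - s₀| := by
      rcases le_total s₀ (1 / 2) with h | h
      · refine ⟨3 / 4, by norm_num, by norm_num, fun s hs => ?_⟩
        rw [le_abs]; left; linarith [hs.1]
      · refine ⟨0, by norm_num, by norm_num, fun s hs => ?_⟩
        rw [le_abs]; right; linarith [hs.2]
    have hlow : ∀ s ∈ Set.Icc l (l + 1 / 4), δ * S / 4 ≤ ‖ζ + s • η‖ := by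
      intro s hs
      have h1 := hdist s
      have h2 : 1 / 4 * ‖η‖ ≤ |s - s₀| * ‖η‖ := by gcongr; exact hl s hs
      linarith
    have hne : ∀ s ∈ Set.Icc l (l + 1 / 4), ζ + s • η ≠ 0 := by
      intro s hs
      have : 0 < δ * S / 4 := by positivity
      exact norm_pos_iff.1 (this.trans_le (hlow s hs))
    have hψd : ∀ s ∈ Set.Icc l (l + 1 / 4), HasDerivAt ψ
        (inner ℝ (fderiv ℝ (fieldA a₀) (ζ + s • η) η) η) s := by
      intro s hs
      have h1 : HasDerivAt (fun s : ℝ => ζ + s • η) η s := by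
        simpa using ((hasDerivAt_id s).smul_const η).const_add ζ
      have h2 := (ha.differentiableAt_fieldA (hne s hs)).hasFDerivAt.comp_hasDerivAt s h1
      have h3 := h2.inner ℝ (hasDerivAt_const s η)
      simpa [ψ] using h3
    have hder : ∀ s ∈ Set.Icc l (l + 1 / 4),
        4 * L * S ^ p ≤ inner ℝ (fderiv ℝ (fieldA a₀) (ζ + s • η) η) η := by
      intro s hs
      refine le_trans ?_ (ha.lower _ (hne s hs) η)
      set t := ‖ζ + s • η‖ with ht
      have ht0 : 0 < t := norm_pos_iff.2 (hne s hs)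
      have htS : t ≤ S := hupper s ⟨hl0.trans hs.1, hs.2.trans hl1⟩
      have h1 : c₁ * ((δ / 4) * S) ^ (p - 1) ≤ ϑ t := by
        refine le_trans ?_ (hϑ.lower t ht0)
        have h3 : δ / 4 * S ≤ t := by linarith [hlow s hs]
        have h4 : 0 ≤ p - 1 := by linarith
        gcongr
      have h2 : c₁ * ((δ / 4) * S) ^ (p - 1) / S ≤ ϑ t / t := by
        have := (hϑ.pos ht0).le
        gcongr
      have h5 : (δ * S) ^ 2 ≤ ‖η‖ ^ 2 := by gcongr
      have h6 : 4 * L * S ^ p = c₁ * ((δ / 4) * S) ^ (p - 1) / S * (δ * S) ^ 2 := by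
        have h7 : S ^ p = S ^ (p - 1) * S := by
          rw [← Real.rpow_add_one hSpos.ne']; congr 1; ring
        rw [hL, Real.mul_rpow (by positivity) hS0, h7]
        field_simp
      rw [h6]
      have := (hϑ.pos ht0).le
      gcongr
    have hmv : 4 * L * S ^ p * (l + 1 / 4 - l) ≤ ψ (l + 1 / 4) - ψ l := by
      refine (convex_Icc l (l + 1 / 4)).mul_sub_le_image_sub_of_le_deriv
        (fun s hs => (hψd s hs).continuousAt.continuousWithinAt)
        (fun s hs => (hψd s (interior_subset hs)).differentiableAt.differentiableWithinAt)
        (fun s hs => ?_) l (Set.left_mem_Icc.2 (by linarith)) _ (Set.right_mem_Icc.2 (by linarith))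
        (by linarith)
      rw [(hψd s (interior_subset hs)).deriv]
      exact hder s (interior_subset hs)
    have h0 := hψmono hl0
    have h1 := hψmono hl1
    have h2 : ψ 1 - ψ 0 = inner ℝ (fieldA a₀ ξ - fieldA a₀ ζ) η := by
      simp only [ψ, zero_smul, add_zero, one_smul, inner_sub_left]
      rw [hη, add_sub_cancel]
    have h3 : L * S ^ p ≤ inner ℝ (fieldA a₀ ξ - fieldA a₀ ζ) η := by
      rw [← h2]
      nlinarith
    have h4 : ‖η‖ ^ p ≤ S ^ p := by gcongr
    have h5 : ‖η‖ ^ p ≤ 1 / L * inner ℝ (fieldA a₀ ξ - fieldA a₀ ζ) η := by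
      rw [one_div, le_inv_mul_iff₀ hL0]
      exact le_trans (by gcongr) h3
    have : 0 ≤ ε * (‖ξ‖ ^ p + ‖ζ‖ ^ p) := by positivity
    linarith

theorem isSmoothIntegrand (hN : 1 ≤ N) (hϑ : HypTheta p ϑ c₁) {α : Type*}
    [MeasurableSpace α] (μ : Measure α) :
    IsSmoothIntegrand μ p (fun _ (ξ : E N) => G₀ a₀ ‖ξ‖) (fun _ ξ => innerSL ℝ (fieldA a₀ ξ)) := by
  have hcont : Continuous fun ξ : E N => innerSL ℝ (fieldA a₀ ξ) :=
    (innerSL ℝ).continuous.comp ha.continuous_fieldA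
  have hG : Continuous fun ξ : E N => G₀ a₀ ‖ξ‖ :=
    continuous_iff_continuousAt.2 fun ξ => (ha.hasFDerivAt_G ξ).continuousAt
  obtain ⟨C, hC, h⟩ := ha.norm_fieldA_le hN hϑ
  exact
    { hasFDerivAt := fun _ ξ => ha.hasFDerivAt_G ξ
      continuous := fun _ => hcont
      zero := fun _ => by simp [G₀]
      aesm := fun h hh => hG.comp_aestronglyMeasurable hh
      aesm_deriv := fun h hh => hcont.comp_aestronglyMeasurable hh
      growth := ⟨C, hC, Eventually.of_forall fun _ ξ => by
        rw [innerSL_apply_norm]; exact h ξ⟩ }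

end HypA

end Field

/-! ### Inequalities for test functions -/

section Test

/-- Jensen's inequality for the p-th power, from Hölder against the constant 1. -/
theorem rpow_lintegral_le_lintegral_rpow {β : Type*} [MeasurableSpace β] {ν : Measure β}
    [IsProbabilityMeasure ν] {f : β → ℝ≥0∞} (hf : AEMeasurable f ν) {p : ℝ} (hp : 1 ≤ p) :
    (∫⁻ x, f x ∂ν) ^ p ≤ ∫⁻ x, f x ^ p ∂ν := by
  have hp0 : 0 < p := by linarith
  have h := ENNReal.lintegral_mul_norm_pow_le (μ := ν) (hf.pow_const p)
    (aemeasurable_const (b := (1 : ℝ≥0∞))) (p := 1 / p) (q := 1 - 1 / p) (by positivity)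
    (by rw [sub_nonneg, div_le_one hp0]; exact hp) (by ring)
  simp only [← ENNReal.rpow_mul, mul_one_div_cancel hp0.ne', ENNReal.rpow_one, ENNReal.one_rpow,
    mul_one, lintegral_const, measure_univ] at h
  calc (∫⁻ x, f x ∂ν) ^ p ≤ ((∫⁻ x, f x ^ p ∂ν) ^ (1 / p)) ^ p := by gcongr
    _ = _ := by rw [← ENNReal.rpow_mul, one_div_mul_cancel hp0.ne', ENNReal.rpow_one]

variable {N : ℕ} {p : ℝ}

/-- Translations of a compactly supported smooth function in the `p`-th mean. -/
theorem lintegral_translate_sub_le (hp : 1 ≤ p) {ψ : E N → ℝ} (hψ : ContDiff ℝ 1 ψ) (h : E N) :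
    ∫⁻ x, ‖ψ (x + h) - ψ x‖ₑ ^ p ≤ ‖h‖ₑ ^ p * ∫⁻ x, ‖fderiv ℝ ψ x‖ₑ ^ p := by
  have hp0 : 0 ≤ p := by linarith
  have hc : Continuous (fderiv ℝ ψ) := hψ.continuous_fderiv (by simp)
  have hd : Differentiable ℝ ψ := hψ.differentiable (by simp)
  set ν : Measure ℝ := volume.restrict (Set.Ioc 0 1) with hν
  have : IsProbabilityMeasure ν := ⟨by simp [hν]⟩
  have hpt : ∀ x, ‖ψ (x + h) - ψ x‖ₑ ^ p ≤ ∫⁻ t, (‖fderiv ℝ ψ (x + t • h)‖ₑ * ‖h‖ₑ) ^ p ∂ν := by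
    intro x
    have h1 : ∀ t : ℝ, HasDerivAt (fun t : ℝ => ψ (x + t • h)) (fderiv ℝ ψ (x + t • h) h) t := by
      intro t
      have h2 : HasDerivAt (fun t : ℝ => x + t • h) h t := by
        simpa using ((hasDerivAt_id t).smul_const h).const_add x
      exact (hd _).hasFDerivAt.comp_hasDerivAt t h2
    have hcont : Continuous fun t : ℝ => fderiv ℝ ψ (x + t • h) h := by fun_prop
    have h3 := intervalIntegral.integral_eq_sub_of_hasDerivAt (a := 0) (b := 1)
      (fun t _ => h1 t) (hcont.intervalIntegrable _ _)
    simp only [one_smul, zero_smul, add_zero] at h3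
    rw [← h3, intervalIntegral.integral_of_le zero_le_one]
    refine le_trans ?_ (rpow_lintegral_le_lintegral_rpow (by fun_prop) hp)
    gcongr
    refine (enorm_integral_le_lintegral_enorm _).trans (lintegral_mono fun t => ?_)
    exact ContinuousLinearMap.le_opENorm _ _
  calc ∫⁻ x, ‖ψ (x + h) - ψ x‖ₑ ^ p
      ≤ ∫⁻ x, ∫⁻ t, (‖fderiv ℝ ψ (x + t • h)‖ₑ * ‖h‖ₑ) ^ p ∂ν := lintegral_mono hpt
    _ = ∫⁻ t, ∫⁻ x, (‖fderiv ℝ ψ (x + t • h)‖ₑ * ‖h‖ₑ) ^ p ∂volume ∂ν := by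
        refine lintegral_lintegral_swap ?_
        have : Continuous fun q : E N × ℝ => (‖fderiv ℝ ψ (q.1 + q.2 • h)‖ₑ * ‖h‖ₑ) ^ p := by
          refine ENNReal.continuous_rpow_const.comp ?_
          refine ENNReal.continuous_mul_const (by simp) |>.comp ?_
          fun_prop
        exact this.measurable.aemeasurable
    _ = ∫⁻ t, (∫⁻ x, ‖fderiv ℝ ψ x‖ₑ ^ p) * ‖h‖ₑ ^ p ∂ν := by
        refine lintegral_congr fun t => ?_
        rw [lintegral_add_right_eq_self (fun x => (‖fderiv ℝ ψ x‖ₑ * ‖h‖ₑ) ^ p) (t • h)]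
        simp only [ENNReal.mul_rpow_of_nonneg _ _ hp0]
        rw [lintegral_mul_const]
        exact (hc.measurable.enorm.pow_const _)
    _ = _ := by rw [lintegral_const, measure_univ, mul_one, mul_comm]

/-- The Poincaré inequality for functions supported in a bounded set. -/
theorem exists_poincare (hN : 1 ≤ N) (hp : 1 ≤ p) {Ω : Set (E N)} (hΩ : Bornology.IsBounded Ω) :
    ∃ C : ℝ, 0 ≤ C ∧ ∀ ψ : E N → ℝ, ContDiff ℝ 1 ψ → Function.support ψ ⊆ Ω →
      ∫⁻ x, ‖ψ x‖ₑ ^ p ≤ ENNReal.ofReal C ^ p * ∫⁻ x, ‖fderiv ℝ ψ x‖ₑ ^ p := by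
  obtain ⟨R, hR⟩ := hΩ.subset_closedBall 0
  -- A translation longer than the diameter of Ω moves its points outside Ω, so on the support of ψ
  -- the difference ψ(x + h) − ψ(x) is −ψ(x).
  set D : ℝ := 2 * |R| + 1 with hD
  have hD0 : 0 < D := by positivity
  let h : E N := D • EuclideanSpace.single ⟨0, hN⟩ 1
  have hh : ‖h‖ = D := by simp [h, norm_smul, abs_of_pos hD0]
  refine ⟨D, hD0.le, fun ψ hψ hs => ?_⟩
  have h1 := lintegral_translate_sub_le hp hψ h
  have h2 : ‖h‖ₑ = ENNReal.ofReal D := by rw [← ofReal_norm, hh]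
  rw [h2] at h1
  refine le_trans (lintegral_mono fun x => ?_) h1
  by_cases hx : ψ x = 0
  · simp [hx, ENNReal.zero_rpow_of_pos (show 0 < p by linarith)]
  · have hx1 : x ∈ Ω := hs hx
    have hx2 : ψ (x + h) = 0 := by
      by_contra hne
      have hb1 := hR hx1
      have hb2 := hR (hs hne)
      rw [mem_closedBall_zero_iff] at hb1 hb2
      have h3 : ‖h‖ ≤ ‖x + h‖ + ‖x‖ := by
        simpa using norm_sub_le (x + h) x
      have := le_abs_self R
      rw [hh] at h3
      linarith
    rw [hx2, zero_sub, enorm_neg]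

/-- A function with small gradient and small averages over a fine cover is small in `L^p`. -/
theorem lintegral_le_of_averages (hp : 1 ≤ p) {Ω : Set (E N)} {ε : ℝ}
    (hε : 0 < ε) (Z : Finset (E N)) (hZ : Ω ⊆ ⋃ z ∈ Z, Metric.ball z ε) {ψ : E N → ℝ}
    (hψ : ContDiff ℝ 1 ψ) (hs : Function.support ψ ⊆ Ω) (hc : HasCompactSupport ψ) :
    ∫⁻ x, ‖ψ x‖ₑ ^ p ≤ 2 ^ (p - 1) *
      ((volume (Metric.ball (0 : E N) ε))⁻¹ * volume (Metric.ball (0 : E N) (2 * ε)) *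
          ENNReal.ofReal (2 * ε) ^ p * (∫⁻ x, ‖fderiv ℝ ψ x‖ₑ ^ p) +
        volume Ω * ∑ z ∈ Z, ((volume (Metric.ball (0 : E N) ε))⁻¹ *
          ‖∫ x in Metric.ball z ε, ψ x‖ₑ) ^ p) := by
  have hp0 : 0 < p := by linarith
  have hcont := hψ.continuous
  set V := volume (Metric.ball (0 : E N) ε) with hV
  have hVb : ∀ z : E N, volume (Metric.ball z ε) = V := fun z => by
    rw [hV, Measure.addHaar_ball_center]
  have hV0 : V ≠ 0 := (Metric.measure_ball_pos volume _ hε).ne'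
  have hVt : V ≠ ⊤ := measure_ball_lt_top.ne
  set T : ℝ≥0∞ := ∑ z ∈ Z, (V⁻¹ * ‖∫ x in Metric.ball z ε, ψ x‖ₑ) ^ p with hT
  set J : E N → ℝ≥0∞ := fun x => ∫⁻ h in Metric.ball (0 : E N) (2 * ε), ‖ψ (x + h) - ψ x‖ₑ ^ p
    with hJ
  have hpt : ∀ x ∈ Ω, ‖ψ x‖ₑ ^ p ≤ 2 ^ (p - 1) * (V⁻¹ * J x + T) := by
    intro x hx
    obtain ⟨z, hz, hxz⟩ : ∃ z ∈ Z, x ∈ Metric.ball z ε := by simpa using hZ hx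
    -- The uniform probability on a covering ball containing x: ψ(x) is the mean over it of ψ(x) −
    -- ψ(y) plus the average of ψ. The first part involves only translations of length below 2ε.
    let ν : Measure (E N) := V⁻¹ • volume.restrict (Metric.ball z ε)
    have : IsProbabilityMeasure ν := ⟨by
      simp only [ν, Measure.smul_apply, Measure.restrict_apply_univ, hVb, smul_eq_mul]
      exact ENNReal.inv_mul_cancel hV0 hVt⟩
    have hint : Integrable ψ ν :=
      ((hcont.integrable_of_hasCompactSupport hc).restrict).smul_measure (ENNReal.inv_ne_top.2 hV0)
    have h1 : ψ x = ∫ y, (ψ x - ψ y) ∂ν + ∫ y, ψ y ∂ν := by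
      rw [integral_sub (integrable_const _) hint]
      simp
    have h2 : ‖∫ y, (ψ x - ψ y) ∂ν‖ₑ ^ p ≤ V⁻¹ * J x := by
      calc ‖∫ y, (ψ x - ψ y) ∂ν‖ₑ ^ p ≤ (∫⁻ y, ‖ψ x - ψ y‖ₑ ∂ν) ^ p := by
            gcongr; exact enorm_integral_le_lintegral_enorm _
        _ ≤ ∫⁻ y, ‖ψ x - ψ y‖ₑ ^ p ∂ν := rpow_lintegral_le_lintegral_rpow (by fun_prop) hp
        _ = V⁻¹ * ∫⁻ y in Metric.ball z ε, ‖ψ x - ψ y‖ₑ ^ p := by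
            rw [lintegral_smul_measure, smul_eq_mul]
        _ ≤ V⁻¹ * ∫⁻ y in Metric.ball x (2 * ε), ‖ψ x - ψ y‖ₑ ^ p := by
            gcongr
            intro y hy
            rw [Metric.mem_ball] at hy hxz ⊢
            rw [dist_comm] at hxz
            linarith [dist_triangle y z x]
        _ = V⁻¹ * J x := by
            congr 1
            simp only [hJ]
            rw [← lintegral_indicator measurableSet_ball, ← lintegral_indicator measurableSet_ball,
              ← lintegral_add_left_eq_self _ x]
            refine lintegral_congr fun y => ?_
            by_cases hy : y ∈ Metric.ball (0 : E N) (2 * ε)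
            · have hy' : x + y ∈ Metric.ball x (2 * ε) := by simpa using hy
              rw [Set.indicator_of_mem hy, Set.indicator_of_mem hy', enorm_sub_rev]
            · have hy' : x + y ∉ Metric.ball x (2 * ε) := by simpa using hy
              rw [Set.indicator_of_notMem hy, Set.indicator_of_notMem hy']
    have h3 : ‖∫ y, ψ y ∂ν‖ₑ ^ p ≤ T := by
      have h4 : ‖∫ y, ψ y ∂ν‖ₑ = V⁻¹ * ‖∫ x in Metric.ball z ε, ψ x‖ₑ := by
        rw [integral_smul_measure, enorm_smul]
        congr 1
        rw [Real.enorm_of_nonneg ENNReal.toReal_nonneg,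
          ENNReal.ofReal_toReal (ENNReal.inv_ne_top.2 hV0)]
      rw [h4, hT]
      exact Finset.single_le_sum (f := fun z => (V⁻¹ * ‖∫ x in Metric.ball z ε, ψ x‖ₑ) ^ p)
        (fun _ _ => zero_le) hz
    calc ‖ψ x‖ₑ ^ p ≤ (‖∫ y, (ψ x - ψ y) ∂ν‖ₑ + ‖∫ y, ψ y ∂ν‖ₑ) ^ p := by
          gcongr
          conv_lhs => rw [h1]
          exact enorm_add_le _ _
      _ ≤ 2 ^ (p - 1) * (‖∫ y, (ψ x - ψ y) ∂ν‖ₑ ^ p + ‖∫ y, ψ y ∂ν‖ₑ ^ p) :=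
          ENNReal.rpow_add_le_mul_rpow_add_rpow _ _ hp
      _ ≤ _ := by gcongr
  have hJm : Measurable J := by
    refine Measurable.lintegral_prod_right' (f := fun q : E N × E N => ‖ψ (q.1 + q.2) - ψ q.1‖ₑ ^ p) ?_
    exact (ENNReal.continuous_rpow_const.comp (by fun_prop : Continuous
      fun q : E N × E N => ‖ψ (q.1 + q.2) - ψ q.1‖ₑ)).measurable
  have hJint : ∫⁻ x, J x ≤ volume (Metric.ball (0 : E N) (2 * ε)) *
      (ENNReal.ofReal (2 * ε) ^ p * ∫⁻ x, ‖fderiv ℝ ψ x‖ₑ ^ p) := by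
    rw [hJ, lintegral_lintegral_swap]
    · rw [mul_comm (volume _), ← setLIntegral_const]
      refine setLIntegral_mono' measurableSet_ball fun h hh => ?_
      refine (lintegral_translate_sub_le hp hψ h).trans ?_
      gcongr
      rw [← ofReal_norm]
      refine ENNReal.ofReal_le_ofReal ?_
      rw [mem_ball_zero_iff] at hh
      exact hh.le
    · exact (ENNReal.continuous_rpow_const.comp (by fun_prop : Continuous
        fun q : E N × E N => ‖ψ (q.1 + q.2) - ψ q.1‖ₑ)).measurable.aemeasurable
  have hsupp : ∫⁻ x, ‖ψ x‖ₑ ^ p = ∫⁻ x in Ω, ‖ψ x‖ₑ ^ p := by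
    symm
    refine setLIntegral_eq_of_support_subset ?_
    intro x hx
    refine hs fun h0 => hx ?_
    simp [h0, ENNReal.zero_rpow_of_pos hp0]
  rw [hsupp]
  calc ∫⁻ x in Ω, ‖ψ x‖ₑ ^ p ≤ ∫⁻ x in Ω, 2 ^ (p - 1) * (V⁻¹ * J x + T) := by
        refine setLIntegral_mono ((measurable_const.mul hJm).add measurable_const |>.const_mul _) hpt
    _ = 2 ^ (p - 1) * (V⁻¹ * (∫⁻ x in Ω, J x) + T * volume Ω) := by
        rw [lintegral_const_mul _ (by fun_prop), lintegral_add_left (hJm.const_mul _), lintegral_const_mul _ hJm, setLIntegral_const]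
    _ ≤ 2 ^ (p - 1) * (V⁻¹ * (volume (Metric.ball (0 : E N) (2 * ε)) *
      (ENNReal.ofReal (2 * ε) ^ p * ∫⁻ x, ‖fderiv ℝ ψ x‖ₑ ^ p)) + T * volume Ω) := by
        gcongr
        exact (setLIntegral_le_lintegral _ _).trans hJint
    _ = _ := by
        rw [mul_comm T]
        simp only [mul_assoc]

/-- On the line the Gagliardo–Nirenberg–Sobolev inequality has no exponent in 1 ≤ p < N available;
the fundamental theorem of calculus replaces it. -/
theorem enorm_le_lintegral_fderiv_of_dim_one {ψ : E 1 → ℝ} (hψ : ContDiff ℝ 1 ψ)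
    (hc : HasCompactSupport ψ) (x : E 1) : ‖ψ x‖ₑ ≤ ∫⁻ y, ‖fderiv ℝ ψ y‖ₑ := by
  let e : ℝ ≃ₗᵢ[ℝ] E 1 := (OrthonormalBasis.singleton (Fin 1) ℝ).repr
  have hg : ContDiff ℝ 1 (ψ ∘ e) := hψ.comp e.contDiff
  have hgc : HasCompactSupport (ψ ∘ e) := hc.comp_homeomorph e.toHomeomorph
  have h1 := HasCompactSupport.enorm_le_lintegral_Ici_deriv hg hgc (e.symm x)
  have h2 : ∀ t, ‖deriv (ψ ∘ e) t‖ₑ ≤ ‖fderiv ℝ ψ (e t)‖ₑ := by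
    intro t
    have h3 : HasDerivAt (ψ ∘ e) (fderiv ℝ ψ (e t) (e 1)) t := by
      have h4 : HasDerivAt e (e 1) t := by
        have := e.toContinuousLinearEquiv.toContinuousLinearMap.hasDerivAt (x := t)
        simpa using this
      exact ((hψ.differentiable (by simp)) (e t)).hasFDerivAt.comp_hasDerivAt t h4
    rw [h3.deriv]
    refine (ContinuousLinearMap.le_opENorm _ _).trans ?_
    have h5 : ‖e 1‖ₑ = 1 := by rw [← ofReal_norm, e.norm_map]; simp
    rw [h5, mul_one]
  calc ‖ψ x‖ₑ = ‖(ψ ∘ e) (e.symm x)‖ₑ := by simp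
    _ ≤ ∫⁻ y in Set.Iic (e.symm x), ‖deriv (ψ ∘ e) y‖ₑ := h1
    _ ≤ ∫⁻ y, ‖deriv (ψ ∘ e) y‖ₑ := setLIntegral_le_lintegral _ _
    _ ≤ ∫⁻ y, ‖fderiv ℝ ψ (e y)‖ₑ := lintegral_mono h2
    _ = _ := e.measurePreserving.lintegral_comp
        (f := fun y => ‖fderiv ℝ ψ y‖ₑ) (hψ.continuous_fderiv (by simp)).measurable.enorm

theorem eLpNorm_fderiv_le_of_exponent_le {Ω : Set (E N)} (hΩ : Bornology.IsBounded Ω)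
    {s t : ℝ≥0∞} (hs : s ≠ 0) (hst : s ≤ t) :
    ∃ C : NNReal, ∀ ψ : E N → ℝ, ContDiff ℝ 1 ψ → tsupport ψ ⊆ Ω →
      eLpNorm (fderiv ℝ ψ) s volume ≤ C * eLpNorm (fderiv ℝ ψ) t volume := by
  have hfin : volume Ω ≠ ⊤ := hΩ.measure_lt_top.ne
  have hexp : 0 ≤ 1 / s.toReal - 1 / t.toReal := by
    rcases eq_or_ne t ⊤ with rfl | ht
    · simp
    · rw [sub_nonneg]
      exact one_div_le_one_div_of_le (ENNReal.toReal_pos hs (hst.trans_lt ht.lt_top).ne)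
        (ENNReal.toReal_mono ht hst)
  refine ⟨(volume Ω ^ (1 / s.toReal - 1 / t.toReal)).toNNReal, fun ψ hψ hsupp => ?_⟩
  have h0 : Function.support (fun x => ‖fderiv ℝ ψ x‖) ⊆ Ω := by
    intro x hx
    exact hsupp (support_fderiv_subset ℝ fun h => hx (by simp [h]))
  have hc : Continuous fun x => ‖fderiv ℝ ψ x‖ := (hψ.continuous_fderiv (by simp)).norm
  rw [ENNReal.coe_toNNReal (ENNReal.rpow_ne_top_of_nonneg hexp hfin), ← eLpNorm_norm,
    ← eLpNorm_norm (fderiv ℝ ψ), mul_comm]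
  have h1 := eLpNorm_le_eLpNorm_mul_rpow_measure_univ hst (μ := volume.restrict Ω)
    hc.aestronglyMeasurable
  rw [eLpNorm_restrict_eq_of_support_subset h0, eLpNorm_restrict_eq_of_support_subset h0] at h1
  simpa using h1

/-- The subcritical Sobolev inequality for test functions in a bounded set. -/
theorem exists_sobolev_test (hN : 1 ≤ N) (hp : 1 < p) {Ω : Set (E N)}
    (hΩ : Bornology.IsBounded Ω) {q : ℝ} (hq : 1 ≤ q)
    (hqs : (q : EReal) < criticalExponent N p) :
    ∃ C : NNReal, ∀ ψ : E N → ℝ, ContDiff ℝ 1 ψ → HasCompactSupport ψ → tsupport ψ ⊆ Ω →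
      eLpNorm ψ (ENNReal.ofReal q) volume ≤
        C * eLpNorm (fderiv ℝ ψ) (ENNReal.ofReal p) volume := by
  have hp0 : 0 < p := by linarith
  have hq0 : 0 < q := by linarith
  by_cases hpN : p < N
  · rw [criticalExponent, if_pos hpN, EReal.coe_lt_coe_iff] at hqs
    have hN0 : (0 : ℝ) < N := by exact_mod_cast hN
    refine ⟨_, fun ψ hψ hc hs => eLpNorm_le_eLpNorm_fderiv_of_le volume hψ
      ((subset_tsupport ψ).trans hs) (p := p.toNNReal) (q := q.toNNReal) ?_ ?_ ?_ hΩ⟩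
    · rw [← Real.toNNReal_one]; exact Real.toNNReal_le_toNNReal hp.le
    · rw [finrank_euclideanSpace_fin, ← NNReal.coe_lt_coe, Real.coe_toNNReal _ hp0.le]
      exact_mod_cast hpN
    · rw [finrank_euclideanSpace_fin, NNReal.coe_inv, Real.coe_toNNReal _ hp0.le,
        Real.coe_toNNReal _ hq0.le]
      rw [lt_div_iff₀ (by linarith)] at hqs
      rw [inv_sub_inv hp0.ne' hN0.ne', inv_eq_one_div q, div_le_div_iff₀ (by positivity) hq0]
      linarith
  · push Not at hpN
    rcases hN.eq_or_lt with rfl | hN2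
    · obtain ⟨C₁, hC₁⟩ := eLpNorm_fderiv_le_of_exponent_le (N := 1) hΩ one_ne_zero
        (show (1 : ℝ≥0∞) ≤ ENNReal.ofReal p by simpa using ENNReal.ofReal_le_ofReal hp.le)
      have hfin : volume Ω ≠ ⊤ := hΩ.measure_lt_top.ne
      refine ⟨(volume Ω ^ (1 / q)).toNNReal * C₁, fun ψ hψ hc hs => ?_⟩
      rw [← eLpNorm_restrict_eq_of_support_subset ((subset_tsupport ψ).trans hs)]
      have h1 : eLpNorm ψ (ENNReal.ofReal q) (volume.restrict Ω) ≤
          eLpNorm (fderiv ℝ ψ) 1 volume * volume Ω ^ (1 / q) := by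
        have h2 := eLpNorm_le_of_ae_enorm_bound (f := ψ) (μ := volume.restrict Ω)
          (p := ENNReal.ofReal q) (C := ∫⁻ y, ‖fderiv ℝ ψ y‖ₑ)
          (Eventually.of_forall fun x => enorm_le_lintegral_fderiv_of_dim_one hψ hc x)
        rw [eLpNorm_one_eq_lintegral_enorm]
        simpa [ENNReal.toReal_ofReal hq0.le, mul_comm] using h2
      refine h1.trans ?_
      rw [ENNReal.coe_mul, ENNReal.coe_toNNReal
        (ENNReal.rpow_ne_top_of_nonneg (by positivity) hfin), mul_assoc, mul_comm]
      gcongr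
      exact hC₁ ψ hψ hs
    · have hN2' : (2 : ℝ) ≤ N := by exact_mod_cast hN2
      -- For p ≥ N ≥ 2 the inequality is applied at an exponent s < N with 1/s = 1/N + m. Taking m ≤
      -- 1/q makes the Sobolev conjugate of s at least q, and m ≤ 1 − 1/N makes s ≥ 1. The passage
      -- from s to p is Hölder on the bounded set.
      set m : ℝ := min (1 / q) (1 - 1 / N) with hm
      have hNinv : (1 : ℝ) / N ≤ 1 / 2 := one_div_le_one_div_of_le (by norm_num) hN2'
      have hNpos : (0 : ℝ) < 1 / N := by positivity
      have hm0 : 0 < m := lt_min (by positivity) (by linarith)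
      set s : ℝ := 1 / (1 / N + m) with hs
      have hs0 : 0 < s := by positivity
      have hs1 : 1 ≤ s := by
        rw [hs, le_div_iff₀ (by positivity)]
        linarith [min_le_right (1 / q) (1 - 1 / (N : ℝ))]
      have hsN : s < N := by
        rw [hs, div_lt_iff₀ (by positivity), mul_add, mul_one_div_cancel (by positivity)]
        have : 0 < (N : ℝ) * m := by positivity
        linarith
      obtain ⟨C₁, hC₁⟩ := eLpNorm_fderiv_le_of_exponent_le (N := N) hΩ
        (s := ENNReal.ofReal s) (t := ENNReal.ofReal p) (by simpa using hs0)
        (ENNReal.ofReal_le_ofReal (by linarith))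
      refine ⟨eLpNormLESNormFDerivOfLeConst ℝ (volume : Measure (E N)) Ω s.toNNReal q.toNNReal * C₁,
        fun ψ hψ hc hsupp => ?_⟩
      have h1 := eLpNorm_le_eLpNorm_fderiv_of_le volume hψ
        ((subset_tsupport ψ).trans hsupp) (p := s.toNNReal) (q := q.toNNReal) (by
          rw [← Real.toNNReal_one]; exact Real.toNNReal_le_toNNReal hs1) (by
          rw [finrank_euclideanSpace_fin, ← NNReal.coe_lt_coe, Real.coe_toNNReal _ hs0.le]
          exact_mod_cast hsN) (by
          rw [finrank_euclideanSpace_fin, NNReal.coe_inv, Real.coe_toNNReal _ hs0.le,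
            Real.coe_toNNReal _ hq0.le, hs, one_div, inv_inv, inv_eq_one_div, inv_eq_one_div]
          linarith [min_le_left (1 / q) (1 - 1 / (N : ℝ))]) hΩ
      refine h1.trans ?_
      rw [ENNReal.coe_mul, mul_assoc]
      gcongr
      exact hC₁ ψ hψ hsupp

end Test

/-! ### The Sobolev space -/

section SobolevSpace

variable {N : ℕ} {Ω : Set (E N)} {p : ℝ} [hp : Fact (1 < p)]

/-- Density: a property closed in the product of Lebesgue spaces need only be checked on test
functions. -/
theorem W0_induction {P : Lp ℝ (ENNReal.ofReal p) (volume.restrict Ω) ×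
      Lp (E N) (ENNReal.ofReal p) (volume.restrict Ω) → Prop} (hclosed : IsClosed {w | P w})
    (htest : ∀ w ∈ testPairs Ω p, P w) (u : W0 Ω p) : P u.1 := by
  have h : u.1 ∈ closure (testPairs Ω p : Set (Lp ℝ (ENNReal.ofReal p) (volume.restrict Ω) ×
      Lp (E N) (ENNReal.ofReal p) (volume.restrict Ω))) := u.2
  exact closure_minimal (t := {w | P w}) (fun w hw => htest w hw) hclosed h

instance : CompleteSpace (W0 Ω p) :=
  (Submodule.isClosed_topologicalClosure (testPairs Ω p)).completeSpace_coe

theorem norm_gradient (ψ : E N → ℝ) (x : E N) : ‖gradient ψ x‖ = ‖fderiv ℝ ψ x‖ := by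
  rw [gradient, LinearIsometryEquiv.norm_map]

theorem lintegral_rpow_eq_of_test {F : Type*} [NormedAddCommGroup F]
    (w : Lp F (ENNReal.ofReal p) (volume.restrict Ω)) {g : E N → ℝ}
    (hg : ∀ᵐ x ∂volume.restrict Ω, ‖w x‖ = ‖g x‖) (hs : Function.support g ⊆ Ω) :
    ∫⁻ x, ‖g x‖ₑ ^ p = ENNReal.ofReal (‖w‖ ^ p) := by
  have hp0 : 0 < p := by linarith [hp.out]
  have h1 : ∫⁻ x, ‖g x‖ₑ ^ p = ∫⁻ x in Ω, ‖g x‖ₑ ^ p := by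
    symm
    refine setLIntegral_eq_of_support_subset ?_
    intro x hx
    refine hs fun h0 => hx ?_
    simp [h0, ENNReal.zero_rpow_of_pos hp0]
  have h2 : ∫⁻ x in Ω, ‖g x‖ₑ ^ p = ∫⁻ x in Ω, ‖w x‖ₑ ^ p := by
    refine lintegral_congr_ae ?_
    filter_upwards [hg] with x hx
    rw [← ofReal_norm, ← ofReal_norm, hx]
  have h3 := eLpNorm_eq_lintegral_rpow_enorm_toReal (μ := volume.restrict Ω) (f := w)
    (p := ENNReal.ofReal p) (by simpa using hp0) ENNReal.ofReal_ne_top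
  rw [ENNReal.toReal_ofReal hp0.le] at h3
  rw [h1, h2, ← ENNReal.ofReal_rpow_of_nonneg (norm_nonneg _) hp0.le, Lp.norm_def,
    ENNReal.ofReal_toReal (Lp.eLpNorm_ne_top w), h3, ← ENNReal.rpow_mul,
    one_div_mul_cancel hp0.ne', ENNReal.rpow_one]

/-- The two norms of a test pair as Lebesgue integrals over the whole space. -/
theorem exists_test_of_mem_testPairs
    {w : Lp ℝ (ENNReal.ofReal p) (volume.restrict Ω) ×
      Lp (E N) (ENNReal.ofReal p) (volume.restrict Ω)} (hw : w ∈ testPairs Ω p) :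
    ∃ ψ : E N → ℝ, ContDiff ℝ ∞ ψ ∧ HasCompactSupport ψ ∧ tsupport ψ ⊆ Ω ∧
      w.1 =ᵐ[volume.restrict Ω] ψ ∧ w.2 =ᵐ[volume.restrict Ω] gradient ψ ∧
      ∫⁻ x, ‖ψ x‖ₑ ^ p = ENNReal.ofReal (‖w.1‖ ^ p) ∧
      ∫⁻ x, ‖fderiv ℝ ψ x‖ₑ ^ p = ENNReal.ofReal (‖w.2‖ ^ p) := by
  obtain ⟨ψ, h1, h2, h3, h4, h5⟩ := hw
  refine ⟨ψ, h1, h2, h3, h4, h5, ?_, ?_⟩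
  · refine lintegral_rpow_eq_of_test w.1 ?_ ((subset_tsupport ψ).trans h3)
    filter_upwards [h4] with x hx
    rw [hx]
  · have h6 := lintegral_rpow_eq_of_test w.2 (g := fun x => ‖fderiv ℝ ψ x‖) (by
      filter_upwards [h5] with x hx
      rw [hx, norm_gradient, norm_norm]) (by
      intro x hx
      exact h3 (support_fderiv_subset ℝ fun h => hx (by simp [h])))
    simpa using h6

/-- The Poincaré inequality on the Sobolev space. -/
theorem exists_norm_val_le (hN : 1 ≤ N) (hΩ : Bornology.IsBounded Ω) :
    ∃ C : ℝ, 0 ≤ C ∧ ∀ u : W0 Ω p, ‖u.1.1‖ ≤ C * ‖u.1.2‖ := by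
  have hp0 : 0 < p := by linarith [hp.out]
  obtain ⟨C, hC, h⟩ := exists_poincare hN hp.out.le hΩ
  refine ⟨C, hC, W0_induction (P := fun w => ‖w.1‖ ≤ C * ‖w.2‖)
    (isClosed_le (by fun_prop) (by fun_prop)) fun w hw => ?_⟩
  obtain ⟨ψ, h1, h2, h3, h4, h5, h6, h7⟩ := exists_test_of_mem_testPairs hw
  have h8 := h ψ (h1.of_le (by simp)) ((subset_tsupport ψ).trans h3)
  rw [h6, h7, ENNReal.ofReal_rpow_of_nonneg hC hp0.le, ← ENNReal.ofReal_mul (by positivity),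
    ENNReal.ofReal_le_ofReal_iff (by positivity), ← Real.mul_rpow hC (norm_nonneg _)] at h8
  exact (Real.rpow_le_rpow_iff (norm_nonneg _) (by positivity) hp0).1 h8

theorem exists_norm_le (hN : 1 ≤ N) (hΩ : Bornology.IsBounded Ω) :
    ∃ C : ℝ, 0 < C ∧ ∀ u : W0 Ω p, ‖u‖ ≤ C * ‖u.1.2‖ := by
  obtain ⟨C, hC, h⟩ := exists_norm_val_le (p := p) hN hΩ
  refine ⟨C + 1, by positivity, fun u => ?_⟩
  have h1 : ‖u‖ = max ‖u.1.1‖ ‖u.1.2‖ := rfl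
  rw [h1]
  have := norm_nonneg u.1.2
  exact max_le (by nlinarith [h u]) (by nlinarith)

/-! ### Compactness -/

theorem exists_setIntegral_functional (s : Set (E N)) (hs : MeasurableSet s)
    (hΩ : Bornology.IsBounded Ω) :
    ∃ ℓ : Lp ℝ (ENNReal.ofReal p) (volume.restrict Ω) →L[ℝ] ℝ,
      ∀ f, ℓ f = ∫ x in s, f x ∂volume.restrict Ω := by
  have hfin : volume.restrict Ω s ≠ ⊤ :=
    ((measure_mono (Set.subset_univ s)).trans_lt (by simpa using hΩ.measure_lt_top)).ne
  obtain ⟨q', hqq⟩ : ∃ q' : ℝ, q'.HolderConjugate p :=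
    ⟨_, (Real.HolderConjugate.conjExponent hp.out).symm⟩
  have : Fact (1 < q') := ⟨hqq.lt⟩
  have := hqq.ennrealOfReal
  refine ⟨(ContinuousLinearMap.mul ℝ ℝ).lpPairing (volume.restrict Ω) (ENNReal.ofReal q')
    (ENNReal.ofReal p) (indicatorConstLp _ hs hfin 1), fun f => ?_⟩
  rw [ContinuousLinearMap.lpPairing_eq_integral, ← integral_indicator hs]
  refine integral_congr_ae ?_
  filter_upwards [indicatorConstLp_coeFn (p := ENNReal.ofReal q') (hs := hs) (hμs := hfin)
    (c := (1 : ℝ))] with x hx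
  by_cases hxs : x ∈ s <;> simp [hx, hxs]

/-- A quantitative Rellich theorem. Up to an arbitrarily small multiple of the gradient norm, the
L^p norm is controlled by finitely many bounded functionals, the integrals over the balls of a
finite ε-cover of Ω. -/
theorem exists_average_estimate (hΩ : Bornology.IsBounded Ω) :
    ∃ A : ℝ, 0 ≤ A ∧ ∀ ε : ℝ, 0 < ε →
      ∃ (L : Finset (Lp ℝ (ENNReal.ofReal p) (volume.restrict Ω) →L[ℝ] ℝ)) (B : ℝ), 0 ≤ B ∧
        ∀ u : W0 Ω p, ‖u.1.1‖ ^ p ≤ A * ε ^ p * ‖u.1.2‖ ^ p + B * ∑ ℓ ∈ L, |ℓ u.1.1| ^ p := by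
  classical
  have hp0 : 0 < p := by linarith [hp.out]
  refine ⟨2 ^ (p - 1) * 2 ^ N * 2 ^ p, by positivity, fun ε hε => ?_⟩
  obtain ⟨t, htf, ht⟩ := Metric.totallyBounded_iff.1
    (hΩ.isCompact_closure.totallyBounded.subset subset_closure) ε hε
  set Z := htf.toFinset with hZ
  have hZΩ : Ω ⊆ ⋃ z ∈ Z, Metric.ball z ε := by simpa [hZ] using ht
  choose ℓ hℓ using fun z : E N => exists_setIntegral_functional (p := p) (Ω := Ω)
    (Metric.ball z ε) measurableSet_ball hΩ
  set V : ℝ := (volume (Metric.ball (0 : E N) ε)).toReal with hV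
  have hVne : volume (Metric.ball (0 : E N) ε) ≠ 0 := (Metric.measure_ball_pos volume _ hε).ne'
  have hVt : volume (Metric.ball (0 : E N) ε) ≠ ⊤ := measure_ball_lt_top.ne
  have hVpos : 0 < V := ENNReal.toReal_pos hVne hVt
  have hV' : volume (Metric.ball (0 : E N) ε) = ENNReal.ofReal V := (ENNReal.ofReal_toReal hVt).symm
  have hVol : volume Ω = ENNReal.ofReal (volume Ω).toReal :=
    (ENNReal.ofReal_toReal hΩ.measure_lt_top.ne).symm
  have hratio : (volume (Metric.ball (0 : E N) ε))⁻¹ * volume (Metric.ball (0 : E N) (2 * ε)) =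
      ENNReal.ofReal (2 ^ N) := by
    rw [Measure.addHaar_ball_mul_of_pos _ _ two_pos, finrank_euclideanSpace_fin,
      mul_comm (ENNReal.ofReal _), ← mul_assoc, ENNReal.inv_mul_cancel hVne hVt, one_mul]
  -- the sum over centres, before collecting the functionals into a finite set
  have key : ∀ u : W0 Ω p, ‖u.1.1‖ ^ p ≤ 2 ^ (p - 1) * 2 ^ N * 2 ^ p * ε ^ p * ‖u.1.2‖ ^ p +
      2 ^ (p - 1) * (volume Ω).toReal * (V⁻¹) ^ p * ∑ z ∈ Z, |ℓ z u.1.1| ^ p := by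
    have hrp : Continuous fun x : ℝ => x ^ p := Real.continuous_rpow_const hp0.le
    refine W0_induction (P := fun w => ‖w.1‖ ^ p ≤ 2 ^ (p - 1) * 2 ^ N * 2 ^ p * ε ^ p * ‖w.2‖ ^ p +
      2 ^ (p - 1) * (volume Ω).toReal * (V⁻¹) ^ p * ∑ z ∈ Z, |ℓ z w.1| ^ p)
      (isClosed_le (hrp.comp (by fun_prop)) ?_) fun w hw => ?_
    · refine Continuous.add (continuous_const.mul (hrp.comp (by fun_prop)))
        (continuous_const.mul (continuous_finsetSum _ fun z _ => hrp.comp (by fun_prop)))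
    obtain ⟨ψ, h1, h2, h3, h4, h5, h6, h7⟩ := exists_test_of_mem_testPairs hw
    have hsup := (subset_tsupport ψ).trans h3
    have h8 := lintegral_le_of_averages hp.out.le hε Z hZΩ (h1.of_le (by simp)) hsup h2
    have hint : ∀ z, ∫ x in Metric.ball z ε, ψ x = ℓ z w.1 := by
      intro z
      rw [hℓ, Measure.restrict_restrict measurableSet_ball]
      have e1 : ∫ x in Metric.ball z ε ∩ Ω, w.1 x = ∫ x in Metric.ball z ε ∩ Ω, ψ x := by
        refine integral_congr_ae ?_
        exact ae_restrict_of_ae_restrict_of_subset Set.inter_subset_right h4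
      rw [e1]
      refine setIntegral_eq_of_subset_of_forall_sdiff_eq_zero measurableSet_ball
        Set.inter_subset_left fun x hx => ?_
      by_contra hne
      exact hx.2 ⟨hx.1, hsup hne⟩
    simp only [hint] at h8
    have h9 : ∀ z, ((volume (Metric.ball (0 : E N) ε))⁻¹ * ‖ℓ z w.1‖ₑ) ^ p =
        ENNReal.ofReal ((V⁻¹) ^ p * |ℓ z w.1| ^ p) := by
      intro z
      rw [hV', ← ENNReal.ofReal_inv_of_pos hVpos, ← ofReal_norm, ← ENNReal.ofReal_mul (by positivity),
        ENNReal.ofReal_rpow_of_nonneg (by positivity) hp0.le,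
        Real.mul_rpow (by positivity) (by positivity), Real.norm_eq_abs]
    have h10 : (2 : ℝ≥0∞) ^ (p - 1) = ENNReal.ofReal (2 ^ (p - 1)) := by
      rw [← ENNReal.ofReal_rpow_of_pos two_pos, ENNReal.ofReal_ofNat]
    rw [h6, h7, hratio, hVol, h10, ENNReal.ofReal_rpow_of_nonneg (by positivity) hp0.le] at h8
    simp only [h9] at h8
    rw [← ENNReal.ofReal_sum_of_nonneg (fun z _ => by positivity),
      ← ENNReal.ofReal_mul (by positivity), ← ENNReal.ofReal_mul (by positivity),
      ← ENNReal.ofReal_mul (by positivity), ← ENNReal.ofReal_add (by positivity) (by positivity),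
      ← ENNReal.ofReal_mul (by positivity), ENNReal.ofReal_le_ofReal_iff (by positivity),
      ← Finset.mul_sum, Real.mul_rpow (by norm_num) hε.le] at h8
    refine h8.trans (le_of_eq ?_)
    ring
  -- Different centres may give the same functional; the factor `Z.card` pays for collapsing them
  -- into a set.
  refine ⟨Z.image ℓ, 2 ^ (p - 1) * (volume Ω).toReal * (V⁻¹) ^ p * Z.card, mul_nonneg (by positivity) (Nat.cast_nonneg _),
    fun u => (key u).trans ?_⟩
  rw [mul_assoc _ (Z.card : ℝ)]
  refine add_le_add le_rfl (mul_le_mul_of_nonneg_left ?_ (by positivity))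
  calc ∑ z ∈ Z, |ℓ z u.1.1| ^ p ≤ ∑ z ∈ Z, ∑ ℓ ∈ Z.image ℓ, |ℓ u.1.1| ^ p := by
        refine Finset.sum_le_sum fun z hz => ?_
        exact Finset.single_le_sum (f := fun ℓ : Lp ℝ (ENNReal.ofReal p) (volume.restrict Ω) →L[ℝ] ℝ =>
          |ℓ u.1.1| ^ p) (fun ℓ _ => Real.rpow_nonneg (abs_nonneg _) p) (Finset.mem_image_of_mem ℓ hz)
    _ = _ := by rw [Finset.sum_const, nsmul_eq_mul]

/-- Bounded sequences in the Sobolev space have subsequences that are Cauchy in `L^p`. -/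
theorem exists_subseq_cauchySeq_val (hΩ : Bornology.IsBounded Ω)
    (u : ℕ → W0 Ω p) {M : ℝ} (hM : ∀ n, ‖u n‖ ≤ M) :
    ∃ σ : ℕ → ℕ, StrictMono σ ∧ CauchySeq fun n => (u (σ n)).1.1 := by
  have hp0 : 0 < p := by linarith [hp.out]
  obtain ⟨A, hA, h⟩ := exists_average_estimate (p := p) hΩ
  choose L B hB hest using fun k : ℕ => h (1 / ((k : ℝ) + 1)) (by positivity)
  have hM1 : ∀ n, ‖(u n).1.1‖ ≤ M := fun n => (norm_fst_le (u n).1).trans (hM n)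
  have hM2 : ∀ n, ‖(u n).1.2‖ ≤ M := fun n => (norm_snd_le (u n).1).trans (hM n)
  have hM0 : 0 ≤ M := (norm_nonneg _).trans (hM 0)
  -- The values of all functionals at all scales lie in a compact product of countably many
  -- intervals, so one subsequence makes every one of them converge.
  let F : ℕ → ((Σ k, L k) → ℝ) := fun n i => i.2.1 (u n).1.1
  have hF : ∀ n, F n ∈ Set.pi Set.univ fun i : Σ k, L k => Set.Icc (-(‖i.2.1‖ * M)) (‖i.2.1‖ * M) := by
    intro n i _
    rw [Set.mem_Icc, ← abs_le, ← Real.norm_eq_abs]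
    refine (i.2.1.le_opNorm _).trans ?_
    gcongr
    exact hM1 n
  obtain ⟨x, -, σ, hσ, hlim⟩ := (isCompact_univ_pi fun i : Σ k, L k =>
    (isCompact_Icc : IsCompact (Set.Icc (-(‖i.2.1‖ * M)) (‖i.2.1‖ * M)))).tendsto_subseq hF
  refine ⟨σ, hσ, ?_⟩
  rw [tendsto_pi_nhds] at hlim
  have hpair : ∀ i : Σ k, L k, Tendsto (fun q : ℕ × ℕ =>
      |i.2.1 ((u (σ q.1)).1.1 - (u (σ q.2)).1.1)| ^ p) (atTop ×ˢ atTop) (𝓝 0) := by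
    intro i
    have h1 : Tendsto (fun q : ℕ × ℕ => F (σ q.1) i - F (σ q.2) i) (atTop ×ˢ atTop)
        (𝓝 (x i - x i)) :=
      ((hlim i).comp tendsto_fst).sub ((hlim i).comp tendsto_snd)
    rw [sub_self] at h1
    have h2 := h1.abs
    have h3 := ((Real.continuous_rpow_const hp0.le).tendsto _).comp h2
    simp only [abs_zero, Real.zero_rpow hp0.ne'] at h3
    refine h3.congr fun q => ?_
    simp [F]
  rw [cauchySeq_iff_tendsto_dist_atTop_0, ← prod_atTop_atTop_eq]
  have hpow : Tendsto (fun q : ℕ × ℕ => dist (u (σ q.1)).1.1 (u (σ q.2)).1.1 ^ p)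
      (atTop ×ˢ atTop) (𝓝 0) := by
    rw [Metric.tendsto_nhds]
    intro η hη
    have hk : Tendsto (fun k : ℕ => A * (1 / ((k : ℝ) + 1)) ^ p * (2 * M) ^ p) atTop (𝓝 0) := by
      have h1 := ((Real.continuous_rpow_const hp0.le).tendsto _).comp
        tendsto_one_div_add_atTop_nhds_zero_nat
      simp only [Real.zero_rpow hp0.ne'] at h1
      simpa using (h1.const_mul A).mul_const ((2 * M) ^ p)
    -- The scale is fixed first, using only the common bound on the gradients; the finitely many
    -- functionals at that scale are then small far along the subsequence.
    obtain ⟨k, hk⟩ := (hk.eventually_lt_const (half_pos hη)).exists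
    have hsum : Tendsto (fun q : ℕ × ℕ => B k * ∑ ℓ ∈ L k,
        |ℓ ((u (σ q.1)).1.1 - (u (σ q.2)).1.1)| ^ p) (atTop ×ˢ atTop) (𝓝 0) := by
      have h1 := (tendsto_finsetSum (L k).attach fun ℓ _ => hpair ⟨k, ℓ⟩).const_mul (B k)
      simp only [Finset.sum_const_zero, mul_zero] at h1
      refine h1.congr fun q => ?_
      rw [Finset.sum_attach (L k) fun ℓ => |ℓ ((u (σ q.1)).1.1 - (u (σ q.2)).1.1)| ^ p]
    filter_upwards [hsum.eventually_lt_const (half_pos hη)] with q hq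
    have h1 := hest k (u (σ q.1) - u (σ q.2))
    have h2 : ‖(u (σ q.1) - u (σ q.2)).1.2‖ ≤ 2 * M := by
      refine (norm_sub_le _ _).trans ?_
      linarith [hM2 (σ q.1), hM2 (σ q.2)]
    have h3 : A * (1 / ((k : ℝ) + 1)) ^ p * ‖(u (σ q.1) - u (σ q.2)).1.2‖ ^ p ≤
        A * (1 / ((k : ℝ) + 1)) ^ p * (2 * M) ^ p := by gcongr
    rw [Real.dist_eq, sub_zero, abs_of_nonneg (by positivity), dist_eq_norm]
    have h4 : (u (σ q.1) - u (σ q.2)).1.1 = (u (σ q.1)).1.1 - (u (σ q.2)).1.1 := rfl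
    rw [h4] at h1
    linarith
  have h1 := ((Real.continuous_rpow_const (q := 1 / p) (by positivity)).tendsto _).comp hpow
  rw [Real.zero_rpow (by positivity)] at h1
  refine h1.congr fun q => ?_
  rw [Function.comp_apply, ← Real.rpow_mul dist_nonneg, mul_one_div_cancel hp0.ne', Real.rpow_one]

end SobolevSpace

/-! ### Sobolev embeddings -/

theorem lintegral_enorm_rpow_Lp {α F : Type*} [MeasurableSpace α] {μ : Measure α}
    [NormedAddCommGroup F] {q : ℝ} [hq' : Fact (1 < q)] (w : Lp F (ENNReal.ofReal q) μ) :
    ∫⁻ x, ‖w x‖ₑ ^ q ∂μ = ENNReal.ofReal (‖w‖ ^ q) := by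
  have hq : 0 < q := by linarith [hq'.out]
  have h3 := eLpNorm_eq_lintegral_rpow_enorm_toReal (μ := μ) (f := w)
    (p := ENNReal.ofReal q) (by simpa using hq) ENNReal.ofReal_ne_top
  rw [ENNReal.toReal_ofReal hq.le] at h3
  rw [← ENNReal.ofReal_rpow_of_nonneg (norm_nonneg _) hq.le, Lp.norm_def,
    ENNReal.ofReal_toReal (Lp.eLpNorm_ne_top w), h3, ← ENNReal.rpow_mul,
    one_div_mul_cancel hq.ne', ENNReal.rpow_one]

/-- Hölder's inequality with b written as the convex combination of a and c having weights (c −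
b)/(c − a) and (b − a)/(c − a). -/
theorem lintegral_rpow_interpolation {α : Type*} [MeasurableSpace α] {μ : Measure α}
    {g : α → ℝ≥0∞} (hg : AEMeasurable g μ) {a b c : ℝ} (ha : 0 < a) (hab : a ≤ b) (hbc : b ≤ c)
    (hac : a < c) :
    ∫⁻ x, g x ^ b ∂μ ≤
      (∫⁻ x, g x ^ a ∂μ) ^ ((c - b) / (c - a)) * (∫⁻ x, g x ^ c ∂μ) ^ ((b - a) / (c - a)) := by
  have hca : 0 < c - a := by linarith
  have h1 : 0 ≤ (c - b) / (c - a) := div_nonneg (by linarith) hca.le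
  have h2 : 0 ≤ (b - a) / (c - a) := div_nonneg (by linarith) hca.le
  refine le_trans (le_of_eq ?_) (ENNReal.lintegral_mul_norm_pow_le (hg.pow_const a)
    (hg.pow_const c) h1 h2 (by field_simp; ring))
  refine lintegral_congr fun x => ?_
  rw [← ENNReal.rpow_mul, ← ENNReal.rpow_mul, ← ENNReal.rpow_add_of_nonneg _ _ (by positivity)
    (mul_nonneg (by linarith) h2)]
  congr 1
  field_simp
  ring

section Embedding

variable {N : ℕ} {Ω : Set (E N)} {p : ℝ} [hp : Fact (1 < p)]

theorem exists_eLpNorm_val_le (hN : 1 ≤ N) (hΩ : Bornology.IsBounded Ω) {q : ℝ} (hq : 1 ≤ q)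
    (hqs : (q : EReal) < criticalExponent N p) :
    ∃ C : NNReal, ∀ u : W0 Ω p,
      eLpNorm (valOf u) (ENNReal.ofReal q) (volume.restrict Ω) ≤ C * ENNReal.ofReal ‖u.1.2‖ := by
  have hp0 : 0 < p := by linarith [hp.out]
  obtain ⟨C, hC⟩ := exists_sobolev_test hN hp.out hΩ hq hqs
  refine ⟨C, W0_induction (P := fun w => eLpNorm w.1 (ENNReal.ofReal q) (volume.restrict Ω) ≤
    C * ENNReal.ofReal ‖w.2‖) ?_ fun w hw => ?_⟩
  -- The L^q norm need not be continuous for the L^p topology, but it is lower semicontinuous along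
  -- an a.e. convergent subsequence by Fatou, which is enough for closedness.
  · refine IsSeqClosed.isClosed fun w v hw hv => ?_
    have h1 : Tendsto (fun n => (w n).1) atTop (𝓝 v.1) := (continuous_fst.tendsto v).comp hv
    have h2 : Tendsto (fun n => C * ENNReal.ofReal ‖(w n).2‖) atTop
        (𝓝 (C * ENNReal.ofReal ‖v.2‖)) := by
      refine ENNReal.Tendsto.const_mul ?_ (Or.inr ENNReal.coe_ne_top)
      exact ENNReal.tendsto_ofReal ((continuous_snd.tendsto v).comp hv).norm
    obtain ⟨σ, hσ, hae⟩ := (tendstoInMeasure_of_tendsto_Lp h1).exists_seq_tendsto_ae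
    have h3 := Lp.eLpNorm_lim_le_liminf_eLpNorm (p := ENNReal.ofReal q)
      (fun n => Lp.aestronglyMeasurable ((w (σ n)).1)) v.1 hae
    refine h3.trans ?_
    have h4 := (h2.comp hσ.tendsto_atTop).liminf_eq
    rw [← h4]
    exact liminf_le_liminf (Eventually.of_forall fun n => hw (σ n))
  · obtain ⟨ψ, h1, h2, h3, h4, h5, h6, h7⟩ := exists_test_of_mem_testPairs hw
    have h8 := hC ψ (h1.of_le (by simp)) h2 h3
    rw [eLpNorm_congr_ae h4]
    refine (eLpNorm_mono_measure _ Measure.restrict_le_self).trans (h8.trans (le_of_eq ?_))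
    rw [eLpNorm_eq_lintegral_rpow_enorm_toReal (by simpa using hp0) ENNReal.ofReal_ne_top,
      ENNReal.toReal_ofReal hp0.le, h7, ENNReal.ofReal_rpow_of_nonneg (by positivity) (by positivity),
      ← Real.rpow_mul (norm_nonneg _), mul_one_div_cancel hp0.ne', Real.rpow_one]

theorem valOf_add (u v : W0 Ω p) : valOf (u + v) =ᵐ[volume.restrict Ω] valOf u + valOf v :=
  Lp.coeFn_add u.1.1 v.1.1

theorem valOf_smul (c : ℝ) (u : W0 Ω p) : valOf (c • u) =ᵐ[volume.restrict Ω] c • valOf u :=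
  Lp.coeFn_smul c u.1.1

theorem memLp_val (hN : 1 ≤ N) (hΩ : Bornology.IsBounded Ω) {q : ℝ} (hq : 1 ≤ q)
    (hqs : (q : EReal) < criticalExponent N p) (u : W0 Ω p) :
    MemLp (valOf u) (ENNReal.ofReal q) (volume.restrict Ω) := by
  obtain ⟨C, hC⟩ := exists_eLpNorm_val_le hN hΩ hq hqs
  exact ⟨Lp.aestronglyMeasurable u.1.1,
    (hC u).trans_lt (ENNReal.mul_lt_top ENNReal.coe_lt_top ENNReal.ofReal_lt_top)⟩

/-- The embedding of the Sobolev space into a subcritical Lebesgue space. -/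
theorem exists_embedding (hN : 1 ≤ N) (hΩ : Bornology.IsBounded Ω) {q : ℝ} [hq : Fact (1 < q)]
    (hqs : (q : EReal) < criticalExponent N p) :
    ∃ ι : W0 Ω p →L[ℝ] Lp ℝ (ENNReal.ofReal q) (volume.restrict Ω),
      ∀ u, ι u =ᵐ[volume.restrict Ω] valOf u := by
  have hmem := memLp_val (p := p) hN hΩ hq.out.le hqs
  obtain ⟨C, hC⟩ := exists_eLpNorm_val_le (p := p) hN hΩ hq.out.le hqs
  let ι : W0 Ω p →ₗ[ℝ] Lp ℝ (ENNReal.ofReal q) (volume.restrict Ω) :=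
    { toFun := fun u => (hmem u).toLp
      map_add' := fun u v => by
        refine Lp.ext ?_
        filter_upwards [(hmem (u + v)).coeFn_toLp, (hmem u).coeFn_toLp, (hmem v).coeFn_toLp,
          Lp.coeFn_add (hmem u).toLp (hmem v).toLp, valOf_add u v] with x h1 h2 h3 h4 h5
        rw [h1, h4, h5, Pi.add_apply, Pi.add_apply, h2, h3]
      map_smul' := fun c u => by
        refine Lp.ext ?_
        filter_upwards [(hmem (c • u)).coeFn_toLp, (hmem u).coeFn_toLp,
          Lp.coeFn_smul c (hmem u).toLp, valOf_smul c u] with x h1 h2 h4 h5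
        rw [h1, RingHom.id_apply, h4, h5, Pi.smul_apply, Pi.smul_apply, h2] }
  refine ⟨ι.mkContinuous C fun u => ?_, fun u => MemLp.coeFn_toLp (hmem u)⟩
  change ‖(hmem u).toLp‖ ≤ _
  rw [Lp.norm_toLp]
  refine ENNReal.toReal_le_of_le_ofReal (by positivity) ((hC u).trans ?_)
  rw [ENNReal.ofReal_mul (by positivity), ENNReal.ofReal_coe_nnreal]
  gcongr
  exact norm_snd_le u.1

theorem norm_embedding_rpow_le {r q : ℝ} [hr : Fact (1 < r)] [hq : Fact (1 < q)] (hpr : p ≤ r)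
    (hrq : r ≤ q) (hpq : p < q) (ι : W0 Ω p →L[ℝ] Lp ℝ (ENNReal.ofReal r) (volume.restrict Ω))
    (hι : ∀ u, ι u =ᵐ[volume.restrict Ω] valOf u)
    (j : W0 Ω p →L[ℝ] Lp ℝ (ENNReal.ofReal q) (volume.restrict Ω))
    (hj : ∀ u, j u =ᵐ[volume.restrict Ω] valOf u) (v : W0 Ω p) :
    ‖ι v‖ ^ r ≤ (‖v.1.1‖ ^ p) ^ ((q - r) / (q - p)) * (‖j v‖ ^ q) ^ ((r - p) / (q - p)) := by
  have hp0 : 0 < p := by linarith [hp.out]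
  have hθ0 : 0 ≤ (q - r) / (q - p) := div_nonneg (by linarith) (by linarith)
  have hκ0 : 0 ≤ (r - p) / (q - p) := div_nonneg (by linarith) (by linarith)
  have h1 := lintegral_rpow_interpolation (μ := volume.restrict Ω) (g := fun x => ‖valOf v x‖ₑ)
    (Lp.aestronglyMeasurable v.1.1).enorm hp0 hpr hrq hpq
  have h2 : ∫⁻ x in Ω, ‖valOf v x‖ₑ ^ r = ENNReal.ofReal (‖ι v‖ ^ r) := by
    rw [← lintegral_enorm_rpow_Lp]
    refine lintegral_congr_ae ?_
    filter_upwards [hι v] with x hx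
    rw [hx]
  have h3 : ∫⁻ x in Ω, ‖valOf v x‖ₑ ^ q = ENNReal.ofReal (‖j v‖ ^ q) := by
    rw [← lintegral_enorm_rpow_Lp]
    refine lintegral_congr_ae ?_
    filter_upwards [hj v] with x hx
    rw [hx]
  have h4 : ∫⁻ x in Ω, ‖valOf v x‖ₑ ^ p = ENNReal.ofReal (‖v.1.1‖ ^ p) :=
    lintegral_enorm_rpow_Lp v.1.1
  have e1 : 0 ≤ ‖v.1.1‖ ^ p := Real.rpow_nonneg (norm_nonneg _) _
  have e2 : 0 ≤ ‖j v‖ ^ q := Real.rpow_nonneg (norm_nonneg _) _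
  have e3 := Real.rpow_nonneg e1 ((q - r) / (q - p))
  have e4 := Real.rpow_nonneg e2 ((r - p) / (q - p))
  rw [h2, h3, h4, ENNReal.ofReal_rpow_of_nonneg e1 hθ0, ENNReal.ofReal_rpow_of_nonneg e2 hκ0,
    ← ENNReal.ofReal_mul e3, ENNReal.ofReal_le_ofReal_iff (mul_nonneg e3 e4)] at h1
  exact h1

set_option maxHeartbeats 1000000 in
/-- Bounded sequences of the Sobolev space are relatively compact in subcritical Lebesgue
spaces. -/
theorem exists_subseq_cauchySeq_embedding (hN : 1 ≤ N) (hΩ : Bornology.IsBounded Ω) {r : ℝ}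
    [hr : Fact (1 < r)] (hpr : p < r) (hrs : (r : EReal) < criticalExponent N p)
    (ι : W0 Ω p →L[ℝ] Lp ℝ (ENNReal.ofReal r) (volume.restrict Ω))
    (hι : ∀ u, ι u =ᵐ[volume.restrict Ω] valOf u) (u : ℕ → W0 Ω p) {M : ℝ}
    (hM : ∀ n, ‖u n‖ ≤ M) :
    ∃ σ : ℕ → ℕ, StrictMono σ ∧ CauchySeq fun n => ι (u (σ n)) := by
  have hp0 : 0 < p := by linarith [hp.out]
  -- Room is left between r and the critical exponent: the L^r norm is interpolated between L^p,
  -- where the sequence is Cauchy, and L^q, where it is bounded.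
  obtain ⟨q, hrq, hqs⟩ := EReal.lt_iff_exists_real_btwn.1 hrs
  rw [EReal.coe_lt_coe_iff] at hrq
  have hq1 : Fact (1 < q) := ⟨by linarith [hr.out]⟩
  have hr0 : 0 < r := by linarith
  have hq0 : 0 < q := by linarith
  obtain ⟨j, hj⟩ := exists_embedding (p := p) hN hΩ hqs
  obtain ⟨σ, hσ, hc⟩ := exists_subseq_cauchySeq_val hΩ u hM
  refine ⟨σ, hσ, ?_⟩
  have hθ0 : 0 < (q - r) / (q - p) := div_pos (by linarith) (by linarith)
  have hκ0 : 0 < (r - p) / (q - p) := div_pos (by linarith) (by linarith)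
  have hest := norm_embedding_rpow_le hpr.le hrq.le (hpr.trans hrq) ι hι j hj
  generalize (q - r) / (q - p) = θ at hθ0 hest
  generalize (r - p) / (q - p) = κ at hκ0 hest
  have hjM : ∀ n m, ‖j (u n - u m)‖ ≤ ‖j‖ * (2 * M) := by
    intro n m
    refine (j.le_opNorm _).trans (mul_le_mul_of_nonneg_left ?_ (norm_nonneg j))
    refine (norm_sub_le _ _).trans ?_
    linarith [hM n, hM m]
  generalize ‖j‖ * (2 * M) = J at hjM
  have hJ0 : 0 ≤ J := (norm_nonneg _).trans (hjM 0 0)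
  rw [cauchySeq_iff_tendsto_dist_atTop_0] at hc ⊢
  have h1 : Tendsto (fun n : ℕ × ℕ => ((dist (u (σ n.1)).1.1 (u (σ n.2)).1.1 ^ p) ^ θ *
      (J ^ q) ^ κ) ^ (1 / r)) atTop (𝓝 0) := by
    have hcont : Continuous fun x : ℝ => ((x ^ p) ^ θ * (J ^ q) ^ κ) ^ (1 / r) :=
      (Real.continuous_rpow_const (by positivity)).comp
        (((Real.continuous_rpow_const hθ0.le).comp (Real.continuous_rpow_const hp0.le)).mul
          continuous_const)
    have h4 := (hcont.tendsto 0).comp hc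
    rw [Real.zero_rpow hp0.ne', Real.zero_rpow hθ0.ne', zero_mul,
      Real.zero_rpow (by positivity)] at h4
    exact h4
  refine squeeze_zero (fun _ => dist_nonneg) (fun n => ?_) h1
  have h5 := hest (u (σ n.1) - u (σ n.2))
  have h7 : ‖(u (σ n.1) - u (σ n.2)).1.1‖ = dist (u (σ n.1)).1.1 (u (σ n.2)).1.1 :=
    (dist_eq_norm _ _).symm
  rw [h7] at h5
  have h6 : dist (ι (u (σ n.1))) (ι (u (σ n.2))) =
      (‖ι (u (σ n.1) - u (σ n.2))‖ ^ r) ^ (1 / r) := by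
    rw [← Real.rpow_mul (norm_nonneg _), mul_one_div_cancel hr0.ne', Real.rpow_one, map_sub,
      dist_eq_norm]
  rw [h6]
  have e2 := Real.rpow_nonneg (norm_nonneg (j (u (σ n.1) - u (σ n.2)))) q
  refine Real.rpow_le_rpow (Real.rpow_nonneg (norm_nonneg _) _) (h5.trans ?_) (by positivity)
  refine mul_le_mul_of_nonneg_left ?_ (Real.rpow_nonneg (Real.rpow_nonneg dist_nonneg _) _)
  refine Real.rpow_le_rpow e2 ?_ hκ0.le
  exact Real.rpow_le_rpow (norm_nonneg _) (hjM _ _) hq0.le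

end Embedding

/-! ### Test functions and multiplication operators -/

section TestElements

variable {N : ℕ} {Ω : Set (E N)} {p : ℝ} [hp : Fact (1 < p)]

theorem continuous_gradient {ψ : E N → ℝ} (h : ContDiff ℝ 1 ψ) : Continuous (gradient ψ) :=
  (InnerProductSpace.toDual ℝ (E N)).symm.continuous.comp (h.continuous_fderiv (by simp))

theorem HasCompactSupport.gradient {ψ : E N → ℝ} (h : HasCompactSupport ψ) :
    HasCompactSupport (gradient ψ) :=
  (h.fderiv (𝕜 := ℝ)).comp_left (g := (InnerProductSpace.toDual ℝ (E N)).symm) (map_zero _)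

theorem exists_test_element {ψ : E N → ℝ} (h1 : ContDiff ℝ ∞ ψ) (h2 : HasCompactSupport ψ)
    (h3 : tsupport ψ ⊆ Ω) : ∃ e : W0 Ω p, valOf e =ᵐ[volume.restrict Ω] ψ := by
  have m1 : MemLp ψ (ENNReal.ofReal p) (volume.restrict Ω) :=
    (h1.continuous.memLp_of_hasCompactSupport h2).restrict Ω
  have m2 : MemLp (gradient ψ) (ENNReal.ofReal p) (volume.restrict Ω) :=
    ((continuous_gradient (h1.of_le (by simp))).memLp_of_hasCompactSupport
      (HasCompactSupport.gradient h2)).restrict Ω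
  exact ⟨⟨(m1.toLp, m2.toLp), Submodule.le_topologicalClosure _
    ⟨ψ, h1, h2, h3, m1.coeFn_toLp, m2.coeFn_toLp⟩⟩, m1.coeFn_toLp⟩

theorem memLp_top_of_continuous {G : Type*} [NormedAddCommGroup G] (hΩ : Bornology.IsBounded Ω)
    (hΩm : MeasurableSet Ω) {m : E N → G} (hm : Continuous m) :
    MemLp m ⊤ (volume.restrict Ω) := by
  obtain ⟨C, hC⟩ := hΩ.isCompact_closure.exists_bound_of_continuousOn hm.continuousOn
  refine memLp_top_of_bound hm.aestronglyMeasurable C ?_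
  filter_upwards [ae_restrict_mem hΩm] with x hx using hC x (subset_closure hx)

/-- Multiplication by a smooth function on the Sobolev space. -/
theorem exists_mul_operator (hΩ : Bornology.IsBounded Ω) (hΩm : MeasurableSet Ω) {m : E N → ℝ}
    (hm : ContDiff ℝ ∞ m) :
    ∃ S : W0 Ω p →L[ℝ] W0 Ω p, ∀ u, valOf (S u) =ᵐ[volume.restrict Ω] m * valOf u := by
  have k1 := memLp_top_of_continuous hΩ hΩm hm.continuous
  have k2 := memLp_top_of_continuous hΩ hΩm (continuous_gradient (hm.of_le (by simp)))
  let A₁ : Lp ℝ (ENNReal.ofReal p) (volume.restrict Ω) →L[ℝ]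
      Lp ℝ (ENNReal.ofReal p) (volume.restrict Ω) :=
    (ContinuousLinearMap.mul ℝ ℝ).holderL (volume.restrict Ω) ⊤ (ENNReal.ofReal p)
      (ENNReal.ofReal p) k1.toLp
  let A₂ : Lp (E N) (ENNReal.ofReal p) (volume.restrict Ω) →L[ℝ]
      Lp (E N) (ENNReal.ofReal p) (volume.restrict Ω) :=
    (ContinuousLinearMap.lsmul ℝ ℝ).holderL (volume.restrict Ω) ⊤ (ENNReal.ofReal p)
      (ENNReal.ofReal p) k1.toLp
  let A₃ : Lp ℝ (ENNReal.ofReal p) (volume.restrict Ω) →L[ℝ]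
      Lp (E N) (ENNReal.ofReal p) (volume.restrict Ω) :=
    (ContinuousLinearMap.lsmul ℝ ℝ).flip.holderL (volume.restrict Ω) ⊤ (ENNReal.ofReal p)
      (ENNReal.ofReal p) k2.toLp
  have h₁ : ∀ f, A₁ f =ᵐ[volume.restrict Ω] fun x => m x * f x := by
    intro f
    filter_upwards [(ContinuousLinearMap.mul ℝ ℝ).coeFn_holder (r := ENNReal.ofReal p) k1.toLp f,
      k1.coeFn_toLp] with x h h'
    refine h.trans ?_
    rw [h', ContinuousLinearMap.mul_apply']
  have h₂ : ∀ f, A₂ f =ᵐ[volume.restrict Ω] fun x => m x • f x := by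
    intro f
    filter_upwards [(ContinuousLinearMap.lsmul ℝ ℝ).coeFn_holder (r := ENNReal.ofReal p) k1.toLp f,
      k1.coeFn_toLp] with x h h'
    refine h.trans ?_
    rw [h', ContinuousLinearMap.lsmul_apply]
  have h₃ : ∀ f, A₃ f =ᵐ[volume.restrict Ω] fun x => f x • gradient m x := by
    intro f
    filter_upwards [(ContinuousLinearMap.lsmul ℝ ℝ).flip.coeFn_holder (r := ENNReal.ofReal p)
      k2.toLp f, k2.coeFn_toLp] with x h h'
    refine h.trans ?_
    rw [h', ContinuousLinearMap.flip_apply, ContinuousLinearMap.lsmul_apply]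
  -- The second component follows the product rule ∇(mu) = m∇u + u∇m, so test pairs are mapped to
  -- test pairs, and closedness extends this to the whole space.
  let T := (A₁.comp (ContinuousLinearMap.fst ℝ _ (Lp (E N) (ENNReal.ofReal p)
    (volume.restrict Ω)))).prod (A₂.comp (ContinuousLinearMap.snd ℝ _ _) +
      A₃.comp (ContinuousLinearMap.fst ℝ _ _))
  have hT : ∀ u : W0 Ω p, T u.1 ∈ W0 Ω p := by
    refine W0_induction (P := fun w => T w ∈ W0 Ω p)
      ((Submodule.isClosed_topologicalClosure (testPairs Ω p)).preimage T.continuous)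
      fun w hw => Submodule.le_topologicalClosure _ ?_
    obtain ⟨ψ, g1, g2, g3, g4, g5⟩ := hw
    refine ⟨fun x => m x * ψ x, hm.mul g1, g2.mul_left, ?_, ?_, ?_⟩
    · exact (closure_mono (Function.support_mul_subset_right m ψ)).trans g3
    · refine (h₁ w.1).trans ?_
      filter_upwards [g4] with x hx
      rw [hx]
    · refine (Lp.coeFn_add (A₂ w.2) (A₃ w.1)).trans ?_
      filter_upwards [h₂ w.2, h₃ w.1, g4, g5] with x h2 h3 h4 h5
      rw [Pi.add_apply, h2, h3, h4, h5, gradient, gradient, gradient, fderiv_fun_mul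
        (hm.differentiable (by simp) x) (g1.differentiable (by simp) x), map_add]
      simp
  refine ⟨(T.comp (W0 Ω p).subtypeL).codRestrict (W0 Ω p) hT, fun u => ?_⟩
  exact h₁ u.1.1

end TestElements

/-! ### Contractibility of the sets of active functions -/

/-- The identity is joined to S and S to a constant by straight segments. The detour through S
serves sets where the direct segment from u to e may leave D. -/
theorem contractible_of_segments {X : Type} [NormedAddCommGroup X] [NormedSpace ℝ X] {D : Set X}
    {S : X → X} (hS : Continuous S) {e : X} (he : e ∈ D)
    (h₁ : ∀ u ∈ D, ∀ t ∈ Set.Icc (0 : ℝ) 1, (1 - t) • u + t • S u ∈ D)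
    (h₂ : ∀ u ∈ D, ∀ t ∈ Set.Icc (0 : ℝ) 1, (1 - t) • S u + t • e ∈ D) : ContractibleSpace D := by
  have hSD : ∀ u ∈ D, S u ∈ D := fun u hu => by simpa using h₁ u hu 1 (by simp)
  let R : C(D, D) := ⟨fun u => ⟨S u.1, hSD u.1 u.2⟩, by fun_prop⟩
  rw [contractible_iff_id_nullhomotopic]
  refine ⟨⟨e, he⟩, ContinuousMap.Homotopic.trans (g := R) ⟨⟨⟨fun q =>
    ⟨(1 - (q.1 : ℝ)) • q.2.1 + (q.1 : ℝ) • S q.2.1, h₁ _ q.2.2 _ q.1.2⟩,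
      Continuous.subtype_mk (by fun_prop) _⟩, ?_, ?_⟩⟩ ⟨⟨⟨fun q =>
    ⟨(1 - (q.1 : ℝ)) • S q.2.1 + (q.1 : ℝ) • e, h₂ _ q.2.2 _ q.1.2⟩,
      Continuous.subtype_mk (by fun_prop) _⟩, ?_, ?_⟩⟩⟩
  · intro u; simp
  · intro u; simp [R]
  · intro u; simp [R]
  · intro u; simp

theorem contractible_of_star {X : Type} [NormedAddCommGroup X] [NormedSpace ℝ X] {D : Set X}
    {e : X} (he : e ∈ D) (h : ∀ u ∈ D, ∀ t : ℝ, 0 ≤ t → t < 1 → (1 - t) • u + t • e ∈ D) :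
    ContractibleSpace D := by
  refine contractible_of_segments (S := id) continuous_id he ?_ ?_
  · intro u hu t _
    rwa [id, ← add_smul, sub_add_cancel, one_smul]
  · intro u hu t ht
    rcases ht.2.eq_or_lt with rfl | h0
    · simpa using he
    · exact h u hu t ht.1 h0

section Contractible

variable {N : ℕ} {Ω : Set (E N)} {p : ℝ} [hp : Fact (1 < p)]

/-- A function of class `L^p` does not blow up like `‖x - x₀‖ ^ (-2N)`. -/
theorem not_singular (hN : 1 ≤ N) (w : Lp ℝ (ENNReal.ofReal p) (volume.restrict Ω)) {x₀ : E N}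
    {ρ : ℝ} (hρ : 0 < ρ) (hball : Metric.ball x₀ ρ ⊆ Ω) {t : ℝ} (ht : 0 < t) :
    ¬ ∀ᵐ x ∂volume.restrict Ω, x ∈ Metric.ball x₀ ρ → t ≤ ‖x - x₀‖ ^ (2 * N) * |w x| := by
  intro h
  have hp0 : 0 < p := by linarith [hp.out]
  set V := (volume (Metric.ball (0 : E N) 1)).toReal with hV
  have hVt : volume (Metric.ball (0 : E N) 1) ≠ ⊤ := measure_ball_lt_top.ne
  have hVpos : 0 < V := ENNReal.toReal_pos (Metric.measure_ball_pos volume _ one_pos).ne' hVt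
  -- Integrating |w|^p over the ball of radius δ gives t^p δ^(−2Np) V δ^N ≤ ‖w‖^p. As δ < 1 and p >
  -- 1, this implies the stated bound, whose right side tends to 0 with δ.
  have key : ∀ δ : ℝ, 0 < δ → δ < min ρ 1 → t ^ p * V ≤ ‖w‖ ^ p * δ ^ N := by
    intro δ hδ hδ'
    have hδρ := hδ'.trans_le (min_le_left _ _)
    have hδ1 := hδ'.trans_le (min_le_right _ _)
    have hsub : Metric.ball x₀ δ ⊆ Ω := (Metric.ball_subset_ball hδρ.le).trans hball
    have h1 : ENNReal.ofReal ((t / δ ^ (2 * N)) ^ p) * volume (Metric.ball x₀ δ) ≤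
        ENNReal.ofReal (‖w‖ ^ p) := by
      rw [← lintegral_enorm_rpow_Lp w, ← setLIntegral_const]
      refine le_trans ?_ (lintegral_mono_set hsub)
      refine lintegral_mono_ae ?_
      filter_upwards [ae_restrict_of_ae_restrict_of_subset hsub h,
        ae_restrict_mem measurableSet_ball] with x hx hxb
      have h2 := hx (Metric.ball_subset_ball hδρ.le hxb)
      have h3 : ‖x - x₀‖ ^ (2 * N) ≤ δ ^ (2 * N) := by
        have : ‖x - x₀‖ ≤ δ := by
          rw [← dist_eq_norm]
          exact (Metric.mem_ball.1 hxb).le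
        gcongr
      rw [← ofReal_norm, ENNReal.ofReal_rpow_of_nonneg (norm_nonneg _) hp0.le]
      refine ENNReal.ofReal_le_ofReal (Real.rpow_le_rpow (by positivity) ?_ hp0.le)
      rw [div_le_iff₀ (by positivity), Real.norm_eq_abs, mul_comm]
      exact h2.trans (by gcongr)
    rw [Measure.addHaar_ball_of_pos _ _ hδ, finrank_euclideanSpace_fin,
      ← ENNReal.ofReal_toReal hVt, ← hV, ← ENNReal.ofReal_mul (by positivity),
      ← ENNReal.ofReal_mul (by positivity), ENNReal.ofReal_le_ofReal_iff (by positivity),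
      Real.div_rpow ht.le (by positivity)] at h1
    have h4 : (δ ^ (2 * N)) ^ p ≤ δ ^ (2 * N) := by
      refine (Real.rpow_le_rpow_of_exponent_ge (by positivity) (pow_le_one₀ hδ.le hδ1.le)
        hp.out.le).trans (by simp)
    have h5 : 0 < (δ ^ (2 * N)) ^ p := by positivity
    rw [div_mul_eq_mul_div, div_le_iff₀ h5] at h1
    have h6 : t ^ p * (δ ^ N * V) ≤ ‖w‖ ^ p * δ ^ (2 * N) :=
      h1.trans (mul_le_mul_of_nonneg_left h4 (Real.rpow_nonneg (norm_nonneg _) _))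
    have h7 : 0 < δ ^ N := by positivity
    rw [two_mul, pow_add] at h6
    refine le_of_mul_le_mul_left ?_ h7
    calc δ ^ N * (t ^ p * V) = t ^ p * (δ ^ N * V) := by ring
      _ ≤ _ := h6
      _ = _ := by ring
  have hlim : Tendsto (fun δ : ℝ => ‖w‖ ^ p * δ ^ N) (𝓝[>] 0) (𝓝 (‖w‖ ^ p * 0 ^ N)) :=
    ((by fun_prop : Continuous fun δ : ℝ => ‖w‖ ^ p * δ ^ N).tendsto 0).mono_left nhdsWithin_le_nhds
  rw [zero_pow (by lia), mul_zero] at hlim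
  have h8 : t ^ p * V ≤ 0 := by
    refine ge_of_tendsto hlim ?_
    filter_upwards [Ioo_mem_nhdsGT (lt_min hρ one_pos)] with δ hδ using key δ hδ.1 hδ.2
  have : 0 < t ^ p * V := by positivity
  linarith

theorem exists_bump (hΩo : IsOpen Ω) {x₀ : E N} (hx₀ : x₀ ∈ Ω) :
    ∃ (e : W0 Ω p) (ψ : E N → ℝ) (ρ : ℝ), valOf e =ᵐ[volume.restrict Ω] ψ ∧ (∀ x, 0 ≤ ψ x) ∧
      0 < ρ ∧ Metric.ball x₀ ρ ⊆ Ω ∧ ∀ x ∈ Metric.ball x₀ ρ, ψ x = 1 := by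
  obtain ⟨R, hR, hRΩ⟩ := Metric.nhds_basis_closedBall.mem_iff.1 (hΩo.mem_nhds hx₀)
  let b : ContDiffBump x₀ := ⟨R / 2, R, by positivity, by linarith⟩
  obtain ⟨e, he⟩ := exists_test_element (p := p) (Ω := Ω) (ψ := b) b.contDiff b.hasCompactSupport
    (b.tsupport_eq.subset.trans hRΩ)
  refine ⟨e, b, R / 2, he, fun x => b.nonneg, by positivity,
    (Metric.ball_subset_closedBall.trans (Metric.closedBall_subset_closedBall (by linarith))).trans
      hRΩ, fun x hx => b.one_of_mem_closedBall (Metric.ball_subset_closedBall hx)⟩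

theorem frequently_ball {x₀ : E N} {ρ : ℝ} (hρ : 0 < ρ) (hball : Metric.ball x₀ ρ ⊆ Ω) :
    ∃ᵐ x ∂volume.restrict Ω, x ∈ Metric.ball x₀ ρ := by
  intro h
  have h1 : volume.restrict Ω (Metric.ball x₀ ρ) = 0 :=
    measure_eq_zero_iff_ae_notMem.2 h
  rw [Measure.restrict_apply measurableSet_ball, Set.inter_eq_left.2 hball] at h1
  exact (Metric.measure_ball_pos volume x₀ hρ).ne' h1

theorem valOf_segment (s t : ℝ) (u v : W0 Ω p) : ∀ᵐ x ∂volume.restrict Ω,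
    valOf (s • u + t • v) x = s * valOf u x + t * valOf v x := by
  filter_upwards [valOf_add (s • u) (t • v), valOf_smul s u, valOf_smul t v] with x h1 h2 h3
  rw [h1, Pi.add_apply, h2, h3, Pi.smul_apply, Pi.smul_apply, smul_eq_mul, smul_eq_mul]

/-- The set of functions which are active for the activity function `act`. -/
def activeSet (Ω : Set (E N)) (p : ℝ) [Fact (1 < p)] (act : ℝ → ℝ) : Set (W0 Ω p) :=
  {u | ¬ ∀ᵐ x ∂volume.restrict Ω, act (valOf u x) = 0}

/-- The active set is the complement of the origin, so the two segments must avoid 0. From u to mu,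
with m = |x − x₀|^{2N}, the multiplier (1 − t) + tm is positive almost everywhere. From mu to the
bump, vanishing at some t > 0 would force |x − x₀|^{2N}|u| ≥ t near x₀, which no L^p function
satisfies. -/
theorem contractible_activeSet_abs (hN : 1 ≤ N) (hΩo : IsOpen Ω) (hΩ : Bornology.IsBounded Ω)
    (hne : Ω.Nonempty) : ContractibleSpace (activeSet Ω p fun s => |s|) := by
  obtain ⟨x₀, hx₀⟩ := hne
  obtain ⟨e, ψ, ρ, he, hψ0, hρ, hball, hψ1⟩ := exists_bump (p := p) hΩo hx₀
  obtain ⟨S, hS⟩ := exists_mul_operator (p := p) hΩ hΩo.measurableSet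
    (m := fun x => (‖x - x₀‖ ^ 2) ^ N) ((contDiff_norm_sq ℝ).comp (contDiff_id.sub contDiff_const) |>.pow N)
  have hne0 : ∀ᵐ x ∂volume.restrict Ω, x ≠ x₀ := by
    have : Nonempty (Fin N) := ⟨⟨0, by lia⟩⟩
    exact ae_restrict_of_ae (Measure.ae_ne volume x₀)
  refine contractible_of_segments S.continuous (e := e) ?_ ?_ ?_
  · intro h
    refine frequently_ball hρ hball ?_
    filter_upwards [h, he] with x h1 h2 h3
    rw [h2, hψ1 x h3] at h1
    simp at h1
  · intro u hu t ht h
    refine hu ?_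
    filter_upwards [h, valOf_segment (1 - t) t u (S u), hS u, hne0] with x h1 h2 h5 h6
    rw [h2, h5, abs_eq_zero, Pi.mul_apply] at h1
    have h7 : 0 < (‖x - x₀‖ ^ 2) ^ N := by
      have := norm_pos_iff.2 (sub_ne_zero.2 h6)
      positivity
    have h8 : 0 < (1 - t) + t * (‖x - x₀‖ ^ 2) ^ N := by
      rcases ht.1.eq_or_lt with h | h
      · simp [← h]
      · have := mul_pos h h7
        linarith [ht.2]
    have h9 : ((1 - t) + t * (‖x - x₀‖ ^ 2) ^ N) * valOf u x = 0 := by linarith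
    simpa using (mul_eq_zero.1 h9).resolve_left h8.ne'
  · intro u hu t ht h
    have hae : ∀ᵐ x ∂volume.restrict Ω,
        (1 - t) * ((‖x - x₀‖ ^ 2) ^ N * valOf u x) + t * ψ x = 0 := by
      filter_upwards [h, valOf_segment (1 - t) t (S u) e, hS u, he] with x h1 h2 h5 h6
      rw [h2, h5, h6, abs_eq_zero, Pi.mul_apply] at h1
      exact h1
    rcases ht.1.eq_or_lt with h0 | h0
    · refine hu ?_
      filter_upwards [hae, hne0] with x h1 h6
      have h7 : 0 < (‖x - x₀‖ ^ 2) ^ N := by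
        have := norm_pos_iff.2 (sub_ne_zero.2 h6)
        positivity
      rw [← h0] at h1
      simp only [sub_zero, one_mul, zero_mul, add_zero] at h1
      simpa using (mul_eq_zero.1 h1).resolve_left h7.ne'
    · refine not_singular hN u.1.1 hρ hball h0 ?_
      filter_upwards [hae] with x h1 h2
      change t ≤ ‖x - x₀‖ ^ (2 * N) * |valOf u x|
      rw [hψ1 x h2, mul_one, ← pow_mul] at h1
      have h3 : t = (1 - t) * (‖x - x₀‖ ^ (2 * N) * -valOf u x) := by linarith
      have h4 : 0 ≤ ‖x - x₀‖ ^ (2 * N) := by positivity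
      have h5 : ‖x - x₀‖ ^ (2 * N) * -valOf u x ≤ ‖x - x₀‖ ^ (2 * N) * |valOf u x| :=
        mul_le_mul_of_nonneg_left (neg_le_abs _) h4
      have h6 : 0 ≤ ‖x - x₀‖ ^ (2 * N) * |valOf u x| := by positivity
      calc t = (1 - t) * (‖x - x₀‖ ^ (2 * N) * -valOf u x) := h3
        _ ≤ (1 - t) * (‖x - x₀‖ ^ (2 * N) * |valOf u x|) :=
          mul_le_mul_of_nonneg_left h5 (by linarith [ht.2])
        _ ≤ 1 * (‖x - x₀‖ ^ (2 * N) * |valOf u x|) :=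
          mul_le_mul_of_nonneg_right (by linarith) h6
        _ = _ := one_mul _

/-- The set is star-shaped about ε times a nonnegative bump: if the ε-part of (1 − t)u + tεψ
vanishes with t < 1, then εu ≤ 0 already. The condition ε² = 1 means ε = ±1 and covers both signs.
-/
theorem contractible_activeSet_signed (hΩo : IsOpen Ω) (hne : Ω.Nonempty) {ε : ℝ} (hε : ε * ε = 1) :
    ContractibleSpace (activeSet Ω p fun s => max (ε * s) 0) := by
  obtain ⟨x₀, hx₀⟩ := hne
  obtain ⟨e, ψ, ρ, he, hψ0, hρ, hball, hψ1⟩ := exists_bump (p := p) hΩo hx₀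
  have heD : ε • e ∈ activeSet Ω p fun s => max (ε * s) 0 := by
    intro h
    refine frequently_ball hρ hball ?_
    filter_upwards [h, he, valOf_smul ε e] with x h1 h2 h4 h3
    rw [h4, Pi.smul_apply, h2, hψ1 x h3, smul_eq_mul, ← mul_assoc, hε] at h1
    simp at h1
  have hev : ∀ᵐ x ∂volume.restrict Ω, valOf (ε • e) x = ε * ψ x := by
    filter_upwards [he, valOf_smul ε e] with x h1 h2
    rw [h2, Pi.smul_apply, h1, smul_eq_mul]
  generalize ε • e = e' at heD hev
  refine contractible_of_star heD fun u hu t ht0 h0 h => hu ?_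
  filter_upwards [h, valOf_segment (1 - t) t u e', hev] with x h1 h2 h5
  have h3 : max (ε * valOf ((1 - t) • u + t • e') x) 0 = 0 := h1
  rw [h2, h5, max_eq_right_iff] at h3
  refine max_eq_right ?_
  have h7 : (1 - t) * (ε * valOf u x) + ε * ε * (t * ψ x) ≤ 0 := by linarith [h3]
  rw [hε, one_mul] at h7
  have h8 := mul_nonneg ht0 (hψ0 x)
  by_contra h9
  have := mul_pos (sub_pos.2 h0) (not_le.1 h9)
  linarith

end Contractible

/-! ### The variational argument in a Banach space -/

section Variational

variable {X Y : Type} [NormedAddCommGroup X] [NormedSpace ℝ X] [CompleteSpace X]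
  [NormedAddCommGroup Y] [NormedSpace ℝ Y] [CompleteSpace Y]

/-- A functional whose derivative is a compact perturbation of a uniformly monotone operator
satisfies the Cerami condition as soon as its Cerami sequences are bounded. -/
theorem ceramiCondition_of_monotone {φ : X → ℝ} {Ψ : Y → ℝ} (hΨ : ContDiff ℝ 1 Ψ) (ι : X →L[ℝ] Y)
    {p : ℝ} (hp : 0 < p)
    (hbdd : ∀ u : ℕ → X, (∃ M : ℝ, ∀ n, |φ (u n)| ≤ M) →
      Tendsto (fun n => (1 + ‖u n‖) • fderiv ℝ φ (u n)) atTop (𝓝 0) → ∃ M : ℝ, ∀ n, ‖u n‖ ≤ M)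
    (hcomp : ∀ (u : ℕ → X) (M : ℝ), (∀ n, ‖u n‖ ≤ M) →
      ∃ σ : ℕ → ℕ, StrictMono σ ∧ CauchySeq fun n => ι (u (σ n)))
    (hmono : ∀ M ε : ℝ, 0 < ε → ∃ C : ℝ, 0 ≤ C ∧ ∀ u v : X, ‖u‖ ≤ M → ‖v‖ ≤ M →
      ‖u - v‖ ^ p ≤ ε + C * ((fderiv ℝ φ u (u - v) + fderiv ℝ Ψ (ι u) (ι (u - v))) -
        (fderiv ℝ φ v (u - v) + fderiv ℝ Ψ (ι v) (ι (u - v))))) :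
    CeramiCondition φ := by
  intro u hφ hd
  obtain ⟨M, hM⟩ := hbdd u hφ hd
  obtain ⟨σ, hσ, hc⟩ := hcomp u M hM
  obtain ⟨w, hw⟩ := cauchySeq_tendsto_of_complete hc
  have hd' : Tendsto (fun n => ‖fderiv ℝ φ (u n)‖) atTop (𝓝 0) := by
    refine squeeze_zero (fun _ => norm_nonneg _) (fun n => ?_) (tendsto_zero_iff_norm_tendsto_zero.1 hd)
    rw [norm_smul, Real.norm_of_nonneg (by positivity)]
    nlinarith [norm_nonneg (u n), norm_nonneg (fderiv ℝ φ (u n))]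
  have hdσ := hd'.comp hσ.tendsto_atTop
  have hΨw : Tendsto (fun n => ‖fderiv ℝ Ψ (ι (u (σ n)))‖) atTop (𝓝 ‖fderiv ℝ Ψ w‖) :=
    (((hΨ.continuous_fderiv (by simp)).tendsto w).comp hw).norm
  set K := ‖fderiv ℝ Ψ w‖ + 1 with hK
  have hK' : ∀ᶠ n in atTop, ‖fderiv ℝ Ψ (ι (u (σ n)))‖ ≤ K :=
    hΨw.eventually_le_const (by linarith)
  have hcauchy : CauchySeq fun n => u (σ n) := by
    rw [cauchySeq_iff_tendsto_dist_atTop_0, ← prod_atTop_atTop_eq]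
    rw [cauchySeq_iff_tendsto_dist_atTop_0, ← prod_atTop_atTop_eq] at hc
    have hpow : Tendsto (fun q : ℕ × ℕ => dist (u (σ q.1)) (u (σ q.2)) ^ p)
        (atTop ×ˢ atTop) (𝓝 0) := by
      rw [Metric.tendsto_nhds]
      intro ε hε
      obtain ⟨C, hC, hest⟩ := hmono M (ε / 2) (half_pos hε)
      -- Once ε fixes C, the remaining error tends to zero: φ' tends to zero against bounded
      -- differences, and Ψ' stays bounded against differences that are Cauchy in Y.
      have hlim : Tendsto (fun q : ℕ × ℕ => C *
          ((‖fderiv ℝ φ (u (σ q.1))‖ + ‖fderiv ℝ φ (u (σ q.2))‖) * (2 * M) +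
            2 * K * dist (ι (u (σ q.1))) (ι (u (σ q.2))))) (atTop ×ˢ atTop) (𝓝 0) := by
        have h1 := (((hdσ.comp tendsto_fst).add (hdσ.comp tendsto_snd)).mul_const (2 * M)).add
          (hc.const_mul (2 * K)) |>.const_mul C
        simpa using h1
      filter_upwards [hlim.eventually_lt_const (half_pos hε), tendsto_fst.eventually hK',
        tendsto_snd.eventually hK'] with q hq h1 h2
      have h3 := hest (u (σ q.1)) (u (σ q.2)) (hM _) (hM _)
      rw [Real.dist_eq, sub_zero, abs_of_nonneg (Real.rpow_nonneg dist_nonneg _), dist_eq_norm]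
      have hMd : ‖u (σ q.1) - u (σ q.2)‖ ≤ 2 * M := by
        refine (norm_sub_le _ _).trans ?_
        linarith [hM (σ q.1), hM (σ q.2)]
      rw [dist_eq_norm, ← map_sub] at hq
      generalize u (σ q.1) - u (σ q.2) = d at *
      have a1 : fderiv ℝ φ (u (σ q.1)) d ≤ ‖fderiv ℝ φ (u (σ q.1))‖ * (2 * M) :=
        (le_abs_self _).trans ((fderiv ℝ φ (u (σ q.1))).le_of_opNorm_le_of_le le_rfl hMd)
      have a2 : -fderiv ℝ φ (u (σ q.2)) d ≤ ‖fderiv ℝ φ (u (σ q.2))‖ * (2 * M) :=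
        (neg_le_abs _).trans ((fderiv ℝ φ (u (σ q.2))).le_of_opNorm_le_of_le le_rfl hMd)
      have a3 : fderiv ℝ Ψ (ι (u (σ q.1))) (ι d) ≤ K * ‖ι d‖ :=
        (le_abs_self _).trans ((fderiv ℝ Ψ (ι (u (σ q.1)))).le_of_opNorm_le_of_le h1 le_rfl)
      have a4 : -fderiv ℝ Ψ (ι (u (σ q.2))) (ι d) ≤ K * ‖ι d‖ :=
        (neg_le_abs _).trans ((fderiv ℝ Ψ (ι (u (σ q.2)))).le_of_opNorm_le_of_le h2 le_rfl)
      have a5 := mul_le_mul_of_nonneg_left (a := C)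
        (show (fderiv ℝ φ (u (σ q.1)) d + fderiv ℝ Ψ (ι (u (σ q.1))) (ι d)) -
          (fderiv ℝ φ (u (σ q.2)) d + fderiv ℝ Ψ (ι (u (σ q.2))) (ι d)) ≤
          (‖fderiv ℝ φ (u (σ q.1))‖ + ‖fderiv ℝ φ (u (σ q.2))‖) * (2 * M) + 2 * K * ‖ι d‖ by
          linarith) hC
      linarith
    have h1 := ((Real.continuous_rpow_const (q := 1 / p) (by positivity)).tendsto _).comp hpow
    rw [Real.zero_rpow (by positivity)] at h1
    refine h1.congr fun q => ?_
    rw [Function.comp_apply, ← Real.rpow_mul dist_nonneg, mul_one_div_cancel hp.ne', Real.rpow_one]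
  obtain ⟨x, hx⟩ := cauchySeq_tendsto_of_complete hcauchy
  exact ⟨x, σ, hσ, hx⟩

/-- The critical groups at infinity vanish for functionals that are unbounded below along the
rays of a contractible set, bounded below off that set, and have negative radial derivative at low
levels. -/
theorem criticalGroupsAtInfinityVanish_of_radial {φ : X → ℝ} (hφ : ContDiff ℝ 1 φ)
    (hC : CeramiCondition φ) {D : Set X} (hD : ContractibleSpace D) {p C L : ℝ} (hp : 0 < p)
    (hrad : ∀ u, fderiv ℝ φ u u ≤ p * φ u + C) (hlow : ∀ u, u ∉ D → L ≤ φ u)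
    (hneg : ∀ u ∈ D, ∀ b : ℝ, ∃ t : ℝ, 1 ≤ t ∧ φ (t • u) < b) :
    CriticalGroupsAtInfinityVanish φ := by
  refine ⟨⟨hφ, hC, ?_⟩, fun c hc k => ?_⟩
  · refine (EReal.bot_lt_coe (-C / p)).trans_le (le_iInf₂ fun u hu => ?_)
    rw [EReal.coe_le_coe_iff, div_le_iff₀ hp]
    have h := hrad u
    have hu' : fderiv ℝ φ u = 0 := hu
    rw [hu', zero_apply] at h
    linarith
  -- The level b is at most c, is below the lower bound of φ off D, and satisfies pb + C ≤ −1, which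
  -- makes the radial derivative negative on the sublevel.
  · set b := min c (min (L - 1) ((-C - 1) / p)) with hb
    have hbc : b ≤ c := min_le_left _ _
    have hbL : b < L := ((min_le_right _ _).trans (min_le_left _ _)).trans_lt (by linarith)
    have hbC : b ≤ (-C - 1) / p := (min_le_right _ _).trans (min_le_right _ _)
    rw [le_div_iff₀ hp] at hbC
    have h1 : ContractibleSpace (sublevel φ b) := by
      refine contractible_sublevel_of_rays hφ.continuous hD (fun u hu => ?_)
        (fun u hu => hneg u hu b)
        (sublevel_ray_of_radial_deriv_neg (hφ.differentiable (by simp)) fun u hu => ?_)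
      · by_contra h
        have := hlow u h
        have hu' : φ u ≤ b := hu
        linarith
      · have := hrad u
        nlinarith
    have h2 : ContractibleSpace (sublevel φ c) :=
      contractible_sublevel_of_cerami hφ hC hbc hc h1
    exact isZero_relativeHomology_of_contractible X (sublevel φ c) k

end Variational

/-! ### Exponents -/

theorem exists_bound_of_rpow_le {p s : ℝ} (hs0 : 0 ≤ s) (hs : s < p) (K₁ K₂ : ℝ) :
    ∃ Y : ℝ, ∀ y : ℝ, 0 ≤ y → y ^ p ≤ K₁ + K₂ * y ^ s → y ≤ Y := by
  have h1 : Tendsto (fun y : ℝ => y ^ (p - s)) atTop atTop := tendsto_rpow_atTop (by linarith)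
  obtain ⟨Y, hY⟩ := (h1.eventually_gt_atTop (|K₁| + K₂)).exists_forall_of_atTop
  refine ⟨max Y 1, fun y hy h => ?_⟩
  by_contra hlt
  rw [not_le, max_lt_iff] at hlt
  have h2 := hY y hlt.1.le
  have h3 : 1 ≤ y ^ s := Real.one_le_rpow hlt.2.le hs0
  have h4 : y ^ p = y ^ (p - s) * y ^ s := by
    rw [← Real.rpow_add (by linarith)]; congr 1; ring
  have h5 : K₁ ≤ |K₁| * y ^ s := (le_abs_self _).trans (le_mul_of_one_le_right (abs_nonneg _) h3)
  nlinarith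

/-- The last inequality says q(r − τ)/(q − τ) < p, the exponent condition met when L^r is
interpolated between L^τ and L^q. At q = p* < ∞ it reads (r − p)N/p < τ, and as q → ∞ it becomes r −
p < τ. The hypothesis on τ gives both, so q close to p*, or large, works. -/
theorem exists_interpolation_exponent {N : ℕ} {p r τ : ℝ} (hp : 1 < p) (hpr : p < r)
    (hr : (r : EReal) < criticalExponent N p) (hτ : (r - p) * max (N / p) 1 < τ)
    (hτs : (τ : EReal) < criticalExponent N p) :
    ∃ q : ℝ, r < q ∧ τ < q ∧ (q : EReal) < criticalExponent N p ∧ (r - p) * q < τ * (q - p) := by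
  have hrp : 0 < r - p := by linarith
  have h1 : (r - p) * (N / p) < τ := (mul_le_mul_of_nonneg_left (le_max_left _ _) hrp.le).trans_lt hτ
  have h2 : r - p < τ := by
    have := (mul_le_mul_of_nonneg_left (le_max_right (N / p) 1) hrp.le).trans_lt hτ
    linarith
  by_cases hpN : p < N
  · rw [criticalExponent, if_pos hpN] at hr hτs ⊢
    simp only [EReal.coe_lt_coe_iff] at hr hτs ⊢
    set P := N * p / (N - p) with hP
    have hNp : 0 < (N : ℝ) - p := by linarith
    have h3 : (r - p) * P < τ * (P - p) := by
      have e1 : P - p = p / (N - p) * p := by rw [hP]; field_simp; ring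
      have e2 : P = p / (N - p) * N := by rw [hP]; ring
      rw [e1, e2]
      have : (r - p) * N < τ * p := by
        rw [mul_div_assoc', div_lt_iff₀ (by linarith)] at h1
        exact h1
      have h5 : 0 < p / (N - p) := by positivity
      nlinarith
    have hc : ∀ᶠ q in 𝓝[<] P, (r - p) * q < τ * (q - p) := by
      refine nhdsWithin_le_nhds ?_
      exact ContinuousAt.eventually_lt (by fun_prop) (by fun_prop) h3
    obtain ⟨q, h5, h6⟩ := (hc.and (Ioo_mem_nhdsLT (max_lt hr hτs))).exists
    exact ⟨q, (le_max_left _ _).trans_lt h6.1, (le_max_right _ _).trans_lt h6.1, h6.2, h5⟩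
  · rw [criticalExponent, if_neg hpN]
    have h3 : Tendsto (fun q : ℝ => (τ - (r - p)) * q) atTop atTop :=
      tendsto_id.const_mul_atTop (by linarith)
    obtain ⟨q, ⟨h4, h5⟩, h6⟩ := ((h3.eventually_gt_atTop (τ * p)).and
      (eventually_gt_atTop r) |>.and (eventually_gt_atTop τ)).exists
    exact ⟨q, h5, h6, EReal.coe_lt_top q, by linarith⟩

/-! ### The reaction term -/

section ReactionTerm

variable {N : ℕ} {Ω : Set (E N)} {p r τ : ℝ} {act : ℝ → ℝ} {f : E N → ℝ → ℝ}

/-- A Carathéodory function agrees, off a null set, with one that is measurable in the first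
variable and continuous in the second without exception. -/
theorem Caratheodory.exists_regular (hf : Caratheodory Ω f) : ∃ g : E N → ℝ → ℝ,
    (∀ s, Measurable fun x => g x s) ∧ (∀ x, Continuous (g x)) ∧
      ∀ᵐ x ∂volume.restrict Ω, g x = f x := by
  classical
  -- Countably many null sets are discarded, one for each rational argument; continuity in s then
  -- recovers measurability at every real argument by limits.
  have h1 : ∀ᵐ x ∂volume.restrict Ω, Continuous (f x) ∧
      ∀ q : ℚ, f x q = (hf.measurable q).mk _ x :=
    hf.continuous.and (ae_all_iff.2 fun q : ℚ => (hf.measurable q).ae_eq_mk)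
  obtain ⟨G, hG, hGm, hGp⟩ := h1.exists_measurable_mem
  have hcont : ∀ x, Continuous fun s => if x ∈ G then f x s else 0 := by
    intro x
    by_cases hx : x ∈ G
    · simpa [hx] using (hGp x hx).1
    · simpa [hx] using continuous_const
  refine ⟨fun x s => if x ∈ G then f x s else 0, fun s => ?_, hcont, ?_⟩
  · obtain ⟨y, hy, hlim⟩ := mem_closure_iff_seq_limit.1 (Rat.denseRange_cast (𝕜 := ℝ) s)
    choose q hq using hy
    have hmeas : ∀ n, Measurable fun x => if x ∈ G then f x (y n) else 0 := by
      intro n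
      have : (fun x => if x ∈ G then f x (y n) else 0) =
          G.indicator ((hf.measurable (q n)).mk _) := by
        ext x
        by_cases hx : x ∈ G
        · simp only [hx, if_true, Set.indicator_of_mem, ← hq n]
          exact (hGp x hx).2 (q n)
        · simp [hx]
      rw [this]
      exact (hf.measurable (q n)).measurable_mk.indicator hGm
    refine measurable_of_tendsto_metrizable hmeas (tendsto_pi_nhds.2 fun x => ?_)
    exact ((hcont x).tendsto s).comp hlim
  · filter_upwards [hG] with x hx
    simp [hx]

/-- The properties of the reaction used in the variational argument; `act` measures the part of the
argument to which the reaction responds. -/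
structure Reaction (Ω : Set (E N)) (p r τ : ℝ) (act : ℝ → ℝ) (f : E N → ℝ → ℝ) : Prop where
  measurable : ∀ s, Measurable fun x => f x s
  continuous : ∀ x, Continuous (f x)
  growth : ∃ A : ℝ, 0 ≤ A ∧ ∀ᵐ x ∂volume.restrict Ω, ∀ s, |f x s| ≤ A * (1 + |s| ^ (r - 1))
  mul_le : ∃ A : ℝ, 0 ≤ A ∧ ∀ᵐ x ∂volume.restrict Ω, ∀ s, f x s * s ≤ A * (1 + act s ^ r)
  superquadratic : ∃ β C : ℝ, 0 < β ∧ ∀ᵐ x ∂volume.restrict Ω, ∀ s,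
    β * act s ^ τ - C ≤ f x s * s - p * primitive f x s
  superlinear : ∀ M : ℝ, ∃ C : ℝ, ∀ᵐ x ∂volume.restrict Ω, ∀ s,
    M * act s ^ p - C ≤ primitive f x s

theorem Reaction.isSmoothIntegrand (R : Reaction Ω p r τ act f) :
    IsSmoothIntegrand (volume.restrict Ω) r (primitive f)
      (fun x s => f x s • (1 : ℝ →L[ℝ] ℝ)) := by
  have hF : ∀ x s, HasDerivAt (primitive f x) (f x s) s := fun x s =>
    intervalIntegral.integral_hasDerivAt_right ((R.continuous x).intervalIntegrable _ _)
      ((R.continuous x).stronglyMeasurableAtFilter _ _) (R.continuous x).continuousAt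
  have hsf : StronglyMeasurable (Function.uncurry fun s x => f x s) :=
    stronglyMeasurable_uncurry_of_continuous_of_stronglyMeasurable R.continuous
      fun s => (R.measurable s).stronglyMeasurable
  have hsf' : StronglyMeasurable (Function.uncurry f) := hsf.comp_measurable measurable_swap
  have hFs : ∀ s, StronglyMeasurable fun x => primitive f x s := by
    intro s
    have h : ∀ a b : ℝ, StronglyMeasurable fun x => ∫ t in Set.Ioc a b, f x t :=
      fun a b => hsf'.integral_prod_right' (ν := volume.restrict (Set.Ioc a b))
    -- The oriented integral is the difference of two integrals over intervals, one of which is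
    -- empty according to the sign of s.
    exact (h 0 s).sub (h s 0)
  have hsF : StronglyMeasurable (Function.uncurry fun s x => primitive f x s) :=
    stronglyMeasurable_uncurry_of_continuous_of_stronglyMeasurable
      (fun x => continuous_iff_continuousAt.2 fun s => (hF x s).continuousAt) hFs
  have hcomp : ∀ {k : ℝ → E N → ℝ}, StronglyMeasurable (Function.uncurry k) →
      ∀ h : E N → ℝ, AEStronglyMeasurable h (volume.restrict Ω) →
        AEStronglyMeasurable (fun x => k (h x) x) (volume.restrict Ω) := by
    intro k hk h hh
    exact (hk.measurable.comp_aemeasurable (hh.aemeasurable.prodMk aemeasurable_id)).aestronglyMeasurable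
  obtain ⟨A, hA, hgr⟩ := R.growth
  exact
    { hasFDerivAt := fun x s => (hF x s).hasFDerivAt.congr_fderiv (by ext; simp)
      continuous := fun x => (R.continuous x).smul continuous_const
      zero := fun x => by simp [primitive]
      aesm := hcomp hsF
      aesm_deriv := fun h hh => (hcomp hsf h hh).smul_const _
      growth := ⟨A, hA, by
        filter_upwards [hgr] with x hx s
        rw [norm_smul, norm_one, mul_one]
        exact hx s⟩ }

/-- Truncations of the argument of a reaction. -/
structure IsTruncation (π : ℝ → ℝ) : Prop where
  continuous : Continuous π
  abs_le : ∀ s, |π s| ≤ |s|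
  comp_mul : ∀ (h : ℝ → ℝ), h 0 = 0 → ∀ s, h (π s) * s = h (π s) * π s
  integral_comp : ∀ h : ℝ → ℝ, Continuous h → h 0 = 0 → ∀ s,
    ∫ t in (0 : ℝ)..s, h (π t) = ∫ t in (0 : ℝ)..π s, h t

theorem isTruncation_id : IsTruncation fun s => s :=
  ⟨continuous_id, fun _ => le_rfl, fun _ _ _ => rfl, fun _ _ _ _ => rfl⟩

theorem isTruncation_pos : IsTruncation fun s => max s 0 := by
  refine ⟨by fun_prop, fun s => ?_, fun h h0 s => ?_, fun h hc h0 s => ?_⟩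
  · rcases le_total s 0 with hs | hs
    · simp [max_eq_right hs]
    · simp [max_eq_left hs]
  · rcases le_total s 0 with hs | hs
    · simp [max_eq_right hs, h0]
    · simp [max_eq_left hs]
  · rcases le_total s 0 with hs | hs
    · rw [max_eq_right hs, intervalIntegral.integral_same]
      refine (intervalIntegral.integral_congr (g := fun _ => 0) fun t ht => ?_).trans
        intervalIntegral.integral_zero
      rw [Set.uIcc_of_ge hs] at ht
      simp only [max_eq_right ht.2, h0]
    · rw [max_eq_left hs]
      refine intervalIntegral.integral_congr fun t ht => ?_
      rw [Set.uIcc_of_le hs] at ht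
      simp only [max_eq_left ht.1]

theorem isTruncation_neg : IsTruncation fun s => -max (-s) 0 := by
  refine ⟨by fun_prop, fun s => ?_, fun h h0 s => ?_, fun h hc h0 s => ?_⟩
  · rcases le_total s 0 with hs | hs
    · simp [max_eq_left (neg_nonneg.2 hs)]
    · simp [max_eq_right (neg_nonpos.2 hs)]
  · rcases le_total s 0 with hs | hs
    · simp [max_eq_left (neg_nonneg.2 hs)]
    · simp [max_eq_right (neg_nonpos.2 hs), h0]
  · rcases le_total s 0 with hs | hs
    · rw [max_eq_left (neg_nonneg.2 hs), neg_neg]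
      refine intervalIntegral.integral_congr fun t ht => ?_
      rw [Set.uIcc_of_ge hs] at ht
      simp only [max_eq_left (neg_nonneg.2 ht.2), neg_neg]
    · rw [max_eq_right (neg_nonpos.2 hs), neg_zero, intervalIntegral.integral_same]
      refine (intervalIntegral.integral_congr (g := fun _ => 0) fun t ht => ?_).trans
        intervalIntegral.integral_zero
      rw [Set.uIcc_of_le hs] at ht
      simp only [max_eq_right (neg_nonpos.2 ht.1), neg_zero, h0]

theorem abs_integral_le_of_growth {h : ℝ → ℝ} {A : ℝ} (hA : 0 ≤ A) (hr : 1 < r)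
    (hgr : ∀ s, |h s| ≤ A * (1 + |s| ^ (r - 1))) (s : ℝ) :
    |∫ t in (0 : ℝ)..s, h t| ≤ A * (1 + |s| ^ (r - 1)) * |s| := by
  have h1 := intervalIntegral.norm_integral_le_of_norm_le_const (a := 0) (b := s) (f := h)
    (C := A * (1 + |s| ^ (r - 1))) fun t ht => by
      refine (hgr t).trans ?_
      have : |t| ≤ |s| := by
        have := Set.abs_sub_left_of_mem_uIcc (Set.uIoc_subset_uIcc ht)
        simpa using this
      have hr' : 0 ≤ r - 1 := by linarith
      gcongr
  simpa using h1

variable [hp : Fact (1 < p)] {c₁ : ℝ}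

/-- The reaction term and its truncations, after modification on a null set. -/
theorem HypF.exists_reaction (hf : HypF Ω p c₁ r f) :
    ∃ (τ : ℝ) (g : E N → ℝ → ℝ), (r - p) * max (N / p) 1 < τ ∧
      (τ : EReal) < criticalExponent N p ∧ (∀ᵐ x ∂volume.restrict Ω, g x = f x) ∧
      ∀ π : ℝ → ℝ, IsTruncation π →
        Reaction Ω p r τ (fun s => |π s|) (fun x s => g x (π s)) := by
  have hp1 := hp.out
  have hr1 : 1 < r := hp1.trans hf.p_lt_r
  have hr0 : 0 ≤ r - 1 := by linarith
  obtain ⟨g, hgm, hgc, hgf⟩ := hf.caratheodory.exists_regular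
  obtain ⟨τ, β₀, hτ, hτs, hβ, hlim⟩ := hf.liminf_infinity
  have hτ0 : 0 < τ := by
    refine lt_of_le_of_lt (mul_nonneg (by linarith [hf.p_lt_r]) ?_) hτ
    exact zero_le_one.trans (le_max_right _ _)
  obtain ⟨α, ⟨hα, hα0⟩, hgrow⟩ := hf.growth
  obtain ⟨A, hA, hgr⟩ : ∃ A : ℝ, 0 ≤ A ∧ ∀ᵐ x ∂volume.restrict Ω, ∀ s,
      |g x s| ≤ A * (1 + |s| ^ (r - 1)) := by
    refine ⟨(eLpNormEssSup α (volume.restrict Ω)).toReal, ENNReal.toReal_nonneg, ?_⟩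
    have hfin : eLpNormEssSup α (volume.restrict Ω) ≠ ⊤ := by
      have := hα.eLpNorm_ne_top
      rwa [eLpNorm_exponent_top] at this
    filter_upwards [hgf, hgrow, ae_le_eLpNormEssSup (f := α) (μ := volume.restrict Ω)]
      with x h1 h2 h3 s
    rw [h1]
    refine (h2 s).trans ?_
    have h4 : α x ≤ (eLpNormEssSup α (volume.restrict Ω)).toReal := by
      refine (le_abs_self _).trans ?_
      rw [← Real.norm_eq_abs, ← toReal_enorm]
      exact ENNReal.toReal_mono hfin h3
    gcongr
  refine ⟨τ, g, hτ, hτs, hgf, fun π hπ => ?_⟩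
  have hg0 : ∀ᵐ x ∂volume.restrict Ω, g x 0 = 0 := by
    filter_upwards [hgf, hf.zero] with x h1 h2
    rw [h1, h2]
  have hprim : ∀ᵐ x ∂volume.restrict Ω, ∀ s,
      primitive (fun x s => g x (π s)) x s = primitive g x (π s) := by
    filter_upwards [hg0] with x hx s
    exact hπ.integral_comp (g x) (hgc x) hx s
  have hprimf : ∀ᵐ x ∂volume.restrict Ω, ∀ s, primitive g x s = primitive f x s := by
    filter_upwards [hgf] with x hx s
    rw [primitive, hx, primitive]
  have hloc : ∀ R : ℝ, ∃ K : ℝ, ∀ᵐ x ∂volume.restrict Ω, ∀ s, |s| ≤ R →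
      |g x s * s| ≤ K ∧ |primitive g x s| ≤ K := by
    intro R
    refine ⟨A * (1 + R ^ (r - 1)) * R, ?_⟩
    filter_upwards [hgr] with x hx s hs
    have h1 : A * (1 + |s| ^ (r - 1)) * |s| ≤ A * (1 + R ^ (r - 1)) * R := by
      have : 0 ≤ R := (abs_nonneg s).trans hs
      gcongr
    refine ⟨?_, (abs_integral_le_of_growth hA hr1 hx s).trans h1⟩
    rw [abs_mul]
    exact (mul_le_mul_of_nonneg_right (hx s) (abs_nonneg s)).trans h1
  refine
    { measurable := fun s => hgm (π s)
      continuous := fun x => (hgc x).comp hπ.continuous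
      growth := ⟨A, hA, ?_⟩
      mul_le := ⟨2 * A, by positivity, ?_⟩
      superquadratic := ?_
      superlinear := fun M => ?_ }
  · filter_upwards [hgr] with x hx s
    refine (hx (π s)).trans ?_
    have := hπ.abs_le s
    gcongr
  · filter_upwards [hgr, hg0] with x hx h0 s
    rw [hπ.comp_mul (g x) h0]
    set y := π s
    have h1 : g x y * y ≤ A * (1 + |y| ^ (r - 1)) * |y| := by
      refine (le_abs_self _).trans ?_
      rw [abs_mul]
      exact mul_le_mul_of_nonneg_right (hx y) (abs_nonneg y)
    have h2 : |y| ^ (r - 1) * |y| = |y| ^ r := by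
      rw [← Real.rpow_add_one' (abs_nonneg y) (by linarith), sub_add_cancel]
    have h3 : |y| ≤ 1 + |y| ^ r := by
      rcases le_total |y| 1 with h | h
      · have : 0 ≤ |y| ^ r := by positivity
        linarith
      · have := Real.self_le_rpow_of_one_le h hr1.le
        linarith
    calc g x y * y ≤ A * (1 + |y| ^ (r - 1)) * |y| := h1
      _ = A * (|y| + |y| ^ r) := by rw [← h2]; ring
      _ ≤ A * (1 + |y| ^ r + (1 + |y| ^ r)) := by
        gcongr
        linarith
      _ = 2 * A * (1 + |y| ^ r) := by ring
  · obtain ⟨R, hR, hliminf⟩ := hlim (β₀ / 2) (by positivity)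
    obtain ⟨K, hK⟩ := hloc R
    -- Beyond R the limit condition with ε = β₀/2 applies; for |π(s)| ≤ R both sides are bounded,
    -- and the constant absorbs them.
    refine ⟨β₀ / 2, β₀ / 2 * R ^ τ + (1 + p) * K, by positivity, ?_⟩
    filter_upwards [hprim, hg0, hK, hliminf, hprimf, hgf] with x h1 h0 h2 h3 h4 h5 s
    rw [hπ.comp_mul (g x) h0, h1]
    set y := π s
    rcases le_total R |y| with hy | hy
    · have h6 := h3 y hy
      have hy0 : 0 < |y| := hR.trans_le hy
      rw [le_div_iff₀ (by positivity)] at h6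
      rw [h4, h5]
      have h7 : 0 ≤ K := (abs_nonneg _).trans (h2 0 (by simpa using hR.le)).1
      have h8 : 0 ≤ β₀ / 2 * R ^ τ := by positivity
      have h9 : 0 ≤ (1 + p) * K := by positivity
      linarith
    · obtain ⟨h6, h7⟩ := h2 y hy
      have h8 : |y| ^ τ ≤ R ^ τ := Real.rpow_le_rpow (abs_nonneg y) hy hτ0.le
      have h9 := neg_abs_le (g x y * y)
      have h10 := mul_le_mul_of_nonneg_left ((le_abs_self (primitive g x y)).trans h7)
        (by linarith : 0 ≤ p)
      have h11 := mul_le_mul_of_nonneg_left h8 (by positivity : 0 ≤ β₀ / 2)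
      linarith
  · obtain ⟨R, hR, hsup⟩ := hf.superlinear M
    obtain ⟨K, hK⟩ := hloc R
    refine ⟨|M| * R ^ p + K, ?_⟩
    filter_upwards [hprim, hK, hsup, hprimf] with x h1 h2 h3 h4 s
    rw [h1]
    set y := π s
    have hRp : 0 ≤ |M| * R ^ p := by positivity
    have hK0 : 0 ≤ K := (abs_nonneg _).trans (h2 0 (by simpa using hR.le)).1
    rcases le_total R |y| with hy | hy
    · have h6 := h3 y hy
      have hy0 : 0 < |y| := hR.trans_le hy
      rw [le_div_iff₀ (by positivity)] at h6
      rw [h4]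
      linarith
    · have h7 := (h2 y hy).2
      have h8 : |y| ^ p ≤ R ^ p := Real.rpow_le_rpow (abs_nonneg y) hy (by linarith)
      have h9 : M * |y| ^ p ≤ |M| * R ^ p := by
        have : 0 ≤ |y| ^ p := by positivity
        exact (mul_le_mul_of_nonneg_right (le_abs_self M) this).trans
          (mul_le_mul_of_nonneg_left h8 (abs_nonneg M))
      linarith [neg_abs_le (primitive g x y)]

end ReactionTerm

/-! ### The energy functional -/

theorem integral_norm_rpow_Lp {α F : Type*} [MeasurableSpace α] {μ : Measure α}
    [NormedAddCommGroup F] {q : ℝ} [hq : Fact (1 < q)] (w : Lp F (ENNReal.ofReal q) μ) :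
    Integrable (fun x => ‖w x‖ ^ q) μ ∧ ∫ x, ‖w x‖ ^ q ∂μ = ‖w‖ ^ q := by
  have hq0 : 0 < q := by linarith [hq.out]
  have h1 := (Lp.memLp w).integrable_norm_rpow (by simpa using hq0) ENNReal.ofReal_ne_top
  rw [ENNReal.toReal_ofReal hq0.le] at h1
  refine ⟨h1, ?_⟩
  have h2 : ENNReal.ofReal (∫ x, ‖w x‖ ^ q ∂μ) = ENNReal.ofReal (‖w‖ ^ q) := by
    rw [ofReal_integral_eq_lintegral_ofReal h1
      (Eventually.of_forall fun x => Real.rpow_nonneg (norm_nonneg _) _), ← lintegral_enorm_rpow_Lp]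
    refine lintegral_congr fun x => ?_
    rw [← ofReal_norm, ENNReal.ofReal_rpow_of_nonneg (norm_nonneg _) hq0.le]
  exact (ENNReal.ofReal_eq_ofReal_iff (integral_nonneg fun x => Real.rpow_nonneg (norm_nonneg _) _)
    (Real.rpow_nonneg (norm_nonneg _) _)).1 h2

theorem integral_rpow_interpolation {α : Type*} [MeasurableSpace α] {μ : Measure α}
    {g : α → ℝ} (hg0 : ∀ x, 0 ≤ g x) (hg : AEMeasurable g μ) {a b c : ℝ} (ha : 0 < a) (hab : a ≤ b)
    (hbc : b ≤ c) (hac : a < c) (hia : Integrable (fun x => g x ^ a) μ)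
    (hib : Integrable (fun x => g x ^ b) μ) (hic : Integrable (fun x => g x ^ c) μ) :
    ∫ x, g x ^ b ∂μ ≤
      (∫ x, g x ^ a ∂μ) ^ ((c - b) / (c - a)) * (∫ x, g x ^ c ∂μ) ^ ((b - a) / (c - a)) := by
  have h := lintegral_rpow_interpolation hg.ennreal_ofReal ha hab hbc hac
  have hs : ∀ s : ℝ, 0 ≤ s → Integrable (fun x => g x ^ s) μ →
      ∫⁻ x, ENNReal.ofReal (g x) ^ s ∂μ = ENNReal.ofReal (∫ x, g x ^ s ∂μ) := by
    intro s hs hi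
    rw [ofReal_integral_eq_lintegral_ofReal hi
      (Eventually.of_forall fun x => Real.rpow_nonneg (hg0 x) _)]
    refine lintegral_congr fun x => ENNReal.ofReal_rpow_of_nonneg (hg0 x) hs
  have hnn : ∀ s : ℝ, 0 ≤ ∫ x, g x ^ s ∂μ :=
    fun s => integral_nonneg fun x => Real.rpow_nonneg (hg0 x) _
  have hca : 0 ≤ c - a := by linarith
  rw [hs a ha.le hia, hs b (by linarith) hib, hs c (by linarith) hic,
    ENNReal.ofReal_rpow_of_nonneg (hnn a) (div_nonneg (by linarith) hca),
    ENNReal.ofReal_rpow_of_nonneg (hnn c) (div_nonneg (by linarith) hca),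
    ← ENNReal.ofReal_mul (Real.rpow_nonneg (hnn a) _),
    ENNReal.ofReal_le_ofReal_iff (mul_nonneg (Real.rpow_nonneg (hnn a) _)
      (Real.rpow_nonneg (hnn c) _))] at h
  exact h

theorem contDiff_and_fderiv_comp_sub_comp {X Y Z : Type*} [NormedAddCommGroup X] [NormedSpace ℝ X]
    [NormedAddCommGroup Y] [NormedSpace ℝ Y] [NormedAddCommGroup Z] [NormedSpace ℝ Z]
    {φ : X → ℝ} {Γ : Y → ℝ} {Ψ : Z → ℝ} (hΓ : ContDiff ℝ 1 Γ) (hΨ : ContDiff ℝ 1 Ψ)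
    (D : X →L[ℝ] Y) (ι : X →L[ℝ] Z) (hφ : ∀ u, φ u = Γ (D u) - Ψ (ι u)) :
    ContDiff ℝ 1 φ ∧
      ∀ u h, fderiv ℝ φ u h + fderiv ℝ Ψ (ι u) (ι h) = fderiv ℝ Γ (D u) (D h) := by
  obtain rfl : φ = fun u => Γ (D u) - Ψ (ι u) := funext hφ
  refine ⟨(hΓ.comp D.contDiff).sub (hΨ.comp ι.contDiff), fun u h => ?_⟩
  have h1 := ((hΓ.differentiable (by simp) (D u)).hasFDerivAt.comp u D.hasFDerivAt).sub
    ((hΨ.differentiable (by simp) (ι u)).hasFDerivAt.comp u ι.hasFDerivAt)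
  have h2 : HasFDerivAt (fun u => Γ (D u) - Ψ (ι u)) _ u := h1
  rw [h2.fderiv]
  exact sub_add_cancel _ _

/-- The part of the argument to which a reaction responds: `|s|` or a one-sided part. -/
structure IsActivity (act : ℝ → ℝ) : Prop where
  continuous : Continuous act
  nonneg : ∀ s, 0 ≤ act s
  le_abs : ∀ s, act s ≤ |s|
  smul : ∀ t s, 0 ≤ t → act (t * s) = t * act s

section Energy

variable {N : ℕ} {Ω : Set (E N)} {p r τ c₁ : ℝ} [hp : Fact (1 < p)] {act : ℝ → ℝ}
  {f : E N → ℝ → ℝ} {a₀ ϑ : ℝ → ℝ}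

theorem gradOf_sub (u v : W0 Ω p) : gradOf (u - v) =ᵐ[volume.restrict Ω] gradOf u - gradOf v :=
  Lp.coeFn_sub u.1.2 v.1.2

theorem gradOf_smul (c : ℝ) (u : W0 Ω p) : gradOf (c • u) =ᵐ[volume.restrict Ω] c • gradOf u :=
  Lp.coeFn_smul c u.1.2

theorem memLp_gradOf (u : W0 Ω p) : MemLp (gradOf u) (ENNReal.ofReal p) (volume.restrict Ω) :=
  Lp.memLp u.1.2

theorem aestronglyMeasurable_valOf (u : W0 Ω p) :
    AEStronglyMeasurable (valOf u) (volume.restrict Ω) :=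
  Lp.aestronglyMeasurable u.1.1

theorem integrable_norm_gradOf (u : W0 Ω p) :
    Integrable (fun x => ‖gradOf u x‖ ^ p) (volume.restrict Ω) :=
  (integral_norm_rpow_Lp u.1.2).1

theorem integral_norm_gradOf (u : W0 Ω p) : ∫ x in Ω, ‖gradOf u x‖ ^ p = ‖u.1.2‖ ^ p :=
  (integral_norm_rpow_Lp u.1.2).2

theorem integral_norm_gradOf_le (u : W0 Ω p) : ∫ x in Ω, ‖gradOf u x‖ ^ p ≤ ‖u‖ ^ p := by
  rw [integral_norm_gradOf]
  exact Real.rpow_le_rpow (norm_nonneg _) (norm_snd_le u.1) (by linarith [hp.out])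

theorem exists_norm_rpow_le (hN : 1 ≤ N) (hΩ : Bornology.IsBounded Ω) :
    ∃ C : ℝ, 0 < C ∧ ∀ u : W0 Ω p, ‖u‖ ^ p ≤ C * ∫ x in Ω, ‖gradOf u x‖ ^ p := by
  obtain ⟨C, hC, h⟩ := exists_norm_le (p := p) hN hΩ
  refine ⟨C ^ p, by positivity, fun u => ?_⟩
  rw [integral_norm_gradOf, ← Real.mul_rpow hC.le (norm_nonneg _)]
  exact Real.rpow_le_rpow (norm_nonneg _) (h u) (by linarith [hp.out])

theorem integrable_act (hact : IsActivity act) (hN : 1 ≤ N) (hΩ : Bornology.IsBounded Ω) {s q : ℝ}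
    (hs : 0 ≤ s) (hsq : s ≤ q) (hq : 1 ≤ q) (hqs : (q : EReal) < criticalExponent N p)
    (u : W0 Ω p) : Integrable (fun x => act (valOf u x) ^ s) (volume.restrict Ω) := by
  have : IsFiniteMeasure (volume.restrict Ω) := ⟨by simpa using hΩ.measure_lt_top⟩
  have hq0 : 0 < q := by linarith
  have h1 := (memLp_val hN hΩ hq hqs u).integrable_norm_rpow (by simpa using hq0)
    ENNReal.ofReal_ne_top
  rw [ENNReal.toReal_ofReal hq0.le] at h1
  refine Integrable.mono' ((integrable_const (1 : ℝ)).add h1) ?_ (Eventually.of_forall fun x => ?_)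
  · exact ((Real.continuous_rpow_const hs).comp hact.continuous).comp_aestronglyMeasurable
      (aestronglyMeasurable_valOf u)
  · have h2 := hact.nonneg (valOf u x)
    rw [Real.norm_of_nonneg (Real.rpow_nonneg h2 _), Pi.add_apply]
    have h3 : act (valOf u x) ^ s ≤ ‖valOf u x‖ ^ s :=
      Real.rpow_le_rpow h2 (hact.le_abs _) hs
    refine h3.trans ?_
    rcases le_total ‖valOf u x‖ 1 with h | h
    · have h4 := Real.rpow_le_one (norm_nonneg _) h hs
      have h5 := Real.rpow_nonneg (norm_nonneg (valOf u x)) q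
      linarith
    · have h4 := Real.rpow_le_rpow_of_exponent_le h hsq
      linarith

/-- The potential of the reaction on a Lebesgue space. -/
def potential (Ω : Set (E N)) (r : ℝ) (f : E N → ℝ → ℝ)
    (w : Lp ℝ (ENNReal.ofReal r) (volume.restrict Ω)) : ℝ :=
  ∫ x in Ω, primitive f x (w x)

set_option maxHeartbeats 1000000 in
theorem energy_contDiff_and_fderiv (hN : 1 ≤ N) (hΩ : Bornology.IsBounded Ω)
    (hϑ : HypTheta p ϑ c₁) (ha : HypA N p a₀ ϑ) [hr : Fact (1 < r)] (R : Reaction Ω p r τ act f)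
    (ι : W0 Ω p →L[ℝ] Lp ℝ (ENNReal.ofReal r) (volume.restrict Ω))
    (hι : ∀ u, ι u =ᵐ[volume.restrict Ω] valOf u) :
    ContDiff ℝ 1 (potential Ω r f) ∧ ContDiff ℝ 1 (energy Ω p a₀ f) ∧
      (∀ u h : W0 Ω p, fderiv ℝ (energy Ω p a₀ f) u h + fderiv ℝ (potential Ω r f) (ι u) (ι h) =
        ∫ x in Ω, inner ℝ (fieldA a₀ (gradOf u x)) (gradOf h x)) ∧
      ∀ u h : W0 Ω p, fderiv ℝ (potential Ω r f) (ι u) (ι h) =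
        ∫ x in Ω, f x (valOf u x) * valOf h x := by
  have : IsFiniteMeasure (volume.restrict Ω) := ⟨by simpa using hΩ.measure_lt_top⟩
  obtain ⟨hΨ, hΨd⟩ := R.isSmoothIntegrand.contDiff_and_fderiv
  obtain ⟨hΓ, hΓd⟩ := (ha.isSmoothIntegrand hN hϑ (volume.restrict Ω)).contDiff_and_fderiv
  let D : W0 Ω p →L[ℝ] Lp (E N) (ENNReal.ofReal p) (volume.restrict Ω) :=
    (ContinuousLinearMap.snd ℝ _ _).comp (W0 Ω p).subtypeL
  have hΨ' : ContDiff ℝ 1 (potential Ω r f) := hΨ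
  have heq : ∀ u : W0 Ω p, energy Ω p a₀ f u =
      (∫ x in Ω, G₀ a₀ ‖(D u : E N → E N) x‖) - potential Ω r f (ι u) := by
    intro u
    have h1 : ∫ x in Ω, primitive f x (valOf u x) = potential Ω r f (ι u) := by
      refine integral_congr_ae ?_
      filter_upwards [hι u] with x hx
      rw [hx]
    rw [energy, h1]
    rfl
  obtain ⟨k1, k2⟩ := contDiff_and_fderiv_comp_sub_comp hΓ hΨ' D ι heq
  refine ⟨hΨ', k1, fun u h => (k2 u h).trans ?_, fun u h => ?_⟩
  · exact hΓd (D u) (D h)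
  · refine (hΨd (ι u) (ι h)).trans (integral_congr_ae ?_)
    filter_upwards [hι u, hι h] with x h1 h2
    rw [h1, h2]
    simp

end Energy

theorem integral_linear_combination {α : Type*} [MeasurableSpace α] {μ : Measure α}
    {a b c d : α → ℝ} (ha : Integrable a μ) (hb : Integrable b μ) (hc : Integrable c μ)
    (hd : Integrable d μ) (δ C : ℝ) :
    Integrable (fun x => δ * (a x + b x) + C * (c x - d x)) μ ∧
      ∫ x, (δ * (a x + b x) + C * (c x - d x)) ∂μ =
        δ * ((∫ x, a x ∂μ) + ∫ x, b x ∂μ) + C * ((∫ x, c x ∂μ) - ∫ x, d x ∂μ) := by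
  have h1 : Integrable (fun x => δ * (a x + b x)) μ := (ha.add hb).const_mul δ
  have h2 : Integrable (fun x => C * (c x - d x)) μ := (hc.sub hd).const_mul C
  exact ⟨h1.add h2, by rw [integral_add h1 h2, integral_const_mul, integral_const_mul,
    integral_add ha hb, integral_sub hc hd]⟩

/-! ### A priori estimates for the energy -/

section Estimates

variable {N : ℕ} {Ω : Set (E N)} {p r τ c₁ : ℝ} [hp : Fact (1 < p)] {act : ℝ → ℝ}
  {f : E N → ℝ → ℝ} {a₀ ϑ : ℝ → ℝ}

theorem integrable_primitive (hN : 1 ≤ N) (hΩ : Bornology.IsBounded Ω) [hr : Fact (1 < r)]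
    (hrs : (r : EReal) < criticalExponent N p) (R : Reaction Ω p r τ act f) (u : W0 Ω p) :
    Integrable (fun x => primitive f x (valOf u x)) (volume.restrict Ω) := by
  have : IsFiniteMeasure (volume.restrict Ω) := ⟨by simpa using hΩ.measure_lt_top⟩
  exact R.isSmoothIntegrand.integrable (memLp_val hN hΩ hr.out.le hrs u)

theorem integrable_reaction_mul (hN : 1 ≤ N) (hΩ : Bornology.IsBounded Ω) [hr : Fact (1 < r)]
    (hrs : (r : EReal) < criticalExponent N p) (R : Reaction Ω p r τ act f) (u v : W0 Ω p) :
    Integrable (fun x => f x (valOf u x) * valOf v x) (volume.restrict Ω) := by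
  have : IsFiniteMeasure (volume.restrict Ω) := ⟨by simpa using hΩ.measure_lt_top⟩
  have h := R.isSmoothIntegrand.integrable_deriv (memLp_val hN hΩ hr.out.le hrs u)
    (memLp_val hN hΩ hr.out.le hrs v)
  refine h.congr (Eventually.of_forall fun x => ?_)
  simp

theorem integrable_G₀ (hN : 1 ≤ N) (hΩ : Bornology.IsBounded Ω) (hϑ : HypTheta p ϑ c₁)
    (ha : HypA N p a₀ ϑ) (u : W0 Ω p) :
    Integrable (fun x => G₀ a₀ ‖gradOf u x‖) (volume.restrict Ω) := by
  have : IsFiniteMeasure (volume.restrict Ω) := ⟨by simpa using hΩ.measure_lt_top⟩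
  exact (ha.isSmoothIntegrand hN hϑ (volume.restrict Ω)).integrable (memLp_gradOf u)

theorem integrable_inner_fieldA (hN : 1 ≤ N) (hΩ : Bornology.IsBounded Ω) (hϑ : HypTheta p ϑ c₁)
    (ha : HypA N p a₀ ϑ) (u v : W0 Ω p) :
    Integrable (fun x => inner ℝ (fieldA a₀ (gradOf u x)) (gradOf v x)) (volume.restrict Ω) := by
  have : IsFiniteMeasure (volume.restrict Ω) := ⟨by simpa using hΩ.measure_lt_top⟩
  exact (ha.isSmoothIntegrand hN hϑ (volume.restrict Ω)).integrable_deriv (memLp_gradOf u)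
    (memLp_gradOf v)

/-- The derivative of the energy in the radial direction is controlled by the energy. -/
theorem exists_radial_estimate (hN : 1 ≤ N) (hΩ : Bornology.IsBounded Ω) (hϑ : HypTheta p ϑ c₁)
    (ha : HypA N p a₀ ϑ) [hr : Fact (1 < r)] (hrs : (r : EReal) < criticalExponent N p)
    (R : Reaction Ω p r τ act f)
    (hiact : ∀ u : W0 Ω p, Integrable (fun x => act (valOf u x) ^ τ) (volume.restrict Ω)) :
    ∃ β C : ℝ, 0 < β ∧ ∀ u : W0 Ω p,
      (∫ x in Ω, inner ℝ (fieldA a₀ (gradOf u x)) (gradOf u x)) -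
        (∫ x in Ω, f x (valOf u x) * valOf u x) + β * ∫ x in Ω, act (valOf u x) ^ τ ≤
      p * energy Ω p a₀ f u + C := by
  have : IsFiniteMeasure (volume.restrict Ω) := ⟨by simpa using hΩ.measure_lt_top⟩
  obtain ⟨β, C, hβ, hsq⟩ := R.superquadratic
  obtain ⟨c, hc, hG⟩ := ha.inner_fieldA_sub_le
  refine ⟨β, (c + C) * (volume.restrict Ω).real Set.univ, hβ, fun u => ?_⟩
  have i1 := integrable_inner_fieldA hN hΩ hϑ ha u u
  have i2 := (integrable_G₀ hN hΩ hϑ ha u).const_mul p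
  have i3 := integrable_reaction_mul hN hΩ hrs R u u
  have i4 := (integrable_primitive hN hΩ hrs R u).const_mul p
  have i5 := (hiact u).const_mul β
  have h1 : ∫ x in Ω, (inner ℝ (fieldA a₀ (gradOf u x)) (gradOf u x) - p * G₀ a₀ ‖gradOf u x‖) ≤
      ∫ x in Ω, c :=
    integral_mono (i1.sub i2) (integrable_const c) fun x => hG (gradOf u x)
  have h2 : ∫ x in Ω, (β * act (valOf u x) ^ τ - C) ≤
      ∫ x in Ω, (f x (valOf u x) * valOf u x - p * primitive f x (valOf u x)) := by
    refine integral_mono_ae (i5.sub (integrable_const C)) (i3.sub i4) ?_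
    filter_upwards [hsq] with x hx using hx (valOf u x)
  rw [integral_sub i1 i2, integral_const, integral_const_mul, smul_eq_mul] at h1
  rw [integral_sub i5 (integrable_const C), integral_sub i3 i4, integral_const, integral_const_mul,
    integral_const_mul, smul_eq_mul] at h2
  rw [energy]
  linarith

/-- Where the activity vanishes, pF ≤ f s + C and f s ≤ A, so F is bounded above. The gradient term
is nonnegative. -/
theorem exists_lower_bound_of_inactive (hN : 1 ≤ N) (hΩ : Bornology.IsBounded Ω)
    (ha : HypA N p a₀ ϑ) [hr : Fact (1 < r)] (hrs : (r : EReal) < criticalExponent N p)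
    (hτ : 0 < τ) (R : Reaction Ω p r τ act f) :
    ∃ L : ℝ, ∀ u : W0 Ω p, u ∉ activeSet Ω p act → L ≤ energy Ω p a₀ f u := by
  have : IsFiniteMeasure (volume.restrict Ω) := ⟨by simpa using hΩ.measure_lt_top⟩
  have hp0 : 0 < p := by linarith [hp.out]
  have hr0 : r ≠ 0 := by linarith [hr.out]
  obtain ⟨β, C, hβ, hsq⟩ := R.superquadratic
  obtain ⟨A, hA, hmul⟩ := R.mul_le
  refine ⟨- ((A + C) / p * (volume.restrict Ω).real Set.univ), fun u hu => ?_⟩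
  rw [activeSet, Set.mem_ofPred_eq, not_not] at hu
  have h1 : 0 ≤ ∫ x in Ω, G₀ a₀ ‖gradOf u x‖ := integral_nonneg fun x => ha.G₀_nonneg (norm_nonneg _)
  have h2 : ∫ x in Ω, primitive f x (valOf u x) ≤ ∫ x in Ω, (A + C) / p := by
    refine integral_mono_ae (integrable_primitive hN hΩ hrs R u) (integrable_const _) ?_
    filter_upwards [hu, hsq, hmul] with x hx h3 h4
    have h5 := h3 (valOf u x)
    have h6 := h4 (valOf u x)
    rw [hx, Real.zero_rpow hτ.ne'] at h5
    rw [hx, Real.zero_rpow hr0] at h6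
    rw [le_div_iff₀ hp0]
    linarith
  rw [integral_const, smul_eq_mul] at h2
  rw [energy]
  linarith

set_option maxHeartbeats 1000000 in
/-- The energy tends to `-∞` along the ray through an active function. -/
theorem exists_energy_smul_lt (hN : 1 ≤ N) (hΩ : Bornology.IsBounded Ω) (hϑ : HypTheta p ϑ c₁)
    (ha : HypA N p a₀ ϑ) [hr : Fact (1 < r)] (hrs : (r : EReal) < criticalExponent N p)
    (hact : IsActivity act) (R : Reaction Ω p r τ act f)
    (hiact : ∀ u : W0 Ω p, Integrable (fun x => act (valOf u x) ^ p) (volume.restrict Ω))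
    {u : W0 Ω p} (hu : u ∈ activeSet Ω p act) (b : ℝ) :
    ∃ t : ℝ, 1 ≤ t ∧ energy Ω p a₀ f (t • u) < b := by
  have : IsFiniteMeasure (volume.restrict Ω) := ⟨by simpa using hΩ.measure_lt_top⟩
  have hp0 : 0 < p := by linarith [hp.out]
  obtain ⟨K, hK, hG⟩ := ha.G₀_le hN hp.out hϑ
  set I := ∫ x in Ω, act (valOf u x) ^ p with hI
  set J := ∫ x in Ω, ‖gradOf u x‖ ^ p with hJ
  set V := (volume.restrict Ω).real Set.univ with hV
  have hIpos : 0 < I := by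
    have h0 : 0 ≤ I := integral_nonneg fun x => Real.rpow_nonneg (hact.nonneg _) _
    refine h0.lt_of_ne fun h => hu ?_
    have h1 := (integral_eq_zero_iff_of_nonneg
      (fun x => Real.rpow_nonneg (hact.nonneg (valOf u x)) p) (hiact u)).1 h.symm
    filter_upwards [h1] with x hx
    exact (Real.rpow_eq_zero (hact.nonneg _) hp0.ne').1 hx
  -- The slope makes the reaction term beat the gradient bound KJt^p by exactly t^p, which is left
  -- with a negative sign.
  obtain ⟨C, hC⟩ := R.superlinear ((K * J + 1) / I)
  have key : ∀ t : ℝ, 0 ≤ t → energy Ω p a₀ f (t • u) ≤ (K + C) * V - t ^ p := by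
    intro t ht
    have h1 : ∫ x in Ω, G₀ a₀ ‖gradOf (t • u) x‖ ≤ ∫ x in Ω, (K + K * t ^ p * ‖gradOf u x‖ ^ p) := by
      refine integral_mono_ae (integrable_G₀ hN hΩ hϑ ha (t • u))
        ((integrable_const K).add ((integrable_norm_gradOf u).const_mul _)) ?_
      filter_upwards [gradOf_smul t u] with x hx
      refine (hG _).trans (le_of_eq ?_)
      rw [hx, Pi.smul_apply, norm_smul, Real.norm_of_nonneg ht, Real.mul_rpow ht (norm_nonneg _)]
      ring
    have h2 : ∫ x in Ω, ((K * J + 1) / I * t ^ p * act (valOf u x) ^ p - C) ≤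
        ∫ x in Ω, primitive f x (valOf (t • u) x) := by
      refine integral_mono_ae (((hiact u).const_mul _).sub (integrable_const C))
        (integrable_primitive hN hΩ hrs R (t • u)) ?_
      filter_upwards [hC, valOf_smul t u] with x hx h3
      refine le_trans (le_of_eq ?_) (hx _)
      rw [h3, Pi.smul_apply, smul_eq_mul, hact.smul _ _ ht, Real.mul_rpow ht (hact.nonneg _)]
      ring
    rw [integral_add (integrable_const K) ((integrable_norm_gradOf u).const_mul _), integral_const,
      integral_const_mul, smul_eq_mul, ← hV, ← hJ] at h1
    rw [integral_sub ((hiact u).const_mul _) (integrable_const C), integral_const,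
      integral_const_mul, smul_eq_mul, ← hV, ← hI] at h2
    have h3 : (K * J + 1) / I * t ^ p * I = (K * J + 1) * t ^ p := by field_simp
    rw [h3] at h2
    rw [energy]
    linarith
  have hlim : Tendsto (fun t : ℝ => t ^ p) atTop atTop := tendsto_rpow_atTop hp0
  obtain ⟨t, h1, h2⟩ := ((eventually_ge_atTop (1 : ℝ)).and
    (hlim.eventually_gt_atTop ((K + C) * V - b))).exists
  exact ⟨t, h1, (key t (by linarith)).trans_lt (by linarith)⟩

set_option maxHeartbeats 1000000 in
/-- The principal part of the energy is uniformly monotone on bounded sets. -/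
theorem exists_monotone_estimate (hN : 1 ≤ N) (hΩ : Bornology.IsBounded Ω) (hϑ : HypTheta p ϑ c₁)
    (ha : HypA N p a₀ ϑ) (M ε : ℝ) (hε : 0 < ε) :
    ∃ C : ℝ, 0 ≤ C ∧ ∀ u v : W0 Ω p, ‖u‖ ≤ M → ‖v‖ ≤ M →
      ‖u - v‖ ^ p ≤ ε + C * ((∫ x in Ω, inner ℝ (fieldA a₀ (gradOf u x)) (gradOf (u - v) x)) -
        ∫ x in Ω, inner ℝ (fieldA a₀ (gradOf v x)) (gradOf (u - v) x)) := by
  have hp0 : 0 < p := by linarith [hp.out]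
  obtain ⟨K, hK, hnorm⟩ := exists_norm_rpow_le (p := p) hN hΩ
  have hM0 : 0 ≤ |M| ^ p := Real.rpow_nonneg (abs_nonneg M) p
  -- With ∫‖∇u‖^p and ∫‖∇v‖^p at most |M|^p, this choice makes the loss term, multiplied by the
  -- Poincaré constant K, at most ε.
  have hδ : 0 < ε / (K * (2 * |M| ^ p + 1)) := by positivity
  obtain ⟨C, hC, hmono⟩ := ha.norm_sub_rpow_le hp.out hϑ hδ
  refine ⟨K * C, by positivity, fun u v hu hv => ?_⟩
  set δ := ε / (K * (2 * |M| ^ p + 1)) with hδ'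
  have i1 := integrable_inner_fieldA hN hΩ hϑ ha u (u - v)
  have i2 := integrable_inner_fieldA hN hΩ hϑ ha v (u - v)
  have iu := integrable_norm_gradOf u
  have iv := integrable_norm_gradOf v
  have hbu : ∀ w : W0 Ω p, ‖w‖ ≤ M → ∫ x in Ω, ‖gradOf w x‖ ^ p ≤ |M| ^ p := fun w hw =>
    (integral_norm_gradOf_le w).trans
      (Real.rpow_le_rpow (norm_nonneg _) (hw.trans (le_abs_self M)) hp0.le)
  have h1 : ∫ x in Ω, ‖gradOf (u - v) x‖ ^ p ≤
      ∫ x in Ω, (δ * (‖gradOf u x‖ ^ p + ‖gradOf v x‖ ^ p) +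
        C * (inner ℝ (fieldA a₀ (gradOf u x)) (gradOf (u - v) x) -
          inner ℝ (fieldA a₀ (gradOf v x)) (gradOf (u - v) x))) := by
    refine integral_mono_ae (integrable_norm_gradOf (u - v))
      (integral_linear_combination iu iv i1 i2 δ C).1 ?_
    filter_upwards [gradOf_sub u v] with x hx
    rw [hx, Pi.sub_apply, ← inner_sub_left]
    exact hmono _ _
  rw [(integral_linear_combination iu iv i1 i2 δ C).2] at h1
  have h3 := hnorm (u - v)
  have h4 := mul_le_mul_of_nonneg_left h1 hK.le
  have h5 : K * (δ * ((∫ x in Ω, ‖gradOf u x‖ ^ p) + ∫ x in Ω, ‖gradOf v x‖ ^ p)) ≤ ε := by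
    have h6 : (∫ x in Ω, ‖gradOf u x‖ ^ p) + ∫ x in Ω, ‖gradOf v x‖ ^ p ≤ 2 * |M| ^ p + 1 := by
      linarith [hbu u hu, hbu v hv]
    calc _ ≤ K * (δ * (2 * |M| ^ p + 1)) := by gcongr
      _ = ε := by rw [hδ']; field_simp
  linarith

/-- Functions with bounded energy and bounded radial derivative of the energy are bounded. -/
theorem exists_norm_bound (hN : 1 ≤ N) (hΩ : Bornology.IsBounded Ω) (hϑ : HypTheta p ϑ c₁)
    (ha : HypA N p a₀ ϑ) [hr : Fact (1 < r)] (hpr : p < r)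
    (hrs : (r : EReal) < criticalExponent N p) (hτ : (r - p) * max (N / p) 1 < τ)
    (hτs : (τ : EReal) < criticalExponent N p) (hact : IsActivity act)
    (R : Reaction Ω p r τ act f) (M K : ℝ) :
    ∃ Y : ℝ, ∀ u : W0 Ω p, energy Ω p a₀ f u ≤ M →
      |(∫ x in Ω, inner ℝ (fieldA a₀ (gradOf u x)) (gradOf u x)) -
        ∫ x in Ω, f x (valOf u x) * valOf u x| ≤ K → ‖u‖ ≤ Y := by
  have : IsFiniteMeasure (volume.restrict Ω) := ⟨by simpa using hΩ.measure_lt_top⟩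
  have hp0 : 0 < p := by linarith [hp.out]
  have hr1 := hr.out
  have hτ0 : 0 < τ := by
    refine lt_of_le_of_lt (mul_nonneg (by linarith) ?_) hτ
    exact zero_le_one.trans (le_max_right _ _)
  obtain ⟨q, hrq, hτq, hqs, hq⟩ := exists_interpolation_exponent hp.out hpr hrs hτ hτs
  have hq1 : Fact (1 < q) := ⟨by linarith⟩
  have hi : ∀ s, 0 ≤ s → s ≤ q → ∀ u : W0 Ω p,
      Integrable (fun x => act (valOf u x) ^ s) (volume.restrict Ω) := fun s hs hsq u =>
    integrable_act hact hN hΩ hs hsq hq1.out.le hqs u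
  obtain ⟨β, C, hβ, hrad⟩ := exists_radial_estimate hN hΩ hϑ ha hrs R (hi τ hτ0.le hτq.le)
  set V := (volume.restrict Ω).real Set.univ with hV
  -- The bound on the integral of act^τ obtained from the radial estimate, the energy bound M and
  -- the bound K on the radial derivative.
  set B := (p * M + C + K) / β with hB
  have hτbound : ∀ u : W0 Ω p, energy Ω p a₀ f u ≤ M →
      |(∫ x in Ω, inner ℝ (fieldA a₀ (gradOf u x)) (gradOf u x)) -
        ∫ x in Ω, f x (valOf u x) * valOf u x| ≤ K → ∫ x in Ω, act (valOf u x) ^ τ ≤ B := by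
    intro u h1 h2
    rw [hB, le_div_iff₀ hβ]
    have h3 := hrad u
    have h4 := mul_le_mul_of_nonneg_left h1 hp0.le
    linarith [(abs_le.1 h2).1]
  obtain ⟨s, hs0, hsp, K₁, K₂, hK₂, hrbound⟩ : ∃ s : ℝ, 0 ≤ s ∧ s < p ∧ ∃ K₁ K₂ : ℝ, 0 ≤ K₂ ∧
      ∀ u : W0 Ω p, ∫ x in Ω, act (valOf u x) ^ τ ≤ B →
        ∫ x in Ω, act (valOf u x) ^ r ≤ K₁ + K₂ * ‖u‖ ^ s := by
    -- If r ≤ τ, then act^r ≤ 1 + act^τ and the L^τ bound is enough, so the power of the norm is 0.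
    -- If τ < r, interpolation between L^τ and L^q costs the power q(r − τ)/(q − τ), which the
    -- choice of q keeps below p.
    rcases le_or_gt r τ with h | h
    · refine ⟨0, le_rfl, hp0, V + B, 0, le_rfl, fun u hu => ?_⟩
      have h1 : ∫ x in Ω, act (valOf u x) ^ r ≤ ∫ x in Ω, (1 + act (valOf u x) ^ τ) := by
        refine integral_mono (hi r (by linarith) hrq.le u)
          ((integrable_const 1).add (hi τ hτ0.le hτq.le u)) fun x => ?_
        have h2 := hact.nonneg (valOf u x)
        rcases le_total (act (valOf u x)) 1 with h3 | h3
        · have h4 := Real.rpow_le_one h2 h3 (by linarith : 0 ≤ r)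
          have h5 := Real.rpow_nonneg h2 τ
          simp only
          linarith
        · have h4 := Real.rpow_le_rpow_of_exponent_le h3 h
          simp only
          linarith
      rw [integral_add (integrable_const 1) (hi τ hτ0.le hτq.le u), integral_const, smul_eq_mul,
        ← hV, mul_one] at h1
      rw [zero_mul, add_zero]
      linarith
    · obtain ⟨j, hj⟩ := exists_embedding (p := p) hN hΩ hqs
      have hqτ : 0 < q - τ := by linarith
      have hκ : 0 ≤ (r - τ) / (q - τ) := div_nonneg (by linarith) hqτ.le
      have hθ : 0 ≤ (q - r) / (q - τ) := div_nonneg (by linarith) hqτ.le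
      refine ⟨q * ((r - τ) / (q - τ)), mul_nonneg (by linarith) hκ, ?_, 0,
        |B| ^ ((q - r) / (q - τ)) * ‖j‖ ^ (q * ((r - τ) / (q - τ))), by positivity,
        fun u hu => ?_⟩
      · rw [mul_div_assoc', div_lt_iff₀ hqτ]
        linarith
      have h1 := integral_rpow_interpolation (μ := volume.restrict Ω)
        (g := fun x => act (valOf u x)) (fun x => hact.nonneg _)
        (hact.continuous.comp_aestronglyMeasurable (aestronglyMeasurable_valOf u)).aemeasurable
        hτ0 h.le hrq.le hτq (hi τ hτ0.le hτq.le u) (hi r (by linarith) hrq.le u)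
        (hi q (by linarith) le_rfl u)
      have hq' : ∫ x in Ω, act (valOf u x) ^ q ≤ (‖j‖ * ‖u‖) ^ q := by
        have h2 := integral_norm_rpow_Lp (j u)
        refine (integral_mono_ae (hi q (by linarith) le_rfl u) h2.1 ?_).trans ?_
        · filter_upwards [hj u] with x hx
          rw [hx]
          exact Real.rpow_le_rpow (hact.nonneg _) (hact.le_abs _) (by linarith)
        · rw [h2.2]
          exact Real.rpow_le_rpow (norm_nonneg _) (j.le_opNorm u) (by linarith)
      have hτnn : 0 ≤ ∫ x in Ω, act (valOf u x) ^ τ :=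
        integral_nonneg fun x => Real.rpow_nonneg (hact.nonneg _) _
      have hqnn : 0 ≤ ∫ x in Ω, act (valOf u x) ^ q :=
        integral_nonneg fun x => Real.rpow_nonneg (hact.nonneg _) _
      have h3 := Real.rpow_le_rpow hτnn (hu.trans (le_abs_self B)) hθ
      have h4 := Real.rpow_le_rpow hqnn hq' hκ
      rw [← Real.rpow_mul (mul_nonneg (norm_nonneg j) (norm_nonneg u)),
        Real.mul_rpow (norm_nonneg j) (norm_nonneg u)] at h4
      refine h1.trans ((mul_le_mul h3 h4 (Real.rpow_nonneg hqnn _)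
        (Real.rpow_nonneg (abs_nonneg B) _)).trans (le_of_eq ?_))
      ring
  obtain ⟨A, hA, hmul⟩ := R.mul_le
  obtain ⟨η, hη, hcoer⟩ := ha.inner_fieldA_ge hp.out
  obtain ⟨P, hP, hnorm⟩ := exists_norm_rpow_le (p := p) hN hΩ
  -- Coercivity bounds ‖u‖^p by constants plus a multiple of ‖u‖^s with s < p, which forces a bound
  -- on ‖u‖.
  obtain ⟨Y, hY⟩ := exists_bound_of_rpow_le hs0 hsp (P / η * (K + A * V + A * K₁)) (P / η * (A * K₂))
  refine ⟨Y, fun u h1 h2 => hY ‖u‖ (norm_nonneg u) ?_⟩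
  have h3 := hrbound u (hτbound u h1 h2)
  have h4 : η * ∫ x in Ω, ‖gradOf u x‖ ^ p ≤
      ∫ x in Ω, inner ℝ (fieldA a₀ (gradOf u x)) (gradOf u x) := by
    rw [← integral_const_mul]
    exact integral_mono ((integrable_norm_gradOf u).const_mul η)
      (integrable_inner_fieldA hN hΩ hϑ ha u u) fun x => hcoer _
  have h5 : ∫ x in Ω, f x (valOf u x) * valOf u x ≤ A * V + A * ∫ x in Ω, act (valOf u x) ^ r := by
    have i1 := hi r (by linarith) hrq.le u
    have h6 : ∫ x in Ω, f x (valOf u x) * valOf u x ≤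
        ∫ x in Ω, A * (1 + act (valOf u x) ^ r) := by
      refine integral_mono_ae (integrable_reaction_mul hN hΩ hrs R u u)
        (((integrable_const 1).add i1).const_mul A) ?_
      filter_upwards [hmul] with x hx using hx _
    rw [integral_const_mul, integral_add (integrable_const 1) i1, integral_const, smul_eq_mul, ← hV,
      mul_one, mul_add] at h6
    exact h6
  have h6 : η * ∫ x in Ω, ‖gradOf u x‖ ^ p ≤ (K + A * V + A * K₁) + A * K₂ * ‖u‖ ^ s := by
    have h7 := mul_le_mul_of_nonneg_left h3 hA
    linarith [(abs_le.1 h2).2]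
  calc ‖u‖ ^ p ≤ P * ∫ x in Ω, ‖gradOf u x‖ ^ p := hnorm u
    _ = P / η * (η * ∫ x in Ω, ‖gradOf u x‖ ^ p) := by field_simp
    _ ≤ P / η * ((K + A * V + A * K₁) + A * K₂ * ‖u‖ ^ s) := by gcongr
    _ = _ := by ring

end Estimates

theorem exists_abs_apply_le_of_tendsto {X : Type*} [NormedAddCommGroup X] [NormedSpace ℝ X]
    {ℓ : ℕ → X →L[ℝ] ℝ} {u : ℕ → X}
    (h : Tendsto (fun n => (1 + ‖u n‖) • ℓ n) atTop (𝓝 0)) : ∃ K : ℝ, ∀ n, |ℓ n (u n)| ≤ K := by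
  obtain ⟨K, hK⟩ := h.norm.bddAbove_range
  refine ⟨K, fun n => le_trans ?_ (hK ⟨n, rfl⟩)⟩
  simp only
  rw [norm_smul, Real.norm_of_nonneg (by positivity), ← Real.norm_eq_abs]
  refine ((ℓ n).le_opNorm (u n)).trans ?_
  nlinarith [norm_nonneg (ℓ n), norm_nonneg (u n)]

/-! ### The C-condition and vanishing of the critical groups -/

section Main

variable {N : ℕ} {Ω : Set (E N)} {p r τ c₁ : ℝ} [hp : Fact (1 < p)] {act : ℝ → ℝ}
  {f : E N → ℝ → ℝ} {a₀ ϑ : ℝ → ℝ}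

set_option maxHeartbeats 1000000 in
-- The one statement behind all three functionals: the reaction enters only through the inequalities
-- of `Reaction`, and the topology only through contractibility of the active set.
theorem criticalGroupsAtInfinityVanish_energy (hN : 1 ≤ N) (hΩ : Bornology.IsBounded Ω)
    (hϑ : HypTheta p ϑ c₁) (ha : HypA N p a₀ ϑ) (hpr : p < r)
    (hrs : (r : EReal) < criticalExponent N p) (hτ : (r - p) * max (N / p) 1 < τ)
    (hτs : (τ : EReal) < criticalExponent N p) (hact : IsActivity act)
    (hD : ContractibleSpace (activeSet Ω p act)) (R : Reaction Ω p r τ act f) :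
    CriticalGroupsAtInfinityVanish (energy Ω p a₀ f) := by
  have hp1 := hp.out
  have hp0 : 0 < p := by linarith
  have hr : Fact (1 < r) := ⟨hp1.trans hpr⟩
  have hτ0 : 0 < τ := by
    refine lt_of_le_of_lt (mul_nonneg (by linarith) ?_) hτ
    exact zero_le_one.trans (le_max_right _ _)
  obtain ⟨q, hrq, hτq, hqs, -⟩ := exists_interpolation_exponent hp1 hpr hrs hτ hτs
  have hi : ∀ s, 0 ≤ s → s ≤ q → ∀ u : W0 Ω p,
      Integrable (fun x => act (valOf u x) ^ s) (volume.restrict Ω) := fun s hs hsq u =>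
    integrable_act hact hN hΩ hs hsq (by linarith) hqs u
  obtain ⟨ι, hι⟩ := exists_embedding (p := p) (Ω := Ω) hN hΩ hrs
  obtain ⟨hΨ, hφ, hd, hΨd⟩ := energy_contDiff_and_fderiv hN hΩ hϑ ha R ι hι
  have hdu : ∀ u : W0 Ω p, fderiv ℝ (energy Ω p a₀ f) u u =
      (∫ x in Ω, inner ℝ (fieldA a₀ (gradOf u x)) (gradOf u x)) -
        ∫ x in Ω, f x (valOf u x) * valOf u x := by
    intro u
    rw [← hd, ← hΨd]
    ring
  obtain ⟨β, C, hβ, hrad⟩ := exists_radial_estimate hN hΩ hϑ ha hrs R (hi τ hτ0.le hτq.le)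
  obtain ⟨L, hL⟩ := exists_lower_bound_of_inactive hN hΩ ha hrs hτ0 R
  have hbdd : ∀ u : ℕ → W0 Ω p, (∃ M : ℝ, ∀ n, |energy Ω p a₀ f (u n)| ≤ M) →
      Tendsto (fun n => (1 + ‖u n‖) • fderiv ℝ (energy Ω p a₀ f) (u n)) atTop (𝓝 0) →
      ∃ M : ℝ, ∀ n, ‖u n‖ ≤ M := by
    rintro u ⟨M, hM⟩ hlim
    obtain ⟨K, hK⟩ := exists_abs_apply_le_of_tendsto hlim
    obtain ⟨Y, hY⟩ := exists_norm_bound hN hΩ hϑ ha hpr hrs hτ hτs hact R M K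
    refine ⟨Y, fun n => hY (u n) ((le_abs_self _).trans (hM n)) ?_⟩
    rw [← hdu]
    exact hK n
  have hmono : ∀ M ε : ℝ, 0 < ε → ∃ C : ℝ, 0 ≤ C ∧ ∀ u v : W0 Ω p, ‖u‖ ≤ M → ‖v‖ ≤ M →
      ‖u - v‖ ^ p ≤ ε + C * ((fderiv ℝ (energy Ω p a₀ f) u (u - v) +
        fderiv ℝ (potential Ω r f) (ι u) (ι (u - v))) - (fderiv ℝ (energy Ω p a₀ f) v (u - v) +
          fderiv ℝ (potential Ω r f) (ι v) (ι (u - v)))) := by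
    intro M ε hε
    obtain ⟨K, hK, hest⟩ := exists_monotone_estimate (p := p) (Ω := Ω) hN hΩ hϑ ha M ε hε
    refine ⟨K, hK, fun u v hu hv => ?_⟩
    rw [hd u, hd v]
    exact hest u v hu hv
  have hC : CeramiCondition (energy Ω p a₀ f) :=
    ceramiCondition_of_monotone hΨ ι hp0 hbdd
      (fun u M hM => exists_subseq_cauchySeq_embedding hN hΩ hpr hrs ι hι u hM) hmono
  refine criticalGroupsAtInfinityVanish_of_radial hφ hC hD (C := C) hp0 (fun u => ?_) hL
    fun u hu b => exists_energy_smul_lt hN hΩ hϑ ha hrs hact R (hi p hp0.le (by linarith)) hu b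
  have h1 := hrad u
  have h2 : 0 ≤ ∫ x in Ω, act (valOf u x) ^ τ :=
    integral_nonneg fun x => Real.rpow_nonneg (hact.nonneg _) _
  rw [hdu]
  nlinarith [mul_nonneg hβ.le h2]

theorem isActivity_abs : IsActivity fun s => |s| :=
  ⟨continuous_abs, abs_nonneg, fun _ => le_rfl, fun t s ht => by rw [abs_mul, abs_of_nonneg ht]⟩

theorem isActivity_signed {ε : ℝ} (hε : |ε| = 1) : IsActivity fun s => max (ε * s) 0 := by
  refine ⟨by fun_prop, fun s => le_max_right _ _, fun s => max_le ?_ (abs_nonneg s), fun t s ht => ?_⟩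
  · refine (le_abs_self _).trans ?_
    rw [abs_mul, hε, one_mul]
  · rw [mul_max_of_nonneg _ _ ht, mul_zero]
    congr 1
    ring

theorem energy_congr {g : E N → ℝ → ℝ} (h : ∀ᵐ x ∂volume.restrict Ω, g x = f x) :
    energy Ω p a₀ g = energy Ω p a₀ f := by
  ext u
  rw [energy, energy]
  congr 1
  refine integral_congr_ae ?_
  filter_upwards [h] with x hx
  rw [primitive, primitive, hx]

end Main

end EllipticDirichlet

end

open EllipticDirichlet in
theorem mainTheorem6 {N : ℕ} (hN : 1 ≤ N) (Ω : Set (E N)) (hΩ_open : IsOpen Ω)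
    (hΩ_conn : _root_.IsConnected Ω) (hΩ_bdd : Bornology.IsBounded Ω) (hΩ_bdry : HasC2Boundary Ω)
    (p : ℝ) [Fact (1 < p)] (a₀ ϑ : ℝ → ℝ) (c₁ r : ℝ) (f : E N → ℝ → ℝ)
    (hϑ : HypTheta p ϑ c₁) (ha : HypA N p a₀ ϑ) (hf : HypF Ω p c₁ r f) :
    CriticalGroupsAtInfinityVanish (energy Ω p a₀ f) ∧
      CriticalGroupsAtInfinityVanish (energy Ω p a₀ (truncPos f)) ∧
      CriticalGroupsAtInfinityVanish (energy Ω p a₀ (truncNeg f)) := by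
  obtain ⟨τ, g, hτ, hτs, hgf, hreact⟩ := hf.exists_reaction
  have hne := hΩ_conn.nonempty
  -- The reaction is replaced by its regular version g, which leaves the energy unchanged as a
  -- function. The three cases are π(s) = s, s⁺ and −s⁻, with activity |π|.
  have main : ∀ (π act : ℝ → ℝ), IsTruncation π → (∀ s, |π s| = act s) → IsActivity act →
      ContractibleSpace (activeSet Ω p act) →
      CriticalGroupsAtInfinityVanish (energy Ω p a₀ fun x s => f x (π s)) := by
    intro π act hπ hact hact' hD
    have R := hreact π hπ
    rw [funext hact] at R
    rw [← energy_congr (g := fun x s => g x (π s))]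
    · exact criticalGroupsAtInfinityVanish_energy hN hΩ_bdd hϑ ha hf.p_lt_r hf.r_lt hτ hτs hact' hD R
    · filter_upwards [hgf] with x hx
      rw [hx]
  refine ⟨main (fun s => s) (fun s => |s|) isTruncation_id (fun _ => rfl) isActivity_abs
      (contractible_activeSet_abs hN hΩ_open hΩ_bdd hne),
    main (fun s => max s 0) (fun s => max (1 * s) 0) isTruncation_pos (fun s => ?_)
      (isActivity_signed (by simp)) (contractible_activeSet_signed hΩ_open hne (by norm_num)),
    main (fun s => -max (-s) 0) (fun s => max (-1 * s) 0) isTruncation_neg (fun s => ?_)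
      (isActivity_signed (by simp)) (contractible_activeSet_signed hΩ_open hne (by norm_num))⟩
  · rw [one_mul, abs_of_nonneg (le_max_right _ _)]
  · rw [neg_one_mul, abs_neg, abs_of_nonneg (le_max_right _ _)]
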